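/- **Setup.** Let $Z_i=(X_i,A_i,Y_i)\in\mathbb R^d\times\{0,1\}\times\mathbb R$, $i\ge 0$, be i.i.d. with law $P$; fix a regular conditional law of $(A,Y)$ given $X=x$. Let $e^*(x)=P(A=1\mid X=x)$ and let $F(\cdot\mid x,a)$ be the conditional distribution function of $Y$ given $X=x,A=a$, assumed to have a density $f(\cdot\mid x,a)$. Fix $\Lambda\ge 1$ and put $\alpha=\Lambda/(\Lambda+1)$, $q_c^*(x,a)=\inf\{\beta: F(\beta\mid x,a)\ge c\}$, $q_+^*=q_\alpha^*$, $q_-^*=q_{1-\alpha}^*$, $\{b\}_+=\max\{b,0\}$, $\{b\}_-=\min\{b,0\}$, $$R_\pm(y,q)=\Lambda^{-1}y+(1-\Lambda^{-1})\Big(q+\tfrac1{1-\alpha}\{y-q\}_\pm\Big),\qquad \rho_\pm^*(x,a)=E\big[R_\pm(Y,q_\pm^*(x,a))\mid X=x,A=a\big].$$ **Sharp bounds.** $\tau^+(x)$ and $\tau^-(x)$ are the supremum and the infimum of $E_Q[Y(1)-Y(0)]$ over all laws $Q$ of $(A,Y(1),Y(0),U)$, $U\in\mathbb R^k$ with $k$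 arbitrary (conditional laws given $X=x$), such that $(A,Y(A))$ has under $Q$ the observed conditional law given $X=x$, $A\perp (Y(1),Y(0))\mid U$, and, almost surely, $e(U)=Q(A=1\mid U)\in(0,1)$ and $\Lambda^{-1}\le \frac{e(U)}{1-e(U)}\big/\frac{e^*(x)}{1-e^*(x)}\le\Lambda$. **Estimator.** Fix a sign $\pm$, $K\ge2$ folds (the fold of $i$ is $i \bmod K$), and a source of randomness $\mathcal G$ independent of the sample (for instance another sample). For each $n$ and each fold $k$ let $\hat\eta=(\hat e,\hat q_\pm(\cdot,1),\hat q_\mp(\cdot,0),\hat\rho_\pm(\cdot,1),\hat\rho_\mp(\cdot,0))$ be estimated from $\{Z_i: i<n,\ i\not\equiv k \bmod K\}$ and $\mathcal G$, and let the weights $w_i(x)=w_{n,i}(x)$ be determined by $x$, the covariates $X_0,\dots,X_{n-1}$ and $\mathcal G$. With $$\phi_1^\pm=AY+(1-A)\hat\rho_\pm(X,1)+\tfrac{(1-\hat e(X))A}{\hat e(X)}\big(R_\pm(Y,\hat q_\pm(X,1))-\hat\rho_\pm(X,1)\big),$$ $$\phi_0^\mp=(1-A)Y+A\hat\rho_\mp(X,0)+\tfrac{\hat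 e(X)(1-A)}{1-\hat e(X)}\big(R_\mp(Y,\hat q_\mp(X,0))-\hat\rho_\mp(X,0)\big),$$ and $\phi_\tau^\pm=\phi_1^\pm-\phi_0^\mp$, the linear-smoother B-Learner is $\hat\tau^\pm_n(x)=\frac1n\sum_{i<n}w_i(x)\,\hat\phi_{\tau,i}^\pm$, where $\hat\phi_{\tau,i}^\pm$ is $\phi_\tau^\pm(Z_i)$ computed with the nuisances of the fold of $i$. **Assumptions.** 1. *Boundedness.* There are $\epsilon>0$ and $B$ such that almost surely, for all $n$ and all folds and for almost every $x$: $e^*(x),\hat e(x)\in[\epsilon,1-\epsilon]$; $|Y|$, $|\hat q_\pm(x,1)|$, $|\hat q_\mp(x,0)|$, $|\hat\rho_\pm(x,1)|$, $|\hat\rho_\mp(x,0)|\le B$; $f(\cdot\mid x,1)\le B$ on the segment between $q^*_\pm(x,1)$ and $\hat q_\pm(x,1)$, and $f(\cdot\mid x,0)\le B$ on the segment between $q^*_\mp(x,0)$ and $\hat q_\mp(x,0)$. 2. *Stone's conditions* for $W_{ni}=w_i/n$. With $X$ distributed as $X_0$ and independent of the sample and of $\mathcal G$: (i) for some $C$,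 $E\sum_i|W_{ni}(X)|\,g(X_i)\le C\,E\,g(X)$ for all $n\ge 1$ and all Borel $g\ge0$; (ii) for some $D$, $\sum_i|W_{ni}(X)|\le D$ almost surely for all $n\ge 1$; (iii) $\sum_i|W_{ni}(X)|\mathbf 1\{\|X_i-X\|>a\}\to0$ in probability for all $a>0$; (iv) $\sum_iW_{ni}(X)\to1$ in probability; (v) $\max_i|W_{ni}(X)|\to0$ in probability. Moreover $\frac1n\sum_i|w_i(X)|=O_p(1)$. 3. *Uniform consistency.* In every fold, $\hat q_\pm(\cdot,1)$ and $\hat q_\mp(\cdot,0)$ are uniformly consistent for $q^*_\pm(\cdot,1)$ and $q^*_\mp(\cdot,0)$; and either $\hat e$ is uniformly consistent for $e^*$ in every fold, or $\hat\rho_\pm(\cdot,1),\hat\rho_\mp(\cdot,0)$ are uniformly consistent for $\rho^*_\pm(\cdot,1),\rho^*_\mp(\cdot,0)$ in every fold. (Uniformly consistent: the essential supremum over $x$ of the absolute error tends to $0$ in probability.) **Conclusion.** $\hat\tau^\pm_n$ converges to the sharp CATE bound $\tau^\pm$: (a) $\hat\tau^\pm_n(X)-\tau^\pm(X)\to0$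 in probability, where $X$ is an evaluation point drawn from the law of the covariates, independent of the sample and of $\mathcal G$; (b) for every fixed point $x_0$ at which $\tau^\pm$, restricted to the support of the law of $X$, is continuous, and at which the weights satisfy $\frac1n\sum_i|w_i(x_0)|=O_p(1)$ and (iii), (iv), (v) with $x_0$ in place of $X$, one has $\hat\tau^\pm_n(x_0)\to\tau^\pm(x_0)$ in probability. -/

import Mathlib

open MeasureTheory ProbabilityTheory Filter Topology Set
open scoped ENNReal NNReal

noncomputable section

namespace BLearner

/-! ### Observed data and conditional outcome functionals -/

/-- The covariate space `ℝ^d`. -/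
abbrev Cov (d : ℕ) : Type := EuclideanSpace ℝ (Fin d)

/-- One observation `Z = (X, A, Y)`; the treatment `A` is `true` for `1` and `false` for `0`. -/
abbrev Obs (d : ℕ) : Type := Cov d × Bool × ℝ

/-- The treatment as a real number in `{0, 1}`. -/
def ind (a : Bool) : ℝ := if a then 1 else 0

/-- The indicator `+` (upper bounds) or `-` (lower bounds). -/
inductive Side : Type
  | upper : Side
  | lower : Side

/-- `±` becomes `∓`. -/
def Side.flip : Side → Side
  | Side.upper => Side.lower
  | Side.lower => Side.upper

/-- `{b}₊ = max b 0` and `{b}₋ = min b 0`. -/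
def Side.part : Side → ℝ → ℝ
  | Side.upper, b => max b 0
  | Side.lower, b => min b 0

/-- `α = Λ / (Λ + 1)`. -/
def alpha (Λ : ℝ) : ℝ := Λ / (Λ + 1)

/-- The quantile level: `α` for `+` and `1 - α` for `-`. -/
def Side.level (Λ : ℝ) : Side → ℝ
  | Side.upper => alpha Λ
  | Side.lower => 1 - alpha Λ

variable {d : ℕ}

/-- The propensity score `e*(x) = P(A = 1 | X = x)`; the kernel `κ` is the conditional law of
`(A, Y)` given `X = x`. -/
def propensity (κ : Kernel (Cov d) (Bool × ℝ)) (x : Cov d) : ℝ :=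
  (κ x).real {p | p.1 = true}

/-- The conditional law of `Y` given `X = x, A = a`. -/
def outcomeLaw (κ : Kernel (Cov d) (Bool × ℝ)) (x : Cov d) (a : Bool) : Measure ℝ :=
  (ProbabilityTheory.cond (κ x) {p | p.1 = a}).map Prod.snd

/-- The conditional quantile `q*_c(x, a) = inf {β | F(β | x, a) ≥ c}`. -/
def quantile (κ : Kernel (Cov d) (Bool × ℝ)) (c : ℝ) (x : Cov d) (a : Bool) : ℝ :=
  sInf {β : ℝ | c ≤ (outcomeLaw κ x a).real (Iic β)}

/-- `q*_±(x, a)`. -/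
def qStar (Λ : ℝ) (κ : Kernel (Cov d) (Bool × ℝ)) (s : Side) (x : Cov d) (a : Bool) : ℝ :=
  quantile κ (s.level Λ) x a

/-- `H_±(z, q) = q + (1 - α)⁻¹ {y - q}_±`. -/
def H (Λ : ℝ) (s : Side) (y q : ℝ) : ℝ :=
  q + 1 / (1 - alpha Λ) * s.part (y - q)

/-- `R_±(z, q) = Λ⁻¹ y + (1 - Λ⁻¹) H_±(z, q)`. -/
def R (Λ : ℝ) (s : Side) (y q : ℝ) : ℝ :=
  Λ⁻¹ * y + (1 - Λ⁻¹) * H Λ s y q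

/-- `ρ*_±(x, a) = E[R_±(Z, q*_±) | X = x, A = a]`. -/
def rhoStar (Λ : ℝ) (κ : Kernel (Cov d) (Bool × ℝ)) (s : Side) (x : Cov d) (a : Bool) : ℝ :=
  ∫ y, R Λ s y (qStar Λ κ s x a) ∂(outcomeLaw κ x a)

/-! ### The marginal sensitivity model and the sharp CATE bounds -/

/-- Values of `(A, Y(1), Y(0), U)` with `U ∈ ℝ^k`. -/
abbrev Full (k : ℕ) : Type := Bool × ℝ × ℝ × (Fin k → ℝ)

/-- The unobserved confounder. -/
def confounder {k : ℕ} (v : Full k) : Fin k → ℝ := v.2.2.2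

theorem measurable_confounder {k : ℕ} : Measurable (confounder (k := k)) := by
  unfold confounder; fun_prop

/-- The σ-algebra generated by `U`. -/
abbrev confounderSigma (k : ℕ) : MeasurableSpace (Full k) :=
  MeasurableSpace.comap confounder inferInstance

theorem confounderSigma_le (k : ℕ) :
    confounderSigma k ≤ (inferInstance : MeasurableSpace (Full k)) :=
  measurable_confounder.comap_le

/-- `Q` is a conditional law of `(A, Y(1), Y(0), U)` given `X = x` that the observed data and the
marginal sensitivity model with parameter `Λ` cannot rule out. -/
structure Compatible (Λ : ℝ) (κ : Kernel (Cov d) (Bool × ℝ)) (x : Cov d) {k : ℕ}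
    (Q : Measure (Full k)) [IsProbabilityMeasure Q] : Prop where
  /-- `(A, Y(A))` has the observed conditional law given `X = x`. -/
  observed : Q.map (fun v => (v.1, if v.1 then v.2.1 else v.2.2.1)) = κ x
  /-- `A` is independent of `(Y(1), Y(0))` given `U` (and `X = x`). -/
  unconfounded : CondIndepFun (confounderSigma k) (confounderSigma_le k)
    (fun v : Full k => v.1) (fun v : Full k => (v.2.1, v.2.2.1)) Q
  /-- The full propensity score `e(x, U)` lies in `(0, 1)`. -/
  overlap : ∀ᵐ v ∂Q, (Q⟦{v : Full k | v.1 = true} | confounderSigma k⟧) v ∈ Ioo (0 : ℝ) 1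
  /-- The odds ratio of `e(x, U)` against `e*(x)` lies in `[Λ⁻¹, Λ]`. -/
  odds : ∀ᵐ v ∂Q,
    ((Q⟦{v : Full k | v.1 = true} | confounderSigma k⟧) v /
        (1 - (Q⟦{v : Full k | v.1 = true} | confounderSigma k⟧) v)) /
      (propensity κ x / (1 - propensity κ x)) ∈ Icc Λ⁻¹ Λ

/-- The identified set of values `E_Q[Y(1) - Y(0) | X = x]`, over all dimensions of `U`. -/
def identifiedSet (Λ : ℝ) (κ : Kernel (Cov d) (Bool × ℝ)) (x : Cov d) : Set ℝ :=
  {t | ∃ (k : ℕ) (Q : Measure (Full k)) (_ : IsProbabilityMeasure Q),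
    Compatible Λ κ x Q ∧ Integrable (fun v : Full k => v.2.1 - v.2.2.1) Q ∧
      t = ∫ v, (v.2.1 - v.2.2.1) ∂Q}

/-- The sharp CATE bounds `τ⁺(x)` (supremum) and `τ⁻(x)` (infimum). -/
def sharpCATE (Λ : ℝ) (κ : Kernel (Cov d) (Bool × ℝ)) : Side → Cov d → ℝ
  | Side.upper, x => sSup (identifiedSet Λ κ x)
  | Side.lower, x => sInf (identifiedSet Λ κ x)

/-! ### Pseudo-outcomes and the linear-smoother B-Learner -/

/-- The nuisances used for `τ^±`: the propensity score `e`, and `q_±(·, 1)`, `q_∓(·, 0)`,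
`ρ_±(·, 1)`, `ρ_∓(·, 0)`. -/
structure Nuisances (d : ℕ) where
  e : Cov d → ℝ
  q1 : Cov d → ℝ
  q0 : Cov d → ℝ
  rho1 : Cov d → ℝ
  rho0 : Cov d → ℝ

/-- The pseudo-outcome `φ₁^±`. -/
def phi1 (Λ : ℝ) (s : Side) (η : Nuisances d) (z : Obs d) : ℝ :=
  ind z.2.1 * z.2.2 + (1 - ind z.2.1) * η.rho1 z.1 +
    (1 - η.e z.1) * ind z.2.1 / η.e z.1 * (R Λ s z.2.2 (η.q1 z.1) - η.rho1 z.1)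

/-- The pseudo-outcome `φ₀^±`. -/
def phi0 (Λ : ℝ) (s : Side) (η : Nuisances d) (z : Obs d) : ℝ :=
  (1 - ind z.2.1) * z.2.2 + ind z.2.1 * η.rho0 z.1 +
    η.e z.1 * (1 - ind z.2.1) / (1 - η.e z.1) * (R Λ s z.2.2 (η.q0 z.1) - η.rho0 z.1)

/-- The pseudo-outcome `φ_τ^± = φ₁^± - φ₀^∓`. -/
def phiTau (Λ : ℝ) (s : Side) (η : Nuisances d) (z : Obs d) : ℝ :=
  phi1 Λ s η z - phi0 Λ s.flip η z

/-- The linear-smoother B-Learner `n⁻¹ ∑_{i < n} w_i(x) φ_τ^±(Z_i, η̂^{(i mod K)})`: the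
pseudo-outcome of an observation uses the nuisances fitted without its own fold. -/
def tauHat {Ω : Type*} (Λ : ℝ) (s : Side) (K : ℕ) (Z : ℕ → Ω → Obs d)
    (ηhat : ℕ → ℕ → Ω → Nuisances d) (w : ℕ → ℕ → Ω → Cov d → ℝ)
    (n : ℕ) (ω : Ω) (x : Cov d) : ℝ :=
  (1 / (n : ℝ)) * ∑ i ∈ Finset.range n,
    w n i ω x * phiTau Λ s (ηhat n (i % K) ω) (Z i ω)

/-! ### What the estimators may depend on -/

/-- The σ-algebra of the training data `{Z_i : i < n, i ≢ k mod K}` of fold `k`. -/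
abbrev trainSigma {Ω : Type*} (K : ℕ) (Z : ℕ → Ω → Obs d) (n k : ℕ) : MeasurableSpace Ω :=
  ⨆ i : {i : ℕ // i < n ∧ i % K ≠ k}, MeasurableSpace.comap (Z i) inferInstance

/-- The σ-algebra of the covariates `X_i`, `i < n`. -/
abbrev covariateSigma {Ω : Type*} (Z : ℕ → Ω → Obs d) (n : ℕ) : MeasurableSpace Ω :=
  ⨆ i : {i : ℕ // i < n}, MeasurableSpace.comap (fun ω => (Z i ω).1) inferInstance

/-- The random function `g` is jointly measurable, and random only through the σ-algebra `m`. -/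
def FittedOn {Ω : Type*} (m : MeasurableSpace Ω) (g : Ω → Cov d → ℝ) : Prop :=
  Measurable[MeasurableSpace.prod m inferInstance] (fun p : Ω × Cov d => g p.1 p.2)

/-- All components of a nuisance estimate are fitted on `m`. -/
structure NuisancesFittedOn {Ω : Type*} (m : MeasurableSpace Ω) (η : Ω → Nuisances d) : Prop where
  e : FittedOn m (fun ω => (η ω).e)
  q1 : FittedOn m (fun ω => (η ω).q1)
  q0 : FittedOn m (fun ω => (η ω).q0)
  rho1 : FittedOn m (fun ω => (η ω).rho1)
  rho0 : FittedOn m (fun ω => (η ω).rho0)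

/-! ### Assumptions -/

/-- Boundedness at a point `x`: positivity for `e*` and `e`, bounded nuisances, and conditional
outcome density `f` bounded between the true and the given quantiles. -/
structure BoundedAt (Λ : ℝ) (κ : Kernel (Cov d) (Bool × ℝ)) (s : Side)
    (f : Cov d → Bool → ℝ → ℝ) (ε B : ℝ) (η : Nuisances d) (x : Cov d) : Prop where
  e_star : propensity κ x ∈ Icc ε (1 - ε)
  e : η.e x ∈ Icc ε (1 - ε)
  q1 : |η.q1 x| ≤ B
  q0 : |η.q0 x| ≤ B
  rho1 : |η.rho1 x| ≤ B
  rho0 : |η.rho0 x| ≤ B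
  density1 : ∀ q ∈ segment ℝ (qStar Λ κ s x true) (η.q1 x), f x true q ≤ B
  density0 : ∀ q ∈ segment ℝ (qStar Λ κ s.flip x false) (η.q0 x), f x false q ≤ B

/-- Uniform consistency: `sup_x |ĝ_n(x) - g(x)| → 0` in probability, where the supremum
disregards `PX`-null sets of `x`. -/
def UniformlyConsistent {Ω : Type*} [MeasurableSpace Ω] (μ : Measure Ω) (PX : Measure (Cov d))
    (ghat : ℕ → Ω → Cov d → ℝ) (g : Cov d → ℝ) : Prop :=
  ∀ δ : ℝ, 0 < δ →
    Tendsto (fun n => μ {ω | ¬ ∀ᵐ x ∂PX, |ghat n ω x - g x| ≤ δ}) atTop (𝓝 0)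

/-- `S_n = O_p(1)`. -/
def IsBigOpOne {T : Type*} [MeasurableSpace T] (ν : Measure T) (S : ℕ → T → ℝ) : Prop :=
  ∀ δ : ℝ, 0 < δ → ∃ M : ℝ, ∀ᶠ n in atTop, ν {t | M < |S n t|} ≤ ENNReal.ofReal δ

/-- The three limit conditions in Stone's theorem, for weights `W n i` on the points `X i`,
`i < n`, and the (random or fixed) evaluation point `x`. -/
structure StoneLimits {T : Type*} [MeasurableSpace T] (ν : Measure T)
    (X : ℕ → T → Cov d) (x : T → Cov d) (W : ℕ → ℕ → T → ℝ) : Prop where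
  concentrate : ∀ a : ℝ, 0 < a → TendstoInMeasure ν
    (fun n t => ∑ i ∈ Finset.range n, {t | a < ‖X i t - x t‖}.indicator (fun t => |W n i t|) t)
    atTop (fun _ => 0)
  sum_one : TendstoInMeasure ν (fun n t => ∑ i ∈ Finset.range n, W n i t) atTop (fun _ => 1)
  max_zero : TendstoInMeasure ν (fun n t => ⨆ i : Fin n, |W n i t|) atTop (fun _ => 0)

/-- The conditions of Stone's theorem. The evaluation point is a draw from `PX` that is
independent of the sample, realized as the second coordinate of `μ.prod PX`. -/
structure StoneConditions {Ω : Type*} [MeasurableSpace Ω] (μ : Measure Ω) (PX : Measure (Cov d))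
    (X : ℕ → Ω → Cov d) (W : ℕ → ℕ → Ω → Cov d → ℝ) : Prop where
  domination : ∃ C : ℝ≥0, ∀ n : ℕ, 1 ≤ n → ∀ f : Cov d → ℝ≥0∞, Measurable f →
    ∫⁻ p, ∑ i ∈ Finset.range n, ENNReal.ofReal |W n i p.1 p.2| * f (X i p.1) ∂(μ.prod PX)
      ≤ C * ∫⁻ x, f x ∂PX
  bounded : ∃ D : ℝ, ∀ n : ℕ, 1 ≤ n →
    ∀ᵐ p ∂(μ.prod PX), ∑ i ∈ Finset.range n, |W n i p.1 p.2| ≤ D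
  limits : StoneLimits (μ.prod PX) (fun i p => X i p.1) (fun p => p.2)
    (fun n i p => W n i p.1 p.2)

end BLearner

end

set_option linter.unusedSectionVars false

namespace BLearner

/-! ### Elementary facts about levels, quantiles and `R` -/

/-! Two independent facts are combined: a closed form for the sharp bound, and consistency of the
estimator for that closed form.

Closed form (`sharpCATE_eq_tauStar`). Only the mean of `Y(a)` on the arm where it is unobserved is
not identified. Given `U` the treatment is independent of the potential outcomes, so the law of
`Y(a)` on that arm is its law on the observed arm, reweighted by the odds of the full propensity
score. These odds lie between `Λ⁻¹ r` and `Λ r`, where `r` is the observed odds. Among such weights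
the worst case puts `Λ r` on one side of a threshold `q` and `Λ⁻¹ r` on the other, and this is what
`R` encodes; hence `Compatible.arm_bound` for every `q`. At `q = qStar` the bound is attained,
simultaneously in both arms, by a binary confounder recording on which side of its quantile the
outcome falls (`exists_compatible`).

Consistency. By `tauHat_eq` the estimator is a sum of three weighted averages. The first averages
the residuals of the pseudo-outcomes. Within a fold these are orthogonal even after multiplication
by functions of the covariates, because the common fit uses no observation of the fold; Chebyshev's
inequality then applies with variance proxy `∑ W_i ^ 2 ≤ max |W_i| * ∑ |W_i|`, which vanishes. The
second averages the conditional bias of the pseudo-outcomes. It is controlled by the quantile error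
plus the product of the errors of `e` and `rho` (`BoundedAt.abs_condMean_sub_le`), so it is
uniformly small as soon as the quantiles and one factor of the product are consistent. The third
smooths the bounded measurable function `tauStar` without noise: Stone's argument handles a random
evaluation point (`StoneConditions.vanishes_sum_sub`), and localization of the weights handles a
continuity point (`StoneLimits.vanishes_sum_sub`). -/

theorem alpha_pos {Λ : ℝ} (hΛ : 1 ≤ Λ) : 0 < alpha Λ := by
  unfold alpha; positivity

theorem alpha_lt_one {Λ : ℝ} (hΛ : 1 ≤ Λ) : alpha Λ < 1 := by
  unfold alpha; rw [div_lt_one (by linarith)]; linarith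

theorem level_mem {Λ : ℝ} (hΛ : 1 ≤ Λ) (s : Side) : s.level Λ ∈ Ioo (0 : ℝ) 1 := by
  have h0 := alpha_pos hΛ
  have h1 := alpha_lt_one hΛ
  cases s <;> constructor <;> simp only [Side.level] <;> linarith

theorem level_flip (Λ : ℝ) (s : Side) : s.flip.level Λ = 1 - s.level Λ := by
  cases s <;> simp [Side.level, Side.flip]

/-- The sign of a side. -/
def Side.sgn : Side → ℝ
  | Side.upper => 1
  | Side.lower => -1

theorem sgn_flip (s : Side) : s.flip.sgn = -s.sgn := by cases s <;> simp [Side.sgn, Side.flip]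

/-- In this form `R` is visibly piecewise linear in `y`, equal to `q` at `y = q`, with slope `Λ` on
the side of `q` selected by `s` and slope `Λ⁻¹` on the other. Most later facts about `R` are read
off from it. -/
theorem R_eq {Λ : ℝ} (hΛ : 1 ≤ Λ) (s : Side) (y q : ℝ) :
    R Λ s y q = q + Λ⁻¹ * (y - q) + (Λ - Λ⁻¹) * s.part (y - q) := by
  have h : 1 / (1 - alpha Λ) = Λ + 1 := by
    have : Λ + 1 ≠ 0 := by linarith
    unfold alpha; field_simp; ring
  have : Λ ≠ 0 := by linarith
  unfold R H; rw [h]; field_simp; ring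

theorem part_abs_le (s : Side) (b : ℝ) : |s.part b| ≤ |b| := by
  cases s
  · exact (abs_max_le_max_abs_abs).trans (by simp)
  · exact (abs_min_le_max_abs_abs).trans (by simp)

theorem part_lipschitz (s : Side) (a b : ℝ) : |s.part a - s.part b| ≤ |a - b| := by
  cases s
  · exact (abs_max_sub_max_le_abs a b 0)
  · exact (abs_min_sub_min_le_max a 0 b 0).trans (by simp)

theorem continuous_part (s : Side) : Continuous s.part := by
  cases s <;> unfold Side.part <;> fun_prop

theorem measurable_R (Λ : ℝ) (s : Side) : Measurable (fun p : ℝ × ℝ => R Λ s p.1 p.2) := by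
  have := continuous_part s
  unfold R H
  exact Continuous.measurable (by fun_prop)

/-- A first-order bound in the quantile error is all that consistency needs; the constant dominates
`(1 - Λ⁻¹) + (Λ - Λ⁻¹)`. -/
theorem R_lipschitz {Λ : ℝ} (hΛ : 1 ≤ Λ) (s : Side) (y q q' : ℝ) :
    |R Λ s y q - R Λ s y q'| ≤ (1 + Λ) * |q - q'| := by
  rw [R_eq hΛ, R_eq hΛ]
  have h0 : Λ⁻¹ ≤ 1 := inv_le_one_of_one_le₀ hΛ
  have h1 : 0 < Λ⁻¹ := by positivity
  have h2 := part_lipschitz s (y - q) (y - q')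
  have h3 : |y - q - (y - q')| = |q - q'| := by rw [abs_sub_comm]; ring_nf
  rw [h3] at h2
  have : q + Λ⁻¹ * (y - q) + (Λ - Λ⁻¹) * s.part (y - q) -
      (q' + Λ⁻¹ * (y - q') + (Λ - Λ⁻¹) * s.part (y - q')) =
      (1 - Λ⁻¹) * (q - q') + (Λ - Λ⁻¹) * (s.part (y - q) - s.part (y - q')) := by ring
  rw [this]
  refine (abs_add_le _ _).trans ?_
  rw [abs_mul, abs_mul, abs_of_nonneg (by linarith : 0 ≤ 1 - Λ⁻¹),
    abs_of_nonneg (by linarith : 0 ≤ Λ - Λ⁻¹)]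
  have h5 := abs_nonneg (q - q')
  nlinarith

/-- A bound for `R` on bounded arguments. -/
theorem R_abs_le {Λ : ℝ} (hΛ : 1 ≤ Λ) (s : Side) {y q B : ℝ} (hy : |y| ≤ B) (hq : |q| ≤ B) :
    |R Λ s y q| ≤ (1 + 2 * Λ) * B := by
  rw [R_eq hΛ]
  have h0 : Λ⁻¹ ≤ 1 := inv_le_one_of_one_le₀ hΛ
  have h1 : 0 < Λ⁻¹ := by positivity
  have h2 := part_abs_le s (y - q)
  have h3 : |y - q| ≤ 2 * B := (abs_sub _ _).trans (by linarith)
  refine (abs_add_three _ _ _).trans ?_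
  rw [abs_mul, abs_mul, abs_of_pos h1, abs_of_nonneg (by linarith : 0 ≤ Λ - Λ⁻¹)]
  have h5 := abs_nonneg (y - q)
  have : Λ⁻¹ * |y - q| + (Λ - Λ⁻¹) * |s.part (y - q)| ≤ Λ * |y - q| := by nlinarith
  nlinarith

/-- Weights in `[Λ⁻¹, Λ]` times `y - q` are dominated, on the given side, by `R - q`. -/
theorem sgn_mul_weight_le {Λ : ℝ} (hΛ : 1 ≤ Λ) (s : Side) {r W : ℝ}
    (hW : Λ⁻¹ * r ≤ W) (hW' : W ≤ Λ * r) (y q : ℝ) :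
    s.sgn * (W * (y - q)) ≤ s.sgn * (r * (R Λ s y q - q)) := by
  rw [R_eq hΛ]
  -- The worst weight is extremal: `Λ * r` where `y - q` has the sign of the side, `Λ⁻¹ * r` where
  -- it has the opposite sign.
  cases s
  · simp only [Side.sgn, Side.part]
    rcases le_total 0 (y - q) with h | h
    · rw [max_eq_left h]; nlinarith
    · rw [max_eq_right h]; nlinarith
  · simp only [Side.sgn, Side.part]
    rcases le_total 0 (y - q) with h | h
    · rw [min_eq_right h]; nlinarith
    · rw [min_eq_left h]; nlinarith

/-! ### Quantiles of a probability law on the line -/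

section Quantile

variable {P : Measure ℝ} [IsProbabilityMeasure P] {c : ℝ}

theorem quantile_set_nonempty (hc1 : c < 1) : {β : ℝ | c ≤ P.real (Iic β)}.Nonempty := by
  obtain ⟨β, hβ⟩ := ((tendsto_cdf_atTop P).eventually (eventually_gt_nhds hc1)).exists
  exact ⟨β, by rw [cdf_eq_real] at hβ; exact hβ.le⟩

theorem quantile_set_bddBelow (hc0 : 0 < c) : BddBelow {β : ℝ | c ≤ P.real (Iic β)} := by
  obtain ⟨β, hβ⟩ := ((tendsto_cdf_atBot P).eventually (eventually_lt_nhds hc0)).exists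
  refine ⟨β, fun γ hγ => ?_⟩
  by_contra! h
  have := monotone_cdf P h.le
  simp only [mem_ofPred_eq, ← cdf_eq_real] at hγ
  linarith

/-- Right continuity of the distribution function makes the infimum a minimum. -/
theorem le_cdf_quantile (hc1 : c < 1) :
    c ≤ P.real (Iic (sInf {β : ℝ | c ≤ P.real (Iic β)})) := by
  set q := sInf {β : ℝ | c ≤ P.real (Iic β)} with hq
  rw [← cdf_eq_real]
  have h : Tendsto (cdf P) (𝓝[>] q) (𝓝 (cdf P q)) := ((cdf P).right_continuous q).mono Ioi_subset_Ici_self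
  refine ge_of_tendsto h ?_
  filter_upwards [self_mem_nhdsWithin] with y hy
  obtain ⟨β, hβ, hβy⟩ := exists_lt_of_csInf_lt (quantile_set_nonempty hc1) hy
  simp only [mem_ofPred_eq, ← cdf_eq_real] at hβ
  exact hβ.trans (monotone_cdf P hβy.le)

/-- The Galois connection between quantile and distribution function; it also yields measurability
of the conditional quantile in `x`. -/
theorem quantile_le_iff (hc0 : 0 < c) (hc1 : c < 1) (β : ℝ) :
    sInf {β : ℝ | c ≤ P.real (Iic β)} ≤ β ↔ c ≤ P.real (Iic β) := by
  refine ⟨fun h => ?_, fun h => csInf_le (quantile_set_bddBelow hc0) h⟩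
  have h2 := monotone_cdf P h
  rw [cdf_eq_real, cdf_eq_real] at h2
  exact (le_cdf_quantile hc1).trans h2

/-- Left of the quantile the distribution function is below `c`, and without an atom there is no
jump at the quantile. The exact value `c` is what lets the worst-case reweighting keep total mass
one. -/
theorem cdf_quantile [NullSingletonClass P] (hc0 : 0 < c) (hc1 : c < 1) :
    P.real (Iic (sInf {β : ℝ | c ≤ P.real (Iic β)})) = c := by
  refine le_antisymm ?_ (le_cdf_quantile hc1)
  set q := sInf {β : ℝ | c ≤ P.real (Iic β)} with hq
  have h1 := (cdf P).measure_singleton q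
  rw [measure_cdf, measure_singleton] at h1
  have h2 : cdf P q ≤ Function.leftLim (cdf P) q := by
    have := ENNReal.ofReal_eq_zero.1 h1.symm
    linarith
  rw [← cdf_eq_real]
  refine h2.trans ?_
  refine le_of_tendsto ((monotone_cdf P).tendsto_leftLim q) ?_
  filter_upwards [self_mem_nhdsWithin] with y hy
  by_contra! h
  have : q ≤ y := (quantile_le_iff hc0 hc1 y).2 (by rw [← cdf_eq_real]; exact h.le)
  exact absurd hy (not_lt.2 this)

theorem abs_quantile_le (hc0 : 0 < c) (hc1 : c < 1) {B : ℝ} (hB : ∀ᵐ y ∂P, |y| ≤ B) :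
    |sInf {β : ℝ | c ≤ P.real (Iic β)}| ≤ B := by
  rw [abs_le]
  constructor
  · refine le_csInf (quantile_set_nonempty hc1) fun β hβ => ?_
    by_contra! h
    have : P (Iic β) = 0 := by
      rw [measure_eq_zero_iff_ae_notMem]
      filter_upwards [hB] with y hy hyβ
      rw [abs_le] at hy
      simp only [mem_Iic] at hyβ
      linarith
    simp only [mem_ofPred_eq, measureReal_def, this, ENNReal.toReal_zero] at hβ
    linarith
  · rw [quantile_le_iff hc0 hc1]
    have : P (Iic B) = 1 := by
      rw [prob_compl_eq_zero_iff measurableSet_Iic |>.symm]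
      rw [measure_eq_zero_iff_ae_notMem]
      filter_upwards [hB] with y hy hyβ
      rw [abs_le] at hy
      exact hyβ hy.2
    simp [measureReal_def, this, hc1.le]

end Quantile

end BLearner

namespace BLearner

/-! ### The bounds on the identified set -/

/-- Inverse-probability weighting under conditional independence, as an identity of measures. -/
theorem map_restrict_eq_map_withDensity {Ω : Type*} {m mΩ : MeasurableSpace Ω}
    [StandardBorelSpace Ω] {hm : m ≤ mΩ} {Q : Measure Ω} [IsProbabilityMeasure Q]
    {A : Ω → Bool} {Y : Ω → ℝ} (hA : Measurable A) (hY : Measurable Y)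
    (hci : CondIndepFun m hm A Y Q) {a b : Bool} {W : Ω → ℝ} (hW : StronglyMeasurable[m] W)
    {M : ℝ} (hW0 : ∀ᵐ ω ∂Q, 0 ≤ W ω) (hWM : ∀ᵐ ω ∂Q, W ω ≤ M)
    (hWe : ∀ᵐ ω ∂Q, W ω * (Q⟦A ⁻¹' {a} | m⟧) ω = (Q⟦A ⁻¹' {b} | m⟧) ω) :
    (Q.restrict (A ⁻¹' {b})).map Y =
      ((Q.restrict (A ⁻¹' {a})).withDensity (fun ω => ENNReal.ofReal (W ω))).map Y := by
  rw [condIndepFun_iff_condExp_inter_preimage_eq_mul hA hY] at hci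
  ext T hT
  have hAs : ∀ c, MeasurableSet (A ⁻¹' {c}) := fun c => hA (measurableSet_singleton c)
  have hTs : MeasurableSet (Y ⁻¹' T) := hY hT
  have hWm : Measurable W := (hW.mono hm).measurable
  have hWi : Integrable W Q := by
    refine Integrable.of_bound hWm.aestronglyMeasurable M ?_
    filter_upwards [hW0, hWM] with ω h0 h1
    rwa [Real.norm_eq_abs, abs_of_nonneg h0]
  rw [Measure.map_apply hY hT, Measure.map_apply hY hT, Measure.restrict_apply hTs,
    withDensity_apply _ hTs, Measure.restrict_restrict hTs,
    ← ofReal_integral_eq_lintegral_ofReal hWi.integrableOn (ae_restrict_of_ae hW0),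
    inter_comm, inter_comm _ (A ⁻¹' {a}), ← ENNReal.ofReal_toReal (measure_ne_top Q _)]
  congr 1
  have hone : ∀ S, MeasurableSet S → Integrable (S.indicator fun _ => (1 : ℝ)) Q := fun S hS =>
    (integrable_const _).indicator hS
  -- Pull the `m`-measurable `W` out and factor by conditional independence: `W` turns the
  -- conditional probability of `A = a` into that of `A = b`, and the factor of `Y` is untouched.
  have key : ∀ᵐ ω ∂Q, (Q[fun ω => W ω * (A ⁻¹' {a} ∩ Y ⁻¹' T).indicator (fun _ => (1 : ℝ)) ω | m]) ω =
      (Q⟦A ⁻¹' {b} ∩ Y ⁻¹' T | m⟧) ω := by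
    have h1 := condExp_mul_of_stronglyMeasurable_left (μ := Q)
      (g := (A ⁻¹' {a} ∩ Y ⁻¹' T).indicator fun _ => (1 : ℝ)) hW (by
        refine Integrable.mul_bdd (c := 1) hWi ((hone _ ((hAs a).inter hTs)).1) ?_
        refine Eventually.of_forall fun ω => ?_
        by_cases h : ω ∈ A ⁻¹' {a} ∩ Y ⁻¹' T <;> simp [indicator, h]) (hone _ ((hAs a).inter hTs))
    filter_upwards [h1, hci {a} T (measurableSet_singleton a) hT,
      hci {b} T (measurableSet_singleton b) hT, hWe] with ω h1 h2 h3 h4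
    rw [h3, ← h4, mul_assoc, ← h2]
    exact h1
  have h2 := integral_congr_ae key
  rw [integral_condExp hm, integral_condExp hm, integral_indicator_const _ ((hAs b).inter hTs)] at h2
  rw [← measureReal_def, ← integral_indicator ((hAs a).inter hTs)]
  simp only [smul_eq_mul, mul_one] at h2
  rw [← h2]
  refine integral_congr_ae (Eventually.of_forall fun ω => ?_)
  by_cases h : ω ∈ A ⁻¹' {a} ∩ Y ⁻¹' T <;> simp [indicator, h]

variable {d : ℕ} {κ : Kernel (Cov d) (Bool × ℝ)} {x : Cov d}

theorem measurableSet_arm (a : Bool) : MeasurableSet {p : Bool × ℝ | p.1 = a} :=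
  measurable_fst (measurableSet_singleton a)

theorem setIntegral_arm [IsFiniteMeasure (κ x)] {a : Bool} (h : (κ x).real {p | p.1 = a} ≠ 0)
    {ψ : ℝ → ℝ} (hψ : Measurable ψ) :
    ∫ p in {p | p.1 = a}, ψ p.2 ∂(κ x) =
      (κ x).real {p | p.1 = a} * ∫ y, ψ y ∂(outcomeLaw κ x a) := by
  rw [outcomeLaw, integral_map (by fun_prop) hψ.aestronglyMeasurable, ProbabilityTheory.cond,
    integral_smul_measure, ENNReal.toReal_inv, ← measureReal_def, smul_eq_mul]
  field_simp

/-- Conditions on the observed conditional law at `x`: overlap, no atoms, bounded outcomes. -/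
structure RegularAt (κ : Kernel (Cov d) (Bool × ℝ)) (B : ℝ) (x : Cov d) : Prop where
  overlap : propensity κ x ∈ Ioo (0 : ℝ) 1
  nullSingleton : ∀ a, NullSingletonClass (outcomeLaw κ x a)
  bounded : ∀ᵐ p ∂(κ x), |p.2| ≤ B

theorem prob_false_arm [IsProbabilityMeasure (κ x)] :
    (κ x).real {p | p.1 = false} = 1 - propensity κ x := by
  have : {p : Bool × ℝ | p.1 = false} = {p | p.1 = true}ᶜ := by ext; simp
  rw [this, probReal_compl_eq_one_sub (measurableSet_arm true)]; rfl

theorem RegularAt.prob_arm_pos [IsProbabilityMeasure (κ x)] {B : ℝ} (h : RegularAt κ B x)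
    (a : Bool) : 0 < (κ x).real {p | p.1 = a} := by
  cases a
  · rw [prob_false_arm]; linarith [h.overlap.2]
  · exact h.overlap.1

theorem RegularAt.isProbabilityMeasure_outcomeLaw [IsProbabilityMeasure (κ x)] {B : ℝ}
    (h : RegularAt κ B x) (a : Bool) : IsProbabilityMeasure (outcomeLaw κ x a) := by
  have h0 : κ x {p | p.1 = a} ≠ 0 := fun h0 => by
    have := h.prob_arm_pos a
    rw [measureReal_def, h0] at this
    simp at this
  have := cond_isProbabilityMeasure h0
  exact Measure.isProbabilityMeasure_map (by fun_prop)

theorem RegularAt.outcome_bounded {B : ℝ} (h : RegularAt κ B x) (a : Bool) :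
    ∀ᵐ y ∂(outcomeLaw κ x a), |y| ≤ B := by
  refine (ae_map_iff (by fun_prop) (measurableSet_le (by fun_prop) (by fun_prop))).2 ?_
  exact cond_absolutelyContinuous.ae_le h.bounded

theorem RegularAt.abs_qStar_le [IsProbabilityMeasure (κ x)] {B : ℝ} (h : RegularAt κ B x)
    {Λ : ℝ} (hΛ : 1 ≤ Λ) (s : Side) (a : Bool) : |qStar Λ κ s x a| ≤ B := by
  have := h.isProbabilityMeasure_outcomeLaw a
  exact abs_quantile_le (level_mem hΛ s).1 (level_mem hΛ s).2 (h.outcome_bounded a)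

theorem RegularAt.cdf_qStar [IsProbabilityMeasure (κ x)] {B : ℝ} (h : RegularAt κ B x)
    {Λ : ℝ} (hΛ : 1 ≤ Λ) (s : Side) (a : Bool) :
    (outcomeLaw κ x a).real (Iic (qStar Λ κ s x a)) = s.level Λ := by
  have := h.isProbabilityMeasure_outcomeLaw a
  have := h.nullSingleton a
  exact cdf_quantile (level_mem hΛ s).1 (level_mem hΛ s).2

/-- The potential outcome under treatment `a`. -/
def potential {k : ℕ} (a : Bool) (v : Full k) : ℝ := if a then v.2.1 else v.2.2.1

theorem measurable_potential {k : ℕ} (a : Bool) : Measurable (potential (k := k) a) := by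
  cases a
  · exact measurable_snd.snd.fst
  · exact measurable_snd.fst

theorem measurable_observed {k : ℕ} :
    Measurable (fun v : Full k => (v.1, if v.1 then v.2.1 else v.2.2.1)) := by
  refine measurable_fst.prodMk (Measurable.ite (measurable_fst (measurableSet_singleton true)) ?_ ?_)
  all_goals fun_prop

section Compatible

variable {Λ : ℝ} {k : ℕ} {Q : Measure (Full k)} [IsProbabilityMeasure Q]

/-- On the arm `a` the potential outcome is the observed one, so this part of its law is identified.
-/
theorem Compatible.setIntegral_potential (hQ : Compatible Λ κ x Q) (a : Bool) {ψ : ℝ → ℝ}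
    (hψ : Measurable ψ) :
    ∫ v in (fun v => v.1) ⁻¹' {a}, ψ (potential a v) ∂Q = ∫ p in {p | p.1 = a}, ψ p.2 ∂(κ x) := by
  rw [← hQ.observed, setIntegral_map (measurableSet_arm a)
    (f := fun p => ψ p.2) (hψ.comp measurable_snd).aestronglyMeasurable measurable_observed.aemeasurable]
  refine setIntegral_congr_fun (measurable_fst (measurableSet_singleton a)) fun v hv => ?_
  have : v.1 = a := hv
  simp [potential, this]

theorem Compatible.prob_arm (hQ : Compatible Λ κ x Q) (a : Bool) :
    Q.real ((fun v => v.1) ⁻¹' {a}) = (κ x).real {p | p.1 = a} := by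
  rw [← hQ.observed, map_measureReal_apply measurable_observed (measurableSet_arm a)]
  rfl

theorem Compatible.potential_bounded (hQ : Compatible Λ κ x Q) {B : ℝ}
    (hB : ∀ᵐ p ∂(κ x), |p.2| ≤ B) (a : Bool) :
    ∀ᵐ v ∂(Q.restrict ((fun v => v.1) ⁻¹' {a})), |potential a v| ≤ B := by
  rw [← hQ.observed] at hB
  have := ae_of_ae_map measurable_observed.aemeasurable hB
  rw [ae_restrict_iff' (measurable_fst (measurableSet_singleton a))]
  filter_upwards [this] with v hv hva
  have : v.1 = a := hva
  simpa [potential, this] using hv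

/-- Bound on the unobserved part of the mean of one potential outcome. -/
theorem Compatible.arm_bound (hΛ : 1 ≤ Λ) (hQ : Compatible Λ κ x Q) [IsProbabilityMeasure (κ x)]
    {B : ℝ} (hx : RegularAt κ B x) (a : Bool) (s : Side) (q : ℝ)
    {W : Full k → ℝ} (hW : StronglyMeasurable[confounderSigma k] W) {r : ℝ}
    (hr : r * (κ x).real {p | p.1 = a} = (κ x).real {p | p.1 = !a})
    (hW0 : ∀ᵐ v ∂Q, Λ⁻¹ * r ≤ W v) (hWM : ∀ᵐ v ∂Q, W v ≤ Λ * r)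
    (hWe : ∀ᵐ v ∂Q, W v * (Q⟦(fun v => v.1) ⁻¹' {a} | confounderSigma k⟧) v =
      (Q⟦(fun v => v.1) ⁻¹' {!a} | confounderSigma k⟧) v) :
    Integrable (potential a) Q ∧
    s.sgn * ∫ v in (fun v => v.1) ⁻¹' {!a}, potential a v ∂Q ≤
      s.sgn * ((κ x).real {p | p.1 = !a} * ∫ y, R Λ s y q ∂(outcomeLaw κ x a)) := by
  have hpa := hx.prob_arm_pos a
  have hpb := hx.prob_arm_pos (!a)
  have hr0 : 0 < r := by
    by_contra! h
    nlinarith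
  have hΛi : 0 < Λ⁻¹ := by positivity
  have hYm := measurable_potential (k := k) a
  have hci : CondIndepFun (confounderSigma k) (confounderSigma_le k)
      (fun v : Full k => v.1) (potential a) Q := by
    have : Measurable (fun p : ℝ × ℝ => if a then p.1 else p.2) := by cases a <;> simp <;> fun_prop
    exact hQ.unconfounded.comp measurable_id this
  have hW0' : ∀ᵐ v ∂Q, 0 ≤ W v := hW0.mono fun v hv => (by positivity : 0 ≤ Λ⁻¹ * r).trans hv
  have hmap := map_restrict_eq_map_withDensity measurable_fst hYm hci hW hW0' hWM hWe
  have hWm : Measurable W := (hW.mono (confounderSigma_le k)).measurable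
  set Qa := Q.restrict ((fun v => v.1) ⁻¹' {a}) with hQa
  set Qb := Q.restrict ((fun v => v.1) ⁻¹' {!a}) with hQb
  have hbda := hQ.potential_bounded hx.bounded a
  have hms : MeasurableSet {y : ℝ | |y| ≤ B} := measurableSet_le (by fun_prop) (by fun_prop)
  -- Compatibility does not bound the unobserved potential outcome directly; its law on the other
  -- arm is absolutely continuous with respect to its law on the observed arm, and inherits the
  -- bound.
  have hbdb : ∀ᵐ v ∂Qb, |potential a v| ≤ B := by
    rw [← ae_map_iff hYm.aemeasurable hms, hmap, ae_map_iff hYm.aemeasurable hms]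
    exact (withDensity_absolutelyContinuous _ _).ae_le hbda
  have hia : Integrable (potential a) Qa := Integrable.of_bound hYm.aestronglyMeasurable B hbda
  have hib : Integrable (potential a) Qb := Integrable.of_bound hYm.aestronglyMeasurable B hbdb
  have hint : Integrable (potential a) Q := by
    have hcompl : ((fun v : Full k => v.1) ⁻¹' {!a}) = ((fun v => v.1) ⁻¹' {a})ᶜ := by
      ext v; cases a <;> simp
    rw [hQb, hcompl] at hib
    rw [← Measure.restrict_add_restrict_compl (μ := Q) (s := (fun v => v.1) ⁻¹' {a})
      (measurable_fst (measurableSet_singleton a))]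
    exact hia.add_measure hib
  have hWψ : ∀ ψ : ℝ → ℝ, Measurable ψ → ∫ v, ψ (potential a v) ∂Qb =
      ∫ v, W v * ψ (potential a v) ∂Qa := fun ψ hψ => by
    rw [← integral_map hYm.aemeasurable hψ.aestronglyMeasurable, hmap,
      integral_map hYm.aemeasurable hψ.aestronglyMeasurable,
      integral_withDensity_eq_integral_toReal_smul hWm.ennreal_ofReal (by simp)]
    refine integral_congr_ae ?_
    filter_upwards [ae_restrict_of_ae hW0'] with v hv
    simp [ENNReal.toReal_ofReal hv]
  have hRm : Measurable (fun y => R Λ s y q) :=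
    (measurable_R Λ s).comp (measurable_id.prodMk measurable_const)
  have hRi : Integrable (fun v => R Λ s (potential a v) q) Qa := by
    refine Integrable.of_bound (hRm.comp hYm).aestronglyMeasurable ((1 + 2 * Λ) * max B |q|) ?_
    filter_upwards [hbda] with v hv
    exact R_abs_le hΛ s (hv.trans (le_max_left _ _)) (le_max_right _ _)
  refine ⟨hint, ?_⟩
  -- Centring at `q` is needed because the pointwise comparison of `W` with the extremal weights
  -- concerns `y - q`.
  have h1 := hWψ (fun y => y - q) (by fun_prop)
  have h2 : ∫ v, (potential a v - q) ∂Qb =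
      ∫ v, potential a v ∂Qb - q * (κ x).real {p | p.1 = !a} := by
    rw [integral_sub hib (integrable_const _), integral_const, smul_eq_mul, hQb, measureReal_restrict_apply_univ,
      hQ.prob_arm, mul_comm q]
  have h3 : s.sgn * ∫ v, W v * (potential a v - q) ∂Qa ≤
      s.sgn * ∫ v, r * (R Λ s (potential a v) q - q) ∂Qa := by
    rw [← integral_const_mul, ← integral_const_mul]
    refine integral_mono_ae ?_ ?_ ?_
    · refine Integrable.const_mul ?_ _
      refine (hia.sub (integrable_const q)).bdd_mul (c := Λ * r) hWm.aestronglyMeasurable ?_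
      filter_upwards [ae_restrict_of_ae hW0', ae_restrict_of_ae hWM] with v h h'
      rwa [Real.norm_eq_abs, abs_of_nonneg h]
    · exact ((hRi.sub (integrable_const q)).const_mul r).const_mul _
    · filter_upwards [ae_restrict_of_ae hW0, ae_restrict_of_ae hWM] with v h h'
      exact sgn_mul_weight_le hΛ s h h' _ _
  -- By `hr` the constant weight `r` carries the mass of arm `a` to that of the other arm, so the
  -- terms in `q` cancel against those of `h2`.
  have h4 : ∫ v, r * (R Λ s (potential a v) q - q) ∂Qa =
      (κ x).real {p | p.1 = !a} * ∫ y, R Λ s y q ∂(outcomeLaw κ x a) -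
        q * (κ x).real {p | p.1 = !a} := by
    rw [integral_const_mul, integral_sub hRi (integrable_const _), integral_const, smul_eq_mul,
      hQa, measureReal_restrict_apply_univ, hQ.prob_arm, hQ.setIntegral_potential a hRm,
      setIntegral_arm hpa.ne' hRm, ← hr]
    ring
  rw [← h1, h2, h4] at h3
  linarith

end Compatible

end BLearner

namespace BLearner

/-- The closed form of the sharp bounds. -/
noncomputable def tauStar {d : ℕ} (Λ : ℝ) (κ : Kernel (Cov d) (Bool × ℝ)) (s : Side)
    (x : Cov d) : ℝ :=
  propensity κ x * (∫ y, y ∂(outcomeLaw κ x true) - rhoStar Λ κ s.flip x false) +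
    (1 - propensity κ x) * (rhoStar Λ κ s x true - ∫ y, y ∂(outcomeLaw κ x false))

variable {d : ℕ} {κ : Kernel (Cov d) (Bool × ℝ)} {x : Cov d}

theorem condExp_arm_false {k : ℕ} (Q : Measure (Full k)) [IsProbabilityMeasure Q] :
    ∀ᵐ v ∂Q, (Q⟦(fun v : Full k => v.1) ⁻¹' {false} | confounderSigma k⟧) v =
      1 - (Q⟦{v : Full k | v.1 = true} | confounderSigma k⟧) v := by
  have hs : MeasurableSet {v : Full k | v.1 = true} := measurable_fst (measurableSet_singleton true)
  have h : ((fun v : Full k => v.1) ⁻¹' {false}).indicator (fun _ => (1 : ℝ)) =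
      (fun _ => (1 : ℝ)) - {v : Full k | v.1 = true}.indicator (fun _ => (1 : ℝ)) := by
    ext v
    rcases hv : v.1 <;> simp [indicator, hv]
  rw [h]
  have h2 := condExp_sub (m := confounderSigma k) (integrable_const (μ := Q) (1 : ℝ))
    ((integrable_const (μ := Q) (1 : ℝ)).indicator hs)
  rw [condExp_const (confounderSigma_le k)] at h2
  filter_upwards [h2] with v hv
  rw [hv]; rfl

/-- Split each mean into its identified arm and the other arm, and bound the latter by `arm_bound`
at the true quantile. `Y(0)` enters with a minus sign, hence with the flipped side. The factor
`s.sgn` treats upper and lower bounds at once. -/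
theorem Compatible.sgn_mul_integral_le {Λ : ℝ} (hΛ : 1 ≤ Λ) {k : ℕ} {Q : Measure (Full k)}
    [IsProbabilityMeasure Q] (hQ : Compatible Λ κ x Q) [IsProbabilityMeasure (κ x)]
    {B : ℝ} (hx : RegularAt κ B x) (s : Side) :
    s.sgn * ∫ v, (v.2.1 - v.2.2.1) ∂Q ≤ s.sgn * tauStar Λ κ s x := by
  obtain ⟨hp0, hp1⟩ := hx.overlap
  have hΛ0 : 0 < Λ := by linarith
  set p := propensity κ x with hp
  set e := Q⟦{v : Full k | v.1 = true} | confounderSigma k⟧ with he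
  have hem : Measurable[confounderSigma k] e := stronglyMeasurable_condExp.measurable
  have hpt : (κ x).real {p | p.1 = true} = p := rfl
  -- For `Y(1)` the weights are the inverse odds, so the upper odds bound gives the lower weight
  -- bound and conversely; `[Λ⁻¹, Λ]` is invariant under inversion.
  have h1 := hQ.arm_bound hΛ hx true s (qStar Λ κ s x true) (W := fun v => (1 - e v) / e v)
    (r := (1 - p) / p) (Measurable.stronglyMeasurable ((measurable_const.sub hem).div hem)) (by
      simp only [Bool.not_true, prob_false_arm, hpt, ← hp]; field_simp)
    (by
      filter_upwards [hQ.overlap, hQ.odds] with v ⟨h0, h1⟩ ⟨h2, h3⟩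
      rw [div_le_iff₀ (by apply div_pos <;> linarith), div_le_iff₀ (by linarith)] at h3
      rw [le_div_iff₀ h0, inv_mul_eq_div, div_mul_eq_mul_div, div_le_iff₀ hΛ0, div_mul_eq_mul_div,
        div_le_iff₀ hp0]
      have : Λ * (p / (1 - p)) * (1 - e v) = Λ * p * (1 - e v) / (1 - p) := by
        field_simp [show 1 - p ≠ 0 by linarith]
      rw [this, le_div_iff₀ (by linarith)] at h3
      linarith)
    (by
      filter_upwards [hQ.overlap, hQ.odds] with v ⟨h0, h1⟩ ⟨h2, h3⟩
      rw [le_div_iff₀ (by apply div_pos <;> linarith), le_div_iff₀ (by linarith), inv_mul_eq_div,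
        div_mul_eq_mul_div, div_le_iff₀ hΛ0, div_mul_eq_mul_div, div_le_iff₀ (by linarith)] at h2
      rw [div_le_iff₀ h0]
      have : Λ * ((1 - p) / p) * e v = Λ * (1 - p) * e v / p := by field_simp
      rw [this, le_div_iff₀ hp0]
      linarith)
    (by
      filter_upwards [hQ.overlap, condExp_arm_false Q] with v ⟨h0, h1⟩ h
      exact (div_mul_cancel₀ _ h0.ne').trans h.symm)
  have h0 := hQ.arm_bound hΛ hx false s.flip (qStar Λ κ s.flip x false)
    (W := fun v => e v / (1 - e v))
    (r := p / (1 - p)) (Measurable.stronglyMeasurable (hem.div (measurable_const.sub hem))) (by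
      simp only [Bool.not_false, prob_false_arm, hpt, ← hp]
      field_simp [show 1 - p ≠ 0 by linarith])
    (by
      filter_upwards [hQ.overlap, hQ.odds] with v ⟨h0, h1⟩ ⟨h2, h3⟩
      rwa [le_div_iff₀ (by apply div_pos <;> linarith)] at h2)
    (by
      filter_upwards [hQ.overlap, hQ.odds] with v ⟨h0, h1⟩ ⟨h2, h3⟩
      rwa [div_le_iff₀ (by apply div_pos <;> linarith)] at h3)
    (by
      filter_upwards [hQ.overlap, condExp_arm_false Q] with v ⟨h0, h1⟩ h
      rw [h]
      exact div_mul_cancel₀ _ (by linarith))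
  have hsplit : ∀ a, Integrable (potential (k := k) a) Q → ∫ v, potential a v ∂Q =
      (κ x).real {p | p.1 = a} * ∫ y, y ∂(outcomeLaw κ x a) +
        ∫ v in (fun v => v.1) ⁻¹' {!a}, potential a v ∂Q := fun a hi => by
    have hcompl : ((fun v : Full k => v.1) ⁻¹' {!a}) = ((fun v => v.1) ⁻¹' {a})ᶜ := by
      ext v; cases a <;> simp
    rw [hcompl, ← integral_add_compl (measurable_fst (measurableSet_singleton a)) hi]
    congr 1
    exact (hQ.setIntegral_potential a measurable_id).trans
      (setIntegral_arm (hx.prob_arm_pos a).ne' measurable_id)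
  have : ∫ v : Full k, (v.2.1 - v.2.2.1) ∂Q =
      ∫ v, potential true v ∂Q - ∫ v, potential false v ∂Q := integral_sub h1.1 h0.1
  rw [this, hsplit true h1.1, hsplit false h0.1]
  have h1 := h1.2
  have h0 := h0.2
  rw [sgn_flip] at h0
  simp only [Bool.not_true, Bool.not_false, prob_false_arm, hpt, ← hp] at h1 h0 ⊢
  change _ ≤ s.sgn * ((1 - p) * rhoStar Λ κ s x true) at h1
  change _ ≤ -s.sgn * (p * rhoStar Λ κ s.flip x false) at h0
  rw [tauStar, ← hp]
  linarith

/-! ### A binary confounder attains the bounds -/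

/-- The value of the confounder that encodes a Boolean. -/
def confounderValue (u : Bool) : Fin 1 → ℝ := fun _ => if u then 1 else 0

/-- Attach the confounder value `u` to values of `(A, Y(1), Y(0))`. -/
def attach (u : Bool) (z : Bool × ℝ × ℝ) : Full 1 := (z.1, z.2.1, z.2.2, confounderValue u)

theorem measurable_attach (u : Bool) : Measurable (attach u) := by
  unfold attach; fun_prop

/-- The mixture of the laws `m u` of `(A, Y(1), Y(0))` over a binary confounder. -/
noncomputable def mixture (p : Bool → ℝ) (m : Bool → Measure (Bool × ℝ × ℝ)) : Measure (Full 1) :=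
  ∑ u, ENNReal.ofReal (p u) • (m u).map (attach u)

section Mixture

variable {p : Bool → ℝ} {m : Bool → Measure (Bool × ℝ × ℝ)}

theorem integrable_mixture {f : Full 1 → ℝ} (hf : Measurable f)
    (hi : ∀ u, Integrable (fun z => f (attach u z)) (m u)) : Integrable f (mixture p m) := by
  refine integrable_finsetSum_measure.2 fun u _ => Integrable.smul_measure ?_ ENNReal.ofReal_ne_top
  exact (integrable_map_measure hf.aestronglyMeasurable (measurable_attach u).aemeasurable).2 (hi u)

theorem integral_mixture (hp : ∀ u, 0 ≤ p u) {f : Full 1 → ℝ} (hf : Measurable f)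
    (hi : ∀ u, Integrable (fun z => f (attach u z)) (m u)) :
    ∫ v, f v ∂(mixture p m) = ∑ u, p u * ∫ z, f (attach u z) ∂(m u) := by
  rw [mixture, integral_finsetSum_measure]
  · refine Finset.sum_congr rfl fun u _ => ?_
    rw [integral_smul_measure, integral_map (measurable_attach u).aemeasurable
      hf.aestronglyMeasurable, ENNReal.toReal_ofReal (hp u), smul_eq_mul]
  · refine fun u _ => Integrable.smul_measure ?_ ENNReal.ofReal_ne_top
    exact (integrable_map_measure hf.aestronglyMeasurable (measurable_attach u).aemeasurable).2 (hi u)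

variable [∀ u, IsProbabilityMeasure (m u)]

theorem isProbabilityMeasure_mixture (hp : ∀ u, 0 ≤ p u) (hp1 : ∑ u, p u = 1) :
    IsProbabilityMeasure (mixture p m) := by
  constructor
  have : ∀ u, (m u).map (attach u) univ = 1 := fun u => by
    rw [Measure.map_apply (measurable_attach u) MeasurableSet.univ]; simp
  simp only [mixture, Measure.coe_finsetSum, Finset.sum_apply, Measure.smul_apply, this, smul_eq_mul,
    mul_one]
  rw [← ENNReal.ofReal_sum_of_nonneg fun u _ => hp u, hp1, ENNReal.ofReal_one]

theorem mixture_real (hp : ∀ u, 0 ≤ p u) {E : Set (Full 1)} (hE : MeasurableSet E) :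
    (mixture p m).real E = ∑ u, p u * (m u).real (attach u ⁻¹' E) := by
  rw [← integral_indicator_one hE, integral_mixture hp (measurable_one.indicator hE)]
  · refine Finset.sum_congr rfl fun u _ => ?_
    rw [← integral_indicator_one (measurable_attach u hE)]
    rfl
  · intro u
    exact (integrable_const (1 : ℝ)).indicator (measurable_attach u hE)

-- The two values of the confounder differ, so `U` reveals the component of the mixture, and the
-- conditional probability is the probability under that component.
open Classical in
theorem condExp_mixture (hp : ∀ u, 0 ≤ p u) (hp1 : ∑ u, p u = 1) {E : Set (Full 1)}
    (hE : MeasurableSet E) :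
    ((mixture p m)⟦E | confounderSigma 1⟧) =ᵐ[mixture p m] fun v =>
      if confounder v = confounderValue true then (m true).real (attach true ⁻¹' E)
      else (m false).real (attach false ⁻¹' E) := by
  have := isProbabilityMeasure_mixture (m := m) hp hp1
  have hU : Measurable[confounderSigma 1] (confounder (k := 1)) := comap_measurable _
  have hs : MeasurableSet[confounderSigma 1] {v : Full 1 | confounder v = confounderValue true} :=
    hU (measurableSet_singleton _)
  have hg : Measurable[confounderSigma 1] fun v : Full 1 =>
      if confounder v = confounderValue true then (m true).real (attach true ⁻¹' E)
      else (m false).real (attach false ⁻¹' E) :=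
    Measurable.ite hs measurable_const measurable_const
  have hgm := hg.mono (confounderSigma_le 1) le_rfl
  have hne : confounderValue false ≠ confounderValue true := fun h => by
    simpa [confounderValue] using congrFun h 0
  have hgi : Integrable (fun v : Full 1 =>
      if confounder v = confounderValue true then (m true).real (attach true ⁻¹' E)
      else (m false).real (attach false ⁻¹' E)) (mixture p m) := by
    refine Integrable.of_bound hgm.aestronglyMeasurable 1 (Eventually.of_forall fun v => ?_)
    split_ifs <;> rw [Real.norm_eq_abs, abs_of_nonneg measureReal_nonneg] <;>
      exact measureReal_le_one
  refine (ae_eq_condExp_of_forall_setIntegral_eq (confounderSigma_le 1)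
    ((integrable_const (1 : ℝ)).indicator hE) (fun _ _ _ => hgi.integrableOn) ?_
    hg.stronglyMeasurable.aestronglyMeasurable).symm
  rintro S ⟨T, hT, rfl⟩ -
  have hTm : MeasurableSet (confounder (k := 1) ⁻¹' T) := measurable_confounder hT
  rw [setIntegral_indicator hE, setIntegral_const, mixture_real hp (hTm.inter hE),
    ← integral_indicator hTm, integral_mixture hp (hgm.indicator hTm)]
  · rw [smul_eq_mul, mul_one]
    refine Finset.sum_congr rfl fun u _ => ?_
    congr 1
    have hval : ∀ z, confounder (attach u z) = confounderValue u := fun z => rfl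
    -- On the component `u` the confounder is constant, so the test event either contains the whole
    -- component or misses it.
    by_cases hu : confounderValue u ∈ T
    · have : attach u ⁻¹' (confounder ⁻¹' T ∩ E) = attach u ⁻¹' E := by
        ext z; simp [hval, hu]
      rw [this]
      cases u <;> simp [indicator, hval, hu, hne]
    · have : attach u ⁻¹' (confounder ⁻¹' T ∩ E) = ∅ := by
        ext z; simp [hval, hu]
      rw [this]
      simp [indicator, hval, hu]
  · intro u
    refine Integrable.of_bound ((hgm.indicator hTm).comp (measurable_attach u)).aestronglyMeasurable
      1 (Eventually.of_forall fun z => ?_)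
    refine (norm_indicator_le_norm_self _ _).trans ?_
    split_ifs <;> rw [Real.norm_eq_abs, abs_of_nonneg measureReal_nonneg] <;>
      exact measureReal_le_one

/-- Conditioning on `U` selects one component, and each component is a product of a treatment law
and an outcome law. -/
theorem condIndepFun_mixture (hp : ∀ u, 0 ≤ p u) (hp1 : ∑ u, p u = 1)
    {β : Bool → Measure Bool} {ν : Bool → Measure (ℝ × ℝ)}
    [∀ u, IsProbabilityMeasure (β u)] [∀ u, IsProbabilityMeasure (ν u)]
    (hm : ∀ u, m u = (β u).prod (ν u)) [IsFiniteMeasure (mixture p m)] :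
    CondIndepFun (confounderSigma 1) (confounderSigma_le 1)
      (fun v : Full 1 => v.1) (fun v : Full 1 => (v.2.1, v.2.2.1)) (mixture p m) := by
  rw [condIndepFun_iff_condExp_inter_preimage_eq_mul (by fun_prop) (by fun_prop)]
  intro s t hs ht
  have hs' : MeasurableSet ((fun v : Full 1 => v.1) ⁻¹' s) := measurable_fst hs
  have ht' : MeasurableSet ((fun v : Full 1 => (v.2.1, v.2.2.1)) ⁻¹' t) :=
    (show Measurable (fun v : Full 1 => (v.2.1, v.2.2.1)) by fun_prop) ht
  have key : ∀ u, (m u).real (attach u ⁻¹' ((fun v : Full 1 => v.1) ⁻¹' s ∩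
      (fun v : Full 1 => (v.2.1, v.2.2.1)) ⁻¹' t)) =
      (m u).real (attach u ⁻¹' ((fun v : Full 1 => v.1) ⁻¹' s)) *
      (m u).real (attach u ⁻¹' ((fun v : Full 1 => (v.2.1, v.2.2.1)) ⁻¹' t)) := fun u => by
    have h1 : attach u ⁻¹' ((fun v : Full 1 => v.1) ⁻¹' s ∩
      (fun v : Full 1 => (v.2.1, v.2.2.1)) ⁻¹' t) = s ×ˢ t := rfl
    have h2 : attach u ⁻¹' ((fun v : Full 1 => v.1) ⁻¹' s) = s ×ˢ univ := by
      ext; simp [attach]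
    have h3 : attach u ⁻¹' ((fun v : Full 1 => (v.2.1, v.2.2.1)) ⁻¹' t) = univ ×ˢ t := by
      ext; simp [attach]
    rw [h1, h2, h3, hm, measureReal_prod_prod, measureReal_prod_prod, measureReal_prod_prod,
      probReal_univ, probReal_univ, one_mul, mul_one]
  filter_upwards [condExp_mixture (m := m) hp hp1 (hs'.inter ht'),
    condExp_mixture (m := m) hp hp1 hs', condExp_mixture (m := m) hp hp1 ht'] with v h1 h2 h3
  rw [h1, h2, h3]
  split_ifs <;> exact key _

end Mixture

end BLearner

namespace BLearner

/-! ### Splitting an outcome law at its quantile -/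

section Split

variable {P : Measure ℝ} {c q : ℝ}

/-- The law of the outcome above (`true`) or below (`false`) the threshold `q`. -/
noncomputable def tailLaw (P : Measure ℝ) (q : ℝ) : Bool → Measure ℝ
  | true => ProbabilityTheory.cond P (Ioi q)
  | false => ProbabilityTheory.cond P (Iic q)

theorem integral_tailLaw_false (hq : P.real (Iic q) = c) (hc : c ∈ Ioo (0 : ℝ) 1) (ψ : ℝ → ℝ) :
    c * ∫ y, ψ y ∂(tailLaw P q false) = ∫ y in Iic q, ψ y ∂P := by
  have : c ≠ 0 := by linarith [hc.1]
  rw [tailLaw, ProbabilityTheory.cond, integral_smul_measure, ENNReal.toReal_inv, ← measureReal_def,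
    hq, smul_eq_mul]
  field_simp

theorem tailLaw_absolutelyContinuous (u : Bool) : tailLaw P q u ≪ P := by
  cases u <;> exact cond_absolutelyContinuous

variable [IsProbabilityMeasure P]

theorem real_Ioi_of_cdf (hq : P.real (Iic q) = c) : P.real (Ioi q) = 1 - c := by
  rw [← compl_Iic, probReal_compl_eq_one_sub measurableSet_Iic, hq]

theorem isProbabilityMeasure_tailLaw (hq : P.real (Iic q) = c) (hc : c ∈ Ioo (0 : ℝ) 1) (u : Bool) :
    IsProbabilityMeasure (tailLaw P q u) := by
  cases u
  · refine cond_isProbabilityMeasure fun h => ?_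
    rw [measureReal_def, h] at hq
    simp at hq; linarith [hc.1]
  · refine cond_isProbabilityMeasure fun h => ?_
    have := real_Ioi_of_cdf hq
    rw [measureReal_def, h] at this
    simp at this; linarith [hc.2]

theorem integral_tailLaw_true (hq : P.real (Iic q) = c) (hc : c ∈ Ioo (0 : ℝ) 1) (ψ : ℝ → ℝ) :
    (1 - c) * ∫ y, ψ y ∂(tailLaw P q true) = ∫ y in Ioi q, ψ y ∂P := by
  have : 1 - c ≠ 0 := by linarith [hc.2]
  rw [tailLaw, ProbabilityTheory.cond, integral_smul_measure, ENNReal.toReal_inv, ← measureReal_def,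
    real_Ioi_of_cdf hq, smul_eq_mul]
  field_simp

theorem integral_eq_tailLaw (hq : P.real (Iic q) = c) (hc : c ∈ Ioo (0 : ℝ) 1) {ψ : ℝ → ℝ}
    (hψ : Integrable ψ P) :
    ∫ y, ψ y ∂P = (1 - c) * ∫ y, ψ y ∂(tailLaw P q true) + c * ∫ y, ψ y ∂(tailLaw P q false) := by
  rw [integral_tailLaw_true hq hc, integral_tailLaw_false hq hc, ← compl_Iic, add_comm,
    integral_add_compl measurableSet_Iic hψ]

theorem real_eq_tailLaw (hq : P.real (Iic q) = c) (hc : c ∈ Ioo (0 : ℝ) 1) {T : Set ℝ}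
    (hT : MeasurableSet T) :
    P.real T = (1 - c) * (tailLaw P q true).real T + c * (tailLaw P q false).real T := by
  have := integral_eq_tailLaw hq hc (ψ := T.indicator 1) ((integrable_const (1 : ℝ)).indicator hT)
  rwa [integral_indicator_one hT, integral_indicator_one hT, integral_indicator_one hT] at this

/-- The halves above and below `q` have masses `1 - c` and `c`, where `c` is the level. On each half
`R` is linear with slope `Λ` or `Λ⁻¹`, and the level is chosen so that slope times mass is the mass
of the other half. Thus `R` swaps the masses of the two halves. -/
theorem integral_R_eq_tailLaw {Λ : ℝ} (hΛ : 1 ≤ Λ) (s : Side) (hq : P.real (Iic q) = s.level Λ)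
    (hi : Integrable (fun y => y) P) :
    ∫ y, R Λ s y q ∂P = s.level Λ * ∫ y, y ∂(tailLaw P q true) +
      (1 - s.level Λ) * ∫ y, y ∂(tailLaw P q false) := by
  have hc := level_mem hΛ s
  have hΛ0 : 0 < Λ := by linarith
  have hpi : Integrable (fun y => s.part (y - q)) P :=
    (hi.sub (integrable_const q)).mono
      ((continuous_part s).measurable.comp (by fun_prop : Measurable fun y : ℝ => y - q)).aestronglyMeasurable
      (Eventually.of_forall fun y => part_abs_le s _)
  have hRi : Integrable (fun y => R Λ s y q) P := by
    simp_rw [R_eq hΛ]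
    exact ((integrable_const q).add ((hi.sub (integrable_const q)).const_mul _)).add
      (hpi.const_mul _)
  have := isProbabilityMeasure_tailLaw hq hc true
  have := isProbabilityMeasure_tailLaw hq hc false
  have hit : Integrable (fun y => y) (tailLaw P q true) := by
    unfold tailLaw ProbabilityTheory.cond
    refine hi.integrableOn.smul_measure (ENNReal.inv_ne_top.2 fun h => ?_)
    have := real_Ioi_of_cdf hq
    rw [measureReal_def, h] at this
    simp at this; linarith [hc.2]
  have hif : Integrable (fun y => y) (tailLaw P q false) := by
    unfold tailLaw ProbabilityTheory.cond
    refine hi.integrableOn.smul_measure (ENNReal.inv_ne_top.2 fun h => ?_)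
    rw [measureReal_def, h] at hq
    simp at hq; linarith [hc.1]
  have hup : ∀ᵐ y ∂(tailLaw P q true), q < y := by
    unfold tailLaw
    exact ae_cond_mem measurableSet_Ioi
  have hdown : ∀ᵐ y ∂(tailLaw P q false), y ≤ q := by
    unfold tailLaw
    exact ae_cond_mem measurableSet_Iic
  have hlin : ∀ (P' : Measure ℝ) [IsProbabilityMeasure P'], Integrable (fun y => y) P' →
      ∀ b : ℝ, (∀ᵐ y ∂P', R Λ s y q = q + b * (y - q)) →
      ∫ y, R Λ s y q ∂P' = q + b * (∫ y, y ∂P' - q) := fun P' _ hi' b h => by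
    have hb : Integrable (fun y => b * (y - q)) P' := (hi'.sub (integrable_const q)).const_mul b
    rw [integral_congr_ae h, integral_add (integrable_const _) hb, integral_const_mul,
      integral_sub hi' (integrable_const _)]
    simp
  have hlev : alpha Λ * (Λ + 1) = Λ := by unfold alpha; field_simp
  have hα : alpha Λ = Λ / (Λ + 1) := rfl
  rw [integral_eq_tailLaw hq hc hRi]
  cases s
  · rw [hlin _ hit Λ, hlin _ hif Λ⁻¹]
    · simp only [Side.level, hα]
      field_simp; ring
    · filter_upwards [hdown] with y hy
      rw [R_eq hΛ, Side.part, max_eq_right (by linarith)]; ring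
    · filter_upwards [hup] with y hy
      rw [R_eq hΛ, Side.part, max_eq_left (by linarith)]; ring
  · rw [hlin _ hit Λ⁻¹, hlin _ hif Λ]
    · simp only [Side.level, hα]
      field_simp; ring
    · filter_upwards [hdown] with y hy
      rw [R_eq hΛ, Side.part, min_eq_left (by linarith)]; ring
    · filter_upwards [hup] with y hy
      rw [R_eq hΛ, Side.part, min_eq_right (by linarith)]; ring

end Split

/-- The Bernoulli law on `Bool` with success probability `t`. -/
noncomputable def bern (t : ℝ) : Measure Bool :=
  ENNReal.ofReal t • Measure.dirac true + ENNReal.ofReal (1 - t) • Measure.dirac false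

theorem isProbabilityMeasure_bern {t : ℝ} (ht : t ∈ Icc (0 : ℝ) 1) :
    IsProbabilityMeasure (bern t) := by
  constructor
  simp only [bern, Measure.coe_add, Pi.add_apply, Measure.smul_apply, measure_univ, smul_eq_mul,
    mul_one]
  rw [← ENNReal.ofReal_add ht.1 (by linarith [ht.2])]
  simp

theorem bern_prod_real {t : ℝ} (ht : t ∈ Icc (0 : ℝ) 1) {T : Type*} [MeasurableSpace T]
    {ν : Measure T} [IsProbabilityMeasure ν] {E : Set (Bool × T)} (hE : MeasurableSet E) :
    ((bern t).prod ν).real E =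
      t * ν.real (Prod.mk true ⁻¹' E) + (1 - t) * ν.real (Prod.mk false ⁻¹' E) := by
  rw [measureReal_def, Measure.prod_apply hE, bern, lintegral_add_measure, lintegral_smul_measure,
    lintegral_smul_measure, lintegral_dirac, lintegral_dirac, smul_eq_mul, smul_eq_mul,
    ENNReal.toReal_add (ENNReal.mul_ne_top ENNReal.ofReal_ne_top (measure_ne_top _ _))
      (ENNReal.mul_ne_top ENNReal.ofReal_ne_top (measure_ne_top _ _)),
    ENNReal.toReal_mul, ENNReal.toReal_mul, ENNReal.toReal_ofReal ht.1,
    ENNReal.toReal_ofReal (by linarith [ht.2])]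
  rfl

end BLearner

/-! ### The extremal law and the closed form -/

namespace BLearner

variable {d : ℕ} {κ : Kernel (Cov d) (Bool × ℝ)} {x : Cov d}

theorem RegularAt.real_eq [IsProbabilityMeasure (κ x)] {B : ℝ} (hx : RegularAt κ B x)
    {S : Set (Bool × ℝ)} (hS : MeasurableSet S) :
    (κ x).real S = propensity κ x * (outcomeLaw κ x true).real (Prod.mk true ⁻¹' S) +
      (1 - propensity κ x) * (outcomeLaw κ x false).real (Prod.mk false ⁻¹' S) := by
  have hT : ∀ a, MeasurableSet (Prod.mk a ⁻¹' S) := fun a => measurable_prodMk_left hS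
  have h : ∀ a, (κ x).real ({p | p.1 = a} ∩ S) =
      (κ x).real {p | p.1 = a} * (outcomeLaw κ x a).real (Prod.mk a ⁻¹' S) := fun a => by
    have h1 := setIntegral_arm (hx.prob_arm_pos a).ne' (measurable_one.indicator (hT a))
    rw [integral_indicator_one (hT a)] at h1
    rw [← h1, ← integral_indicator_one ((measurableSet_arm a).inter hS),
      ← integral_indicator (measurableSet_arm a)]
    refine integral_congr_ae (Eventually.of_forall fun p => ?_)
    rcases p with ⟨b, y⟩
    by_cases hb : b = a
    · subst hb
      by_cases hy : (b, y) ∈ S <;> simp [indicator, hy]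
    · simp [indicator, hb]
  have h2 : {p : Bool × ℝ | p.1 = false} ∩ S = S \ {p | p.1 = true} := by
    ext p; simp [and_comm]
  have h3 := h false
  rw [prob_false_arm, h2] at h3
  have h4 := h true
  rw [inter_comm] at h4
  rw [← measureReal_inter_add_sdiff (s := S) (measurableSet_arm true), h3, h4]
  rfl

/-- The confounder tells whether the outcome lies above its quantile, at level `c` in the treated
arm and `1 - c` in the control arm. The complementary levels make the conditional law of `U` differ
between the arms by exactly a swap of `c` and `1 - c`, which is the swap performed by `R`, and which
makes the odds ratio equal to `Λ` or `Λ⁻¹`. -/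
theorem exists_compatible {Λ : ℝ} (hΛ : 1 ≤ Λ) [IsProbabilityMeasure (κ x)] {B : ℝ}
    (hx : RegularAt κ B x) (s : Side) :
    ∃ (Q : Measure (Full 1)) (_ : IsProbabilityMeasure Q), Compatible Λ κ x Q ∧
      Integrable (fun v : Full 1 => v.2.1 - v.2.2.1) Q ∧
      ∫ v, (v.2.1 - v.2.2.1) ∂Q = tauStar Λ κ s x := by
  classical
  have hprob := hx.isProbabilityMeasure_outcomeLaw
  obtain ⟨he0, he1⟩ := hx.overlap
  have hΛ0 : 0 < Λ := by linarith
  set e := propensity κ x with he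
  set c := s.level Λ with hc
  have hcm : c ∈ Ioo (0 : ℝ) 1 := level_mem hΛ s
  have hc0 := hcm.1
  have hc1 := hcm.2
  have hcm' : 1 - c ∈ Ioo (0 : ℝ) 1 := ⟨by linarith, by linarith⟩
  set P1 := outcomeLaw κ x true with hP1
  set P0 := outcomeLaw κ x false with hP0
  set q1 := qStar Λ κ s x true with hq1
  set q0 := qStar Λ κ s.flip x false with hq0
  have hF1 : P1.real (Iic q1) = c := hx.cdf_qStar hΛ s true
  have hF0 : P0.real (Iic q0) = 1 - c := by
    rw [← level_flip]; exact hx.cdf_qStar hΛ s.flip false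
  have := isProbabilityMeasure_tailLaw hF1 hcm
  have := isProbabilityMeasure_tailLaw hF0 hcm'
  -- `w1 u` and `w0 u` are the joint probabilities of `U = u` with `A = 1` and with `A = 0`; below,
  -- `p u` is the probability of `U = u` and `t u` the full propensity score there.
  set w1 : Bool → ℝ := fun u => e * (if u then 1 - c else c) with hw1
  set w0 : Bool → ℝ := fun u => (1 - e) * (if u then c else 1 - c) with hw0
  have hw1p : ∀ u, 0 < w1 u := fun u => mul_pos he0 (by cases u <;> simp <;> linarith)
  have hw0p : ∀ u, 0 < w0 u := fun u => mul_pos (by linarith) (by cases u <;> simp <;> linarith)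
  set p : Bool → ℝ := fun u => w1 u + w0 u with hp
  have hpp : ∀ u, 0 < p u := fun u => add_pos (hw1p u) (hw0p u)
  have hp1 : ∑ u, p u = 1 := by simp [hp, hw1, hw0]; ring
  set t : Bool → ℝ := fun u => w1 u / p u with ht
  have htm : ∀ u, t u ∈ Ioo (0 : ℝ) 1 := fun u =>
    ⟨div_pos (hw1p u) (hpp u), by rw [div_lt_one (hpp u)]; linarith [hw0p u]⟩
  have hpt : ∀ u, p u * t u = w1 u := fun u => mul_div_cancel₀ _ (hpp u).ne'
  have hpt' : ∀ u, p u * (1 - t u) = w0 u := fun u => by rw [mul_sub, hpt]; simp [hp]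
  have hβ : ∀ u, IsProbabilityMeasure (bern (t u)) := fun u =>
    isProbabilityMeasure_bern (Ioo_subset_Icc_self (htm u))
  -- The coupling of the two potential outcomes given `U` is immaterial, since the observed law and
  -- the mean difference only involve the marginals; the product is the simplest.
  set ν : Bool → Measure (ℝ × ℝ) := fun u => (tailLaw P1 q1 u).prod (tailLaw P0 q0 u) with hν
  have hνp : ∀ u, IsProbabilityMeasure (ν u) := fun u => by rw [hν]; infer_instance
  set m : Bool → Measure (Bool × ℝ × ℝ) := fun u => (bern (t u)).prod (ν u) with hm
  have hmp : ∀ u, IsProbabilityMeasure (m u) := fun u => by rw [hm]; infer_instance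
  have hQ : IsProbabilityMeasure (mixture p m) :=
    isProbabilityMeasure_mixture (fun u => (hpp u).le) hp1
  have hAm : MeasurableSet {v : Full 1 | v.1 = true} := measurable_fst (measurableSet_singleton true)
  have hmt : ∀ u, (m u).real (attach u ⁻¹' {v : Full 1 | v.1 = true}) = t u := fun u => by
    rw [hm, bern_prod_real (Ioo_subset_Icc_self (htm u)) (measurable_attach u hAm)]
    have h1 : Prod.mk true ⁻¹' (attach u ⁻¹' {v : Full 1 | v.1 = true}) = univ := by
      ext; simp [attach]
    have h2 : Prod.mk false ⁻¹' (attach u ⁻¹' {v : Full 1 | v.1 = true}) = ∅ := by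
      ext; simp [attach]
    rw [h1, h2, probReal_univ, measureReal_empty]; ring
  have hscore : ∀ᵐ v ∂(mixture p m), ∃ u,
      ((mixture p m)⟦{v : Full 1 | v.1 = true} | confounderSigma 1⟧) v = t u := by
    filter_upwards [condExp_mixture (m := m) (fun u => (hpp u).le) hp1 hAm] with v hv
    rw [hv]
    split_ifs
    · exact ⟨true, hmt true⟩
    · exact ⟨false, hmt false⟩
  refine ⟨mixture p m, hQ, ⟨?_, ?_, ?_, ?_⟩, ?_⟩
  · ext S hS
    rw [Measure.map_apply measurable_observed hS, ← ENNReal.ofReal_toReal (measure_ne_top _ _),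
      ← ENNReal.ofReal_toReal (measure_ne_top (κ x) S), ← measureReal_def, ← measureReal_def,
      hx.real_eq hS, mixture_real (fun u => (hpp u).le) (measurable_observed hS)]
    congr 1
    have hsec : ∀ a, MeasurableSet (Prod.mk a ⁻¹' S) := fun a => measurable_prodMk_left hS
    have hmu : ∀ u, p u * (m u).real (attach u ⁻¹' ((fun v : Full 1 =>
        (v.1, if v.1 = true then v.2.1 else v.2.2.1)) ⁻¹' S)) =
        w1 u * (tailLaw P1 q1 u).real (Prod.mk true ⁻¹' S) +
        w0 u * (tailLaw P0 q0 u).real (Prod.mk false ⁻¹' S) := fun u => by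
      rw [hm, bern_prod_real (Ioo_subset_Icc_self (htm u))
        (measurable_attach u (measurable_observed hS))]
      have h1 : Prod.mk true ⁻¹' (attach u ⁻¹' ((fun v : Full 1 =>
          (v.1, if v.1 = true then v.2.1 else v.2.2.1)) ⁻¹' S)) =
          (Prod.mk true ⁻¹' S) ×ˢ univ := by ext; simp [attach]
      have h2 : Prod.mk false ⁻¹' (attach u ⁻¹' ((fun v : Full 1 =>
          (v.1, if v.1 = true then v.2.1 else v.2.2.1)) ⁻¹' S)) =
          univ ×ˢ (Prod.mk false ⁻¹' S) := by ext; simp [attach]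
      rw [h1, h2, hν, measureReal_prod_prod, measureReal_prod_prod, probReal_univ, probReal_univ,
        ← hpt u, ← hpt' u]
      ring
    -- In each arm the two halves reassemble, with their own masses, into the observed outcome law.
    rw [Fintype.sum_bool, hmu, hmu, real_eq_tailLaw hF1 hcm (hsec true),
      real_eq_tailLaw hF0 hcm' (hsec false)]
    simp only [hw1, hw0, if_true, Bool.false_eq_true, if_false]
    ring
  · exact condIndepFun_mixture (fun u => (hpp u).le) hp1 (fun u => rfl)
  · filter_upwards [hscore] with v ⟨u, hu⟩
    rw [hu]; exact htm u
  · filter_upwards [hscore] with v ⟨u, hu⟩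
    rw [hu]
    have hodds : t u / (1 - t u) / (e / (1 - e)) = (if u then 1 - c else c) / (if u then c else 1 - c) := by
      have h1 : t u / (1 - t u) = w1 u / w0 u := by
        rw [← hpt, ← hpt', mul_div_mul_left _ _ (hpp u).ne']
      have : 1 - e ≠ 0 := by linarith
      have : 1 - c ≠ 0 := by linarith
      rw [h1]
      cases u <;> simp only [hw1, hw0, if_true, Bool.false_eq_true, if_false] <;> field_simp
    have hi : Λ⁻¹ ≤ Λ := (inv_le_one_of_one_le₀ hΛ).trans hΛ
    have hα : alpha Λ / (1 - alpha Λ) = Λ := by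
      have : Λ + 1 ≠ 0 := by linarith
      unfold alpha; field_simp; ring
    have hα' : (1 - alpha Λ) / alpha Λ = Λ⁻¹ := by
      rw [← inv_div, hα]
    rw [hodds, hc]
    cases s <;> cases u <;>
      simp only [Side.level, if_true, Bool.false_eq_true, if_false, sub_sub_cancel, hα, hα'] <;>
      constructor <;> linarith
  · have hi1 : Integrable (fun y => y) P1 :=
      Integrable.of_bound measurable_id.aestronglyMeasurable B (hx.outcome_bounded true)
    have hi0 : Integrable (fun y => y) P0 :=
      Integrable.of_bound measurable_id.aestronglyMeasurable B (hx.outcome_bounded false)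
    have hit1 : ∀ u, Integrable (fun y => y) (tailLaw P1 q1 u) := fun u =>
      Integrable.of_bound measurable_id.aestronglyMeasurable B
        ((tailLaw_absolutelyContinuous u).ae_le (hx.outcome_bounded true))
    have hit0 : ∀ u, Integrable (fun y => y) (tailLaw P0 q0 u) := fun u =>
      Integrable.of_bound measurable_id.aestronglyMeasurable B
        ((tailLaw_absolutelyContinuous u).ae_le (hx.outcome_bounded false))
    have hfst : ∀ u, Integrable (fun z : ℝ × ℝ => z.1) (ν u) := fun u => (hit1 u).comp_fst _
    have hsnd : ∀ u, Integrable (fun z : ℝ × ℝ => z.2) (ν u) := fun u => (hit0 u).comp_snd _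
    have hint : ∀ u, Integrable (fun z => (attach u z).2.1 - (attach u z).2.2.1) (m u) := fun u =>
      ((hfst u).sub (hsnd u)).comp_snd (bern (t u))
    have hmean : ∀ u, ∫ z, ((attach u z).2.1 - (attach u z).2.2.1) ∂(m u) =
        ∫ y, y ∂(tailLaw P1 q1 u) - ∫ y, y ∂(tailLaw P0 q0 u) := fun u => by
      have h1 := integral_fun_snd (μ := bern (t u)) (ν := ν u) (fun z : ℝ × ℝ => z.1 - z.2)
      rw [probReal_univ, one_smul, integral_sub (hfst u) (hsnd u)] at h1
      have h2 := integral_fun_fst (μ := tailLaw P1 q1 u) (ν := tailLaw P0 q0 u) (fun y => y)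
      have h3 := integral_fun_snd (μ := tailLaw P1 q1 u) (ν := tailLaw P0 q0 u) (fun y => y)
      rw [probReal_univ, one_smul] at h2 h3
      rw [← h2, ← h3]
      exact h1
    have hfm : Measurable (fun v : Full 1 => v.2.1 - v.2.2.1) := by fun_prop
    refine ⟨integrable_mixture hfm hint, ?_⟩
    rw [integral_mixture (fun u => (hpp u).le) hfm hint, Fintype.sum_bool, hmean, hmean]
    have hr1 : rhoStar Λ κ s x true = _ := integral_R_eq_tailLaw hΛ s hF1 hi1
    have hr0 : rhoStar Λ κ s.flip x false = _ :=
      integral_R_eq_tailLaw hΛ s.flip (by rw [level_flip]; exact hF0) hi0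
    rw [tauStar, hr1, hr0, level_flip, integral_eq_tailLaw hF1 hcm hi1,
      integral_eq_tailLaw hF0 hcm' hi0]
    simp only [hp, hw1, hw0, if_true, Bool.false_eq_true, if_false, ← hc, ← he]
    ring

/-- The sharp bounds have the closed form `tauStar`. -/
theorem sharpCATE_eq_tauStar {Λ : ℝ} (hΛ : 1 ≤ Λ) [IsProbabilityMeasure (κ x)] {B : ℝ}
    (hx : RegularAt κ B x) (s : Side) : sharpCATE Λ κ s x = tauStar Λ κ s x := by
  obtain ⟨Q, hQ, hc, hi, ht⟩ := exists_compatible hΛ hx s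
  have hmem : tauStar Λ κ s x ∈ identifiedSet Λ κ x := ⟨1, Q, hQ, hc, hi, ht.symm⟩
  cases s
  · refine IsGreatest.csSup_eq ⟨hmem, ?_⟩
    rintro t ⟨k, Q, hQ, hc, -, rfl⟩
    simpa [Side.sgn] using hc.sgn_mul_integral_le hΛ hx Side.upper
  · refine IsLeast.csInf_eq ⟨hmem, ?_⟩
    rintro t ⟨k, Q, hQ, hc, -, rfl⟩
    simpa [Side.sgn] using hc.sgn_mul_integral_le hΛ hx Side.lower

end BLearner

namespace BLearner

variable {d : ℕ}

/-! ### Conditional means of the pseudo-outcomes -/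

/-- `E[φ_τ^±(Z; η) | X = x]`. -/
noncomputable def condMean (Λ : ℝ) (κ : Kernel (Cov d) (Bool × ℝ)) (s : Side) (η : Nuisances d)
    (x : Cov d) : ℝ := ∫ p, phiTau Λ s η (x, p) ∂(κ x)

theorem phiTau_true (Λ : ℝ) (s : Side) (η : Nuisances d) (x : Cov d) (y : ℝ) :
    phiTau Λ s η (x, true, y) =
      y + (1 - η.e x) / η.e x * (R Λ s y (η.q1 x) - η.rho1 x) - η.rho0 x := by
  simp [phiTau, phi1, phi0, ind]

theorem phiTau_false (Λ : ℝ) (s : Side) (η : Nuisances d) (x : Cov d) (y : ℝ) :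
    phiTau Λ s η (x, false, y) =
      η.rho1 x - (y + η.e x / (1 - η.e x) * (R Λ s.flip y (η.q0 x) - η.rho0 x)) := by
  simp [phiTau, phi1, phi0, ind]

/-- A bound for the pseudo-outcomes. -/
noncomputable def phiBound (Λ ε B : ℝ) : ℝ := 2 * B + ε⁻¹ * ((2 + 2 * Λ) * B)

section Bounds

variable {Λ : ℝ} {κ : Kernel (Cov d) (Bool × ℝ)} {s : Side} {f : Cov d → Bool → ℝ → ℝ}
  {ε B : ℝ} {η : Nuisances d} {x : Cov d}

theorem abs_odds_mul_le (hε : 0 < ε) {t r : ℝ} (ht : t ∈ Icc ε (1 - ε)) {b : ℝ} (hr : |r| ≤ b) :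
    |(1 - t) / t * r| ≤ ε⁻¹ * b := by
  obtain ⟨h0, h1⟩ := ht
  have : |(1 - t) / t| ≤ ε⁻¹ := by
    rw [abs_of_nonneg (div_nonneg (by linarith) (by linarith)), inv_eq_one_div]
    exact div_le_div₀ zero_le_one (by linarith) hε h0
  rw [abs_mul]
  exact mul_le_mul this hr (abs_nonneg _) (by positivity)

theorem abs_odds_mul_le' (hε : 0 < ε) {t r : ℝ} (ht : t ∈ Icc ε (1 - ε)) {b : ℝ} (hr : |r| ≤ b) :
    |t / (1 - t) * r| ≤ ε⁻¹ * b := by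
  have := abs_odds_mul_le hε (t := 1 - t) ⟨by linarith [ht.2], by linarith [ht.1]⟩ hr
  rwa [sub_sub_cancel] at this

theorem BoundedAt.abs_phiTau_le (hΛ : 1 ≤ Λ) (hε : 0 < ε) (h : BoundedAt Λ κ s f ε B η x)
    {p : Bool × ℝ} (hp : |p.2| ≤ B) : |phiTau Λ s η (x, p)| ≤ phiBound Λ ε B := by
  rcases p with ⟨a, y⟩
  simp only at hp
  unfold phiBound
  cases a
  · rw [phiTau_false]
    have hR : |R Λ s.flip y (η.q0 x) - η.rho0 x| ≤ (2 + 2 * Λ) * B :=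
      (abs_sub _ _).trans (by linarith [R_abs_le hΛ s.flip hp h.q0, h.rho0])
    have := abs_odds_mul_le' hε h.e hR
    have h1 := abs_sub (η.rho1 x)
      (y + η.e x / (1 - η.e x) * (R Λ s.flip y (η.q0 x) - η.rho0 x))
    have h2 := abs_add_le y (η.e x / (1 - η.e x) * (R Λ s.flip y (η.q0 x) - η.rho0 x))
    linarith [h.rho1]
  · rw [phiTau_true]
    have hR : |R Λ s y (η.q1 x) - η.rho1 x| ≤ (2 + 2 * Λ) * B :=
      (abs_sub _ _).trans (by linarith [R_abs_le hΛ s hp h.q1, h.rho1])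
    have := abs_odds_mul_le hε h.e hR
    have h1 := abs_sub (y + (1 - η.e x) / η.e x * (R Λ s y (η.q1 x) - η.rho1 x)) (η.rho0 x)
    have h2 := abs_add_le y ((1 - η.e x) / η.e x * (R Λ s y (η.q1 x) - η.rho1 x))
    linarith [h.rho0]

theorem measurable_phiTau_section : Measurable (fun p => phiTau Λ s η (x, p)) := by
  have h : (fun p : Bool × ℝ => phiTau Λ s η (x, p)) = fun p =>
      if p.1 = true then p.2 + (1 - η.e x) / η.e x * (R Λ s p.2 (η.q1 x) - η.rho1 x) - η.rho0 x
      else η.rho1 x - (p.2 + η.e x / (1 - η.e x) * (R Λ s.flip p.2 (η.q0 x) - η.rho0 x)) := by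
    ext ⟨a, y⟩
    cases a <;> simp [phiTau_true, phiTau_false]
  have hR : ∀ s' q, Measurable (fun p : Bool × ℝ => R Λ s' p.2 q) := fun s' q =>
    (measurable_R Λ s').comp (measurable_snd.prodMk measurable_const)
  rw [h]
  refine Measurable.ite (measurableSet_arm true) ?_ ?_
  · exact (measurable_snd.add (((hR _ _).sub_const _).const_mul _)).sub_const _
  · exact (measurable_snd.add (((hR _ _).sub_const _).const_mul _)).const_sub _

variable [IsProbabilityMeasure (κ x)]

theorem BoundedAt.integrable_phiTau (hΛ : 1 ≤ Λ) (hε : 0 < ε) (h : BoundedAt Λ κ s f ε B η x)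
    (hx : RegularAt κ B x) : Integrable (fun p => phiTau Λ s η (x, p)) (κ x) :=
  Integrable.of_bound measurable_phiTau_section.aestronglyMeasurable _
    (hx.bounded.mono fun _ hp => h.abs_phiTau_le hΛ hε hp)

theorem BoundedAt.abs_condMean_le (hΛ : 1 ≤ Λ) (hε : 0 < ε) (h : BoundedAt Λ κ s f ε B η x)
    (hx : RegularAt κ B x) : |condMean Λ κ s η x| ≤ phiBound Λ ε B := by
  have := norm_integral_le_of_norm_le_const
    (hx.bounded.mono fun _ hp => h.abs_phiTau_le hΛ hε hp : ∀ᵐ p ∂(κ x),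
      ‖phiTau Λ s η (x, p)‖ ≤ phiBound Λ ε B)
  simpa [condMean] using this

theorem RegularAt.integrable_R (hΛ : 1 ≤ Λ) (hx : RegularAt κ B x) (s : Side) (a : Bool) (q : ℝ) :
    Integrable (fun y => R Λ s y q) (outcomeLaw κ x a) := by
  have := hx.isProbabilityMeasure_outcomeLaw a
  refine Integrable.of_bound ((measurable_R Λ s).comp
    (measurable_id.prodMk measurable_const)).aestronglyMeasurable ((1 + 2 * Λ) * max B |q|) ?_
  filter_upwards [hx.outcome_bounded a] with v hv
  exact R_abs_le hΛ s (hv.trans (le_max_left _ _)) (le_max_right _ _)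

theorem RegularAt.abs_integral_R_sub_le (hΛ : 1 ≤ Λ) (hx : RegularAt κ B x) (s : Side) (a : Bool)
    (q : ℝ) : |∫ y, R Λ s y q ∂(outcomeLaw κ x a) - rhoStar Λ κ s x a| ≤
      (1 + Λ) * |q - qStar Λ κ s x a| := by
  have := hx.isProbabilityMeasure_outcomeLaw a
  rw [rhoStar, ← integral_sub (hx.integrable_R hΛ s a _) (hx.integrable_R hΛ s a _)]
  have := norm_integral_le_of_norm_le_const (μ := outcomeLaw κ x a)
    (f := fun y => R Λ s y q - R Λ s y (qStar Λ κ s x a))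
    (Eventually.of_forall fun y => R_lipschitz hΛ s y q (qStar Λ κ s x a))
  simpa using this

theorem RegularAt.abs_rhoStar_le (hΛ : 1 ≤ Λ) (hx : RegularAt κ B x) (s : Side) (a : Bool) :
    |rhoStar Λ κ s x a| ≤ (1 + 2 * Λ) * B := by
  have := hx.isProbabilityMeasure_outcomeLaw a
  have := norm_integral_le_of_norm_le_const (μ := outcomeLaw κ x a)
    (f := fun y => R Λ s y (qStar Λ κ s x a))
    ((hx.outcome_bounded a).mono fun y hy => R_abs_le hΛ s hy (hx.abs_qStar_le hΛ s a))
  simpa [rhoStar] using this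

theorem RegularAt.abs_tauStar_le (hΛ : 1 ≤ Λ) (hx : RegularAt κ B x) (s : Side) :
    |tauStar Λ κ s x| ≤ (2 + 2 * Λ) * B := by
  have h := hx.isProbabilityMeasure_outcomeLaw
  have hm : ∀ a, |∫ y, y ∂(outcomeLaw κ x a)| ≤ B := fun a => by
    have := norm_integral_le_of_norm_le_const (μ := outcomeLaw κ x a) (f := fun y => y)
      (hx.outcome_bounded a)
    simpa using this
  obtain ⟨h0, h1⟩ := hx.overlap
  have a1 := (abs_sub (∫ y, y ∂(outcomeLaw κ x true)) (rhoStar Λ κ s.flip x false)).trans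
    (add_le_add (hm true) (hx.abs_rhoStar_le hΛ s.flip false))
  have a0 := (abs_sub (rhoStar Λ κ s x true) (∫ y, y ∂(outcomeLaw κ x false))).trans
    (add_le_add (hx.abs_rhoStar_le hΛ s true) (hm false))
  unfold tauStar
  refine (abs_add_le _ _).trans ?_
  rw [abs_mul, abs_mul, abs_of_pos h0, abs_of_nonneg (by linarith : 0 ≤ 1 - propensity κ x)]
  nlinarith

theorem RegularAt.integral_eq (hx : RegularAt κ B x) {F : Bool × ℝ → ℝ} (hF : Measurable F)
    (hi : Integrable F (κ x)) :
    ∫ p, F p ∂(κ x) = propensity κ x * ∫ y, F (true, y) ∂(outcomeLaw κ x true) +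
      (1 - propensity κ x) * ∫ y, F (false, y) ∂(outcomeLaw κ x false) := by
  have h : ∀ a, ∫ p in {p | p.1 = a}, F p ∂(κ x) =
      (κ x).real {p | p.1 = a} * ∫ y, F (a, y) ∂(outcomeLaw κ x a) := fun a => by
    rw [← setIntegral_arm (hx.prob_arm_pos a).ne' (ψ := fun y => F (a, y))
      (hF.comp (measurable_const.prodMk measurable_id))]
    refine setIntegral_congr_fun (measurableSet_arm a) fun p hp => ?_
    have : p.1 = a := hp
    rw [← this]
  have hc : {p : Bool × ℝ | p.1 = true}ᶜ = {p | p.1 = false} := by ext; simp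
  rw [← integral_add_compl (measurableSet_arm true) hi, hc, h, h, prob_false_arm]
  rfl

/-- Double robustness of the pseudo-outcomes, up to the error of the quantiles. -/
theorem BoundedAt.abs_condMean_sub_le (hΛ : 1 ≤ Λ) (hε : 0 < ε) (h : BoundedAt Λ κ s f ε B η x)
    (hx : RegularAt κ B x) :
    |condMean Λ κ s η x - tauStar Λ κ s x| ≤
      ε⁻¹ * ((1 + Λ) * |η.q1 x - qStar Λ κ s x true| +
        (1 + Λ) * |η.q0 x - qStar Λ κ s.flip x false| +
        |η.rho1 x - rhoStar Λ κ s x true| * |η.e x - propensity κ x| +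
        |η.rho0 x - rhoStar Λ κ s.flip x false| * |η.e x - propensity κ x|) := by
  have hprob := hx.isProbabilityMeasure_outcomeLaw
  have hi : ∀ a, Integrable (fun y => y) (outcomeLaw κ x a) := fun a =>
    Integrable.of_bound measurable_id.aestronglyMeasurable B (hx.outcome_bounded a)
  have hR1 := hx.integrable_R hΛ s true (η.q1 x)
  have hR0 := hx.integrable_R hΛ s.flip false (η.q0 x)
  have e1 : ∫ y, phiTau Λ s η (x, true, y) ∂(outcomeLaw κ x true) =
      ∫ y, y ∂(outcomeLaw κ x true) + (1 - η.e x) / η.e x *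
        (∫ y, R Λ s y (η.q1 x) ∂(outcomeLaw κ x true) - η.rho1 x) - η.rho0 x := by
    have h2 := (hR1.sub (integrable_const (η.rho1 x))).const_mul ((1 - η.e x) / η.e x)
    simp only [Pi.sub_apply] at h2
    have h3 := (hi true).add h2
    simp only [Pi.add_def] at h3
    simp_rw [phiTau_true]
    rw [integral_sub h3 (integrable_const _), integral_add (hi true) h2,
      integral_const_mul, integral_sub hR1 (integrable_const _)]
    simp
  have e0 : ∫ y, phiTau Λ s η (x, false, y) ∂(outcomeLaw κ x false) =
      η.rho1 x - (∫ y, y ∂(outcomeLaw κ x false) + η.e x / (1 - η.e x) *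
        (∫ y, R Λ s.flip y (η.q0 x) ∂(outcomeLaw κ x false) - η.rho0 x)) := by
    have h2 := (hR0.sub (integrable_const (η.rho0 x))).const_mul (η.e x / (1 - η.e x))
    simp only [Pi.sub_apply] at h2
    have h3 := (hi false).add h2
    simp only [Pi.add_def] at h3
    simp_rw [phiTau_false]
    rw [integral_sub (integrable_const _) h3, integral_add (hi false) h2,
      integral_const_mul, integral_sub hR0 (integrable_const _)]
    simp
  have b1 := hx.abs_integral_R_sub_le hΛ s true (η.q1 x)
  have b0 := hx.abs_integral_R_sub_le hΛ s.flip false (η.q0 x)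
  rw [condMean, hx.integral_eq measurable_phiTau_section (h.integrable_phiTau hΛ hε hx), e1, e0,
    tauStar]
  set r1 := ∫ y, R Λ s y (η.q1 x) ∂(outcomeLaw κ x true)
  set r0 := ∫ y, R Λ s.flip y (η.q0 x) ∂(outcomeLaw κ x false)
  set ρ1 := rhoStar Λ κ s x true
  set ρ0 := rhoStar Λ κ s.flip x false
  set e := propensity κ x
  obtain ⟨h0, h1⟩ := hx.overlap
  have t0 : 0 < η.e x := hε.trans_le h.e.1
  have t1 : 0 < 1 - η.e x := by linarith [h.e.2]
  -- An exact expansion of the bias: with `r1` and `r0` compared to `ρ1` and `ρ0` separately, the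
  -- errors of the `rho` estimates survive only multiplied by the error of `e`.
  have key : e * (∫ y, y ∂(outcomeLaw κ x true) + (1 - η.e x) / η.e x * (r1 - η.rho1 x) - η.rho0 x) +
      (1 - e) * (η.rho1 x - (∫ y, y ∂(outcomeLaw κ x false) +
        η.e x / (1 - η.e x) * (r0 - η.rho0 x))) -
      (e * (∫ y, y ∂(outcomeLaw κ x true) - ρ0) + (1 - e) * (ρ1 - ∫ y, y ∂(outcomeLaw κ x false))) =
      e * ((1 - η.e x) / η.e x * (r1 - ρ1)) - (1 - e) * (η.e x / (1 - η.e x) * (r0 - ρ0)) +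
      (η.e x)⁻¹ * ((η.rho1 x - ρ1) * (η.e x - e)) +
      (1 - η.e x)⁻¹ * ((η.rho0 x - ρ0) * (η.e x - e)) := by
    field_simp; ring
  rw [key]
  have c1 : |e * ((1 - η.e x) / η.e x * (r1 - ρ1))| ≤
      ε⁻¹ * ((1 + Λ) * |η.q1 x - qStar Λ κ s x true|) := by
    rw [abs_mul, abs_of_pos h0]
    exact (mul_le_of_le_one_left (abs_nonneg _) h1.le).trans (abs_odds_mul_le hε h.e b1)
  have c0 : |(1 - e) * (η.e x / (1 - η.e x) * (r0 - ρ0))| ≤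
      ε⁻¹ * ((1 + Λ) * |η.q0 x - qStar Λ κ s.flip x false|) := by
    rw [abs_mul, abs_of_pos (by linarith : 0 < 1 - e)]
    exact (mul_le_of_le_one_left (abs_nonneg _) (by linarith)).trans (abs_odds_mul_le' hε h.e b0)
  have d1 : |(η.e x)⁻¹ * ((η.rho1 x - ρ1) * (η.e x - e))| ≤
      ε⁻¹ * (|η.rho1 x - ρ1| * |η.e x - e|) := by
    rw [abs_mul, abs_mul, abs_of_pos (inv_pos.2 t0)]
    exact mul_le_mul_of_nonneg_right (inv_anti₀ hε h.e.1) (by positivity)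
  have d0 : |(1 - η.e x)⁻¹ * ((η.rho0 x - ρ0) * (η.e x - e))| ≤
      ε⁻¹ * (|η.rho0 x - ρ0| * |η.e x - e|) := by
    rw [abs_mul, abs_mul, abs_of_pos (inv_pos.2 t1)]
    exact mul_le_mul_of_nonneg_right (inv_anti₀ hε (by linarith [h.e.2])) (by positivity)
  have := abs_add_three (e * ((1 - η.e x) / η.e x * (r1 - ρ1)) -
    (1 - e) * (η.e x / (1 - η.e x) * (r0 - ρ0))) ((η.e x)⁻¹ * ((η.rho1 x - ρ1) * (η.e x - e)))
    ((1 - η.e x)⁻¹ * ((η.rho0 x - ρ0) * (η.e x - e)))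
  have := abs_sub (e * ((1 - η.e x) / η.e x * (r1 - ρ1)))
    ((1 - e) * (η.e x / (1 - η.e x) * (r0 - ρ0)))
  linarith

end Bounds

end BLearner

namespace BLearner

variable {d : ℕ}

/-! ### Measurability -/

section Measurability

variable (κ : Kernel (Cov d) (Bool × ℝ))

theorem measurable_prob_arm (a : Bool) : Measurable fun x => (κ x).real {p | p.1 = a} :=
  (κ.measurable_coe (measurableSet_arm a)).ennreal_toReal

theorem measurable_propensity : Measurable (propensity κ) := measurable_prob_arm κ true

theorem outcomeLaw_apply (x : Cov d) (a : Bool) {T : Set ℝ} (hT : MeasurableSet T) :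
    outcomeLaw κ x a T = (κ x {p | p.1 = a})⁻¹ * κ x ({p | p.1 = a} ∩ Prod.snd ⁻¹' T) := by
  rw [outcomeLaw, Measure.map_apply measurable_snd hT, cond_apply (measurableSet_arm a)]

variable [IsMarkovKernel κ]

/-- The conditional law of the outcome as a kernel. -/
noncomputable def outcomeKernel (a : Bool) : Kernel (Cov d) ℝ where
  toFun x := outcomeLaw κ x a
  measurable' := by
    refine Measure.measurable_of_measurable_coe _ fun T hT => ?_
    simp_rw [outcomeLaw_apply κ _ a hT]
    exact (κ.measurable_coe (measurableSet_arm a)).inv.mul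
      (κ.measurable_coe ((measurableSet_arm a).inter (measurable_snd hT)))

instance isFiniteKernel_outcomeKernel (a : Bool) : IsFiniteKernel (outcomeKernel κ a) := by
  refine ⟨1, ENNReal.one_lt_top, fun x => ?_⟩
  change outcomeLaw κ x a univ ≤ 1
  rw [outcomeLaw_apply κ x a MeasurableSet.univ, preimage_univ, inter_univ]
  exact ENNReal.inv_mul_le_one _

theorem isProbabilityMeasure_outcomeLaw_of_ne_zero {x : Cov d} {a : Bool}
    (h : κ x {p | p.1 = a} ≠ 0) : IsProbabilityMeasure (outcomeLaw κ x a) := by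
  have := cond_isProbabilityMeasure h
  exact Measure.isProbabilityMeasure_map (by fun_prop)

/-- By `quantile_le_iff` a sublevel set of the quantile is a superlevel set of the distribution
function at a fixed point, which is measurable in `x`. -/
theorem measurable_qStar {Λ : ℝ} (hΛ : 1 ≤ Λ) (s : Side) (a : Bool) :
    Measurable fun x => qStar Λ κ s x a := by
  obtain ⟨hc0, hc1⟩ := level_mem hΛ s
  refine measurable_of_Iic fun β => ?_
  have hN : MeasurableSet {x | κ x {p | p.1 = a} = 0} :=
    κ.measurable_coe (measurableSet_arm a) (measurableSet_singleton 0)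
  have hF : MeasurableSet {x | s.level Λ ≤ (outcomeLaw κ x a).real (Iic β)} :=
    measurableSet_le measurable_const
      ((outcomeKernel κ a).measurable_coe measurableSet_Iic).ennreal_toReal
  -- Where the arm has mass zero, `outcomeLaw` is the zero measure, no point reaches the level, and
  -- the infimum of the empty set is `0` by convention.
  have hzero : ∀ x, κ x {p | p.1 = a} = 0 → qStar Λ κ s x a = 0 := fun x hx => by
    have h0 : ∀ γ, (outcomeLaw κ x a).real (Iic γ) = 0 := fun γ => by
      rw [measureReal_def, outcomeLaw_apply κ x a measurableSet_Iic,
        measure_mono_null inter_subset_left hx]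
      simp
    have : {β : ℝ | s.level Λ ≤ (outcomeLaw κ x a).real (Iic β)} = ∅ := by
      ext γ
      simp only [mem_ofPred_eq, h0, mem_empty_iff_false, iff_false, not_le]
      exact hc0
    rw [qStar, quantile, this, Real.sInf_empty]
  have heq : (fun x => qStar Λ κ s x a) ⁻¹' Iic β =
      ({x | κ x {p | p.1 = a} = 0} ∩ {_x | (0 : ℝ) ≤ β}) ∪
      ({x | κ x {p | p.1 = a} = 0}ᶜ ∩ {x | s.level Λ ≤ (outcomeLaw κ x a).real (Iic β)}) := by
    ext x
    by_cases hx : κ x {p | p.1 = a} = 0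
    · simp [hx, hzero x hx]
    · have := isProbabilityMeasure_outcomeLaw_of_ne_zero κ hx
      have := quantile_le_iff (P := outcomeLaw κ x a) hc0 hc1 β
      simpa [hx, qStar, quantile] using this
  rw [heq]
  exact (hN.inter (MeasurableSet.const _)).union (hN.compl.inter hF)

theorem measurable_rhoStar {Λ : ℝ} (hΛ : 1 ≤ Λ) (s : Side) (a : Bool) :
    Measurable fun x => rhoStar Λ κ s x a := by
  have h : Measurable (fun p : Cov d × ℝ => R Λ s p.2 (qStar Λ κ s p.1 a)) :=
    (measurable_R Λ s).comp (measurable_snd.prodMk ((measurable_qStar κ hΛ s a).comp measurable_fst))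
  exact (h.stronglyMeasurable.integral_kernel_prod_right' (κ := outcomeKernel κ a)).measurable

theorem measurable_tauStar {Λ : ℝ} (hΛ : 1 ≤ Λ) (s : Side) : Measurable (tauStar Λ κ s) := by
  have hm : ∀ a, Measurable fun x => ∫ y, y ∂(outcomeLaw κ x a) := fun a =>
    ((measurable_snd (α := Cov d) (β := ℝ)).stronglyMeasurable.integral_kernel_prod_right'
      (κ := outcomeKernel κ a)).measurable
  have he := measurable_propensity κ
  exact (he.mul ((hm true).sub (measurable_rhoStar κ hΛ s.flip false))).add
    ((he.const_sub 1).mul ((measurable_rhoStar κ hΛ s true).sub (hm false)))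

variable {κ} {Ω : Type*} {m : MeasurableSpace Ω} {η : Ω → Nuisances d} {Λ : ℝ} {s : Side}

theorem NuisancesFittedOn.measurable_phiTau (h : NuisancesFittedOn m η) :
    Measurable fun p : Ω × Obs d => phiTau Λ s (η p.1) p.2 := by
  have hx : Measurable fun p : Ω × Obs d => (p.1, p.2.1) := by fun_prop
  have hy : Measurable fun p : Ω × Obs d => p.2.2.2 := by fun_prop
  have he : Measurable fun p : Ω × Obs d => (η p.1).e p.2.1 := Measurable.comp h.e hx
  have hq1 : Measurable fun p : Ω × Obs d => (η p.1).q1 p.2.1 := Measurable.comp h.q1 hx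
  have hq0 : Measurable fun p : Ω × Obs d => (η p.1).q0 p.2.1 := Measurable.comp h.q0 hx
  have hr1 : Measurable fun p : Ω × Obs d => (η p.1).rho1 p.2.1 := Measurable.comp h.rho1 hx
  have hr0 : Measurable fun p : Ω × Obs d => (η p.1).rho0 p.2.1 := Measurable.comp h.rho0 hx
  have hind : Measurable fun p : Ω × Obs d => ind p.2.2.1 :=
    (measurable_of_countable ind).comp (by fun_prop)
  have hR1 := (measurable_R Λ s).comp (hy.prodMk hq1)
  have hR0 := (measurable_R Λ s.flip).comp (hy.prodMk hq0)
  unfold phiTau phi1 phi0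
  refine Measurable.sub ?_ ?_
  · exact ((hind.mul hy).add ((hind.const_sub 1).mul hr1)).add
      ((((he.const_sub 1).mul hind).div he).mul (hR1.sub hr1))
  · exact (((hind.const_sub 1).mul hy).add (hind.mul hr0)).add
      (((he.mul (hind.const_sub 1)).div (he.const_sub 1)).mul (hR0.sub hr0))

theorem NuisancesFittedOn.measurable_condMean (h : NuisancesFittedOn m η) :
    Measurable fun p : Ω × Cov d => condMean Λ κ s (η p.1) p.2 := by
  have h1 : Measurable fun q : (Ω × Cov d) × (Bool × ℝ) => phiTau Λ s (η q.1.1) (q.1.2, q.2) :=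
    (h.measurable_phiTau (Λ := Λ) (s := s)).comp
      (by fun_prop : Measurable fun q : (Ω × Cov d) × (Bool × ℝ) => (q.1.1, (q.1.2, q.2)))
  exact (h1.stronglyMeasurable.integral_kernel_prod_right'
    (κ := κ.comap Prod.snd measurable_snd)).measurable

end Measurability

end BLearner

namespace BLearner

/-! ### Averaging over one observation given everything else -/

/-- The intersections `t ∩ g` form a π-system generating the join, and on them the probability
factors in two steps, first splitting off `g`, then `t`. This adds the external randomness to the
other observations without losing independence from the remaining one. -/
theorem indep_sup_left {Ω : Type*} {G T S mΩ : MeasurableSpace Ω} {μ : Measure Ω}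
    [IsProbabilityMeasure μ] (hG : G ≤ mΩ) (hT : T ≤ mΩ) (hS : S ≤ mΩ)
    (hGTS : Indep G (T ⊔ S) μ) (hTS : Indep T S μ) : Indep (T ⊔ G) S μ := by
  set p : Set (Set Ω) := {u | ∃ t g, MeasurableSet[T] t ∧ MeasurableSet[G] g ∧ t ∩ g = u} with hp
  have hle : T ⊔ G ≤ MeasurableSpace.generateFrom p := by
    refine sup_le (fun t ht => ?_) fun g hg => ?_
    · exact MeasurableSpace.measurableSet_generateFrom
        ⟨t, univ, ht, MeasurableSet.univ, inter_univ t⟩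
    · exact MeasurableSpace.measurableSet_generateFrom
        ⟨univ, g, MeasurableSet.univ, hg, univ_inter g⟩
  have hpi : IsPiSystem p := by
    rintro _ ⟨t, g, ht, hg, rfl⟩ _ ⟨t', g', ht', hg', rfl⟩ -
    exact ⟨t ∩ t', g ∩ g', ht.inter ht', hg.inter hg', by ext; simp; tauto⟩
  have hpm : ∀ u ∈ p, MeasurableSet[mΩ] u := by
    rintro _ ⟨t, g, ht, hg, rfl⟩
    exact (hT _ ht).inter (hG _ hg)
  have h := IndepSets.indep' (μ := μ) (p1 := p) (p2 := {s | MeasurableSet[S] s}) hpm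
    (fun s hs => hS _ hs) hpi (@MeasurableSpace.isPiSystem_measurableSet _ S) (by
      rw [IndepSets_iff]
      rintro _ b ⟨t, g, ht, hg, rfl⟩ hb
      rw [Indep_iff] at hGTS hTS
      have hT' : T ≤ T ⊔ S := le_sup_left
      have hS' : S ≤ T ⊔ S := le_sup_right
      rw [inter_comm t g, inter_assoc, hGTS g (t ∩ b) hg (MeasurableSet.inter (hT' _ ht) (hS' _ hb)),
        hTS t b ht hb, hGTS g t hg (hT' _ ht), mul_assoc])
  rw [@MeasurableSpace.generateFrom_measurableSet _ S] at h
  exact indep_of_indep_of_le_left h hle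

variable {d : ℕ} {Ω : Type*} [mΩ : MeasurableSpace Ω] {μ : Measure Ω}
  {PX : Measure (Cov d)} {κ : Kernel (Cov d) (Bool × ℝ)}
  {T : Type*} {mT : MeasurableSpace T} {ι : Ω → T} {Zi : Ω → Obs d}

theorem map_prodMk_eq [IsProbabilityMeasure μ] (hι : Measurable ι) (hZ : Measurable Zi) (hind : IndepFun ι Zi μ)
    (hlaw : μ.map Zi = PX.compProd κ) :
    μ.map (fun ω => (ι ω, Zi ω)) = (μ.map ι).prod (PX.compProd κ) := by
  rw [← hlaw]
  exact (indepFun_iff_map_prod_eq_prod_map_map hι.aemeasurable hZ.aemeasurable).1 hind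

variable [IsProbabilityMeasure PX] [IsMarkovKernel κ]

theorem ae_compProd_of_ae_left {P : Cov d → Prop} (h : ∀ᵐ x ∂PX, P x) :
    ∀ᵐ z ∂(PX.compProd κ), P z.1 := by
  rw [← Measure.fst_compProd PX κ] at h
  exact ae_of_ae_map measurable_fst.aemeasurable h

theorem map_fst_eq (hZ : Measurable Zi) (hlaw : μ.map Zi = PX.compProd κ) :
    μ.map (fun ω => (Zi ω).1) = PX := by
  have : (μ.map Zi).map Prod.fst = PX := by rw [hlaw]; exact Measure.fst_compProd PX κ
  rwa [Measure.map_map measurable_fst hZ] at this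

variable [IsProbabilityMeasure μ]

/-- Fubini for the product law: with `ι` and the covariate frozen, the inner integral over treatment
and outcome vanishes. No conditional expectation has to be formed. -/
theorem integral_eq_zero_of_conditional_mean (hι : Measurable ι) (hZ : Measurable Zi)
    (hind : IndepFun ι Zi μ) (hlaw : μ.map Zi = PX.compProd κ) {h : T × Obs d → ℝ}
    (hm : Measurable h) (hi : Integrable (fun ω => h (ι ω, Zi ω)) μ)
    (h0 : ∀ᵐ ω ∂μ, ∀ᵐ x ∂PX, ∫ p, h (ι ω, (x, p)) ∂(κ x) = 0) :
    ∫ ω, h (ι ω, Zi ω) ∂μ = 0 := by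
  have hpair := map_prodMk_eq hι hZ hind hlaw
  have := Measure.isProbabilityMeasure_map (μ := μ) hι.aemeasurable
  have hip : Integrable h ((μ.map ι).prod (PX.compProd κ)) := by
    rw [← hpair, integrable_map_measure hm.aestronglyMeasurable (hι.prodMk hZ).aemeasurable]
    exact hi
  have h1 : ∫ ω, h (ι ω, Zi ω) ∂μ = ∫ ω, ∫ z, h (ι ω, z) ∂(PX.compProd κ) ∂μ := by
    rw [← integral_map (f := h) (hι.prodMk hZ).aemeasurable hm.aestronglyMeasurable, hpair,
      integral_prod _ hip, integral_map hι.aemeasurable]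
    exact hm.stronglyMeasurable.integral_prod_right'.aestronglyMeasurable
  rw [h1]
  refine integral_eq_zero_of_ae ?_
  filter_upwards [h0, ae_of_ae_map hι.aemeasurable hip.prod_right_ae] with ω h0 hω
  rw [Measure.integral_compProd hω]
  exact integral_eq_zero_of_ae h0

/-- Fubini for null sets. It transfers "for almost every `x`" properties of a fitted function to the
observation itself, provided the fit is independent of that observation. -/
theorem ae_mem_of_ae_ae (hι : Measurable ι) (hZ : Measurable Zi) (hind : IndepFun ι Zi μ)
    (hlaw : μ.map Zi = PX.compProd κ) {S : Set (T × Obs d)} (hS : MeasurableSet S)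
    (h : ∀ᵐ ω ∂μ, ∀ᵐ z ∂(PX.compProd κ), (ι ω, z) ∈ S) : ∀ᵐ ω ∂μ, (ι ω, Zi ω) ∈ S := by
  have hpair := map_prodMk_eq hι hZ hind hlaw
  refine ae_of_ae_map (f := fun ω => (ι ω, Zi ω)) (p := fun q => q ∈ S) (hι.prodMk hZ).aemeasurable ?_
  rw [hpair, Measure.ae_prod_iff_ae_ae (p := fun q => q ∈ S) hS, ae_map_iff hι.aemeasurable]
  · exact h
  · have : {t | ∀ᵐ z ∂(PX.compProd κ), (t, z) ∈ S} =
        {t | (PX.compProd κ) (Prod.mk t ⁻¹' Sᶜ) = 0} := by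
      ext t; rfl
    change MeasurableSet {t | ∀ᵐ z ∂(PX.compProd κ), (t, z) ∈ S}
    rw [this]
    exact measurable_measure_prodMk_left hS.compl (measurableSet_singleton 0)

/-! ### Chebyshev's inequality for conditionally centred sums -/

/-- The weights `a` need not be square integrable, so the second moment is taken on the event that
their squares sum to at most `c`; the complement is paid for separately. Orthogonality is therefore
required with the indicator of this event included. -/
theorem measure_abs_weighted_sum_ge_le {Ω : Type*} [MeasurableSpace Ω] {μ : Measure Ω}
    [IsProbabilityMeasure μ] {I J : Finset ℕ} (hIJ : I ⊆ J) {a D : ℕ → Ω → ℝ}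
    (ha : ∀ i ∈ J, Measurable (a i)) (hD : ∀ i ∈ I, Measurable (D i)) {M c δ : ℝ} (hδ : 0 < δ)
    (hM : ∀ i ∈ I, ∀ᵐ ω ∂μ, |D i ω| ≤ M) (hM0 : 0 ≤ M) (hc : 0 ≤ c)
    (horth : ∀ i ∈ I, ∀ j ∈ I, i ≠ j →
      ∫ ω, {ω | ∑ l ∈ J, a l ω ^ 2 ≤ c}.indicator (fun ω => a i ω * a j ω) ω * D j ω * D i ω ∂μ = 0) :
    μ {ω | δ ≤ |∑ i ∈ I, a i ω * D i ω|} ≤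
      μ {ω | c < ∑ l ∈ J, a l ω ^ 2} + ENNReal.ofReal (M ^ 2 * c / δ ^ 2) := by
  set E := {ω | ∑ l ∈ J, a l ω ^ 2 ≤ c} with hE
  have hEm : MeasurableSet E :=
    measurableSet_le (Finset.measurable_fun_sum _ fun l hl => (ha l hl).pow_const 2) measurable_const
  have hDI : ∀ᵐ ω ∂μ, ∀ i ∈ I, |D i ω| ≤ M := (Finset.eventually_all I).2 hM
  have hprod : ∀ i ∈ I, ∀ j ∈ I, ∀ ω ∈ E, |a i ω * a j ω| ≤ c := fun i hi j hj ω hω => by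
    have hsum : ∀ l ∈ I, a l ω ^ 2 ≤ c := fun l hl =>
      (Finset.single_le_sum (f := fun l => a l ω ^ 2) (fun _ _ => sq_nonneg _) (hIJ hl)).trans hω
    rw [abs_mul]
    have h1 := hsum i hi
    have h2 := hsum j hj
    rw [← sq_abs] at h1 h2
    nlinarith [sq_nonneg (|a i ω| - |a j ω|)]
  set S : Ω → ℝ := fun ω => ∑ i ∈ I, a i ω * D i ω with hS
  have hSm : Measurable S :=
    Finset.measurable_fun_sum _ fun i hi => (ha i (hIJ hi)).mul (hD i hi)
  set t : ℕ → ℕ → Ω → ℝ := fun i j ω => E.indicator (fun ω => a i ω * a j ω) ω * D j ω * D i ω with ht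
  have hti : ∀ i ∈ I, ∀ j ∈ I, Integrable (t i j) μ := fun i hi j hj => by
    refine Integrable.of_bound (((((ha i (hIJ hi)).mul (ha j (hIJ hj))).indicator hEm).mul
      (hD j hj)).mul (hD i hi)).aestronglyMeasurable (c * M * M) ?_
    filter_upwards [hDI] with ω hω
    rw [norm_mul, norm_mul]
    refine mul_le_mul (mul_le_mul ?_ (hω j hj) (norm_nonneg _) hc) (hω i hi) (norm_nonneg _)
      (by positivity)
    by_cases h : ω ∈ E
    · rw [indicator_of_mem h]; exact hprod i hi j hj ω h
    · rw [indicator_of_notMem h, norm_zero]; exact hc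
  have hsq : ∀ ω, E.indicator (fun ω => S ω ^ 2) ω = ∑ i ∈ I, ∑ j ∈ I, t i j ω := fun ω => by
    by_cases h : ω ∈ E
    · rw [indicator_of_mem h, hS, sq, Finset.sum_mul_sum]
      refine Finset.sum_congr rfl fun i _ => Finset.sum_congr rfl fun j _ => ?_
      rw [ht]; simp only [indicator_of_mem h]; ring
    · simp [ht, indicator_of_notMem h]
  have hint : Integrable (E.indicator fun ω => S ω ^ 2) μ := by
    rw [funext hsq]
    exact integrable_finsetSum _ fun i hi => integrable_finsetSum _ fun j hj => hti i hi j hj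
  have hvar : ∫ ω, E.indicator (fun ω => S ω ^ 2) ω ∂μ ≤ M ^ 2 * c := by
    have h1 : ∫ ω, E.indicator (fun ω => S ω ^ 2) ω ∂μ = ∑ i ∈ I, ∫ ω, t i i ω ∂μ := by
      simp_rw [hsq]
      rw [integral_finsetSum _ fun i hi => integrable_finsetSum _ fun j hj => hti i hi j hj]
      refine Finset.sum_congr rfl fun i hi => ?_
      rw [integral_finsetSum _ fun j hj => hti i hi j hj]
      exact Finset.sum_eq_single_of_mem i hi fun j hj hij => horth i hi j hj hij.symm
    rw [h1, ← integral_finsetSum _ fun i hi => hti i hi i hi]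
    refine (integral_mono_ae (integrable_finsetSum _ fun i hi => hti i hi i hi)
      (integrable_const (M ^ 2 * c)) ?_).trans (by simp)
    filter_upwards [hDI] with ω hω
    by_cases h : ω ∈ E
    · have h2 : ∑ i ∈ I, a i ω ^ 2 ≤ c :=
        (Finset.sum_le_sum_of_subset_of_nonneg hIJ fun _ _ _ => sq_nonneg _).trans h
      calc ∑ i ∈ I, t i i ω ≤ ∑ i ∈ I, M ^ 2 * a i ω ^ 2 := by
            refine Finset.sum_le_sum fun i hi => ?_
            rw [ht]; simp only [indicator_of_mem h]
            have h3 : D i ω ^ 2 ≤ M ^ 2 := sq_le_sq' (abs_le.1 (hω i hi)).1 (abs_le.1 (hω i hi)).2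
            nlinarith [sq_nonneg (a i ω)]
        _ ≤ M ^ 2 * c := by
            rw [← Finset.mul_sum]
            exact mul_le_mul_of_nonneg_left h2 (sq_nonneg M)
    · have : ∑ i ∈ I, t i i ω = 0 :=
        Finset.sum_eq_zero fun i _ => by rw [ht]; simp only [indicator_of_notMem h, zero_mul]
      rw [this]; positivity
  have hmarkov := mul_meas_ge_le_integral_of_nonneg (μ := μ)
    (f := E.indicator fun ω => S ω ^ 2)
    (Eventually.of_forall fun ω => indicator_nonneg (fun _ _ => sq_nonneg _) ω) hint (δ ^ 2)
  have hsub : {ω | δ ≤ |S ω|} ⊆ {ω | c < ∑ l ∈ J, a l ω ^ 2} ∪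
      {ω | δ ^ 2 ≤ E.indicator (fun ω => S ω ^ 2) ω} := fun ω hω => by
    by_cases h : ω ∈ E
    · right
      simp only [mem_ofPred_eq, indicator_of_mem h]
      rw [← sq_abs (S ω)]
      exact pow_le_pow_left₀ hδ.le hω 2
    · left
      simpa [hE] using h
  refine (measure_mono hsub).trans ((measure_union_le _ _).trans (add_le_add le_rfl ?_))
  rw [← ENNReal.ofReal_toReal (measure_ne_top μ {ω | δ ^ 2 ≤ E.indicator (fun ω => S ω ^ 2) ω})]
  refine ENNReal.ofReal_le_ofReal ?_
  rw [le_div_iff₀ (by positivity), mul_comm]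
  exact hmarkov.trans hvar

end BLearner

namespace BLearner

variable {d : ℕ}

/-! ### Cross-fitting -/

/-- The pseudo-outcome centred at its conditional mean given the covariates. -/
noncomputable def residual (Λ : ℝ) (κ : Kernel (Cov d) (Bool × ℝ)) (s : Side) (η : Nuisances d)
    (z : Obs d) : ℝ := phiTau Λ s η z - condMean Λ κ s η z.1

/-- The σ-algebra of all observations but the `i`-th, and of the separate randomness. -/
abbrev othersSigma {Ω : Type*} (G : MeasurableSpace Ω) (Z : ℕ → Ω → Obs d) (i : ℕ) :
    MeasurableSpace Ω :=
  (⨆ j ∈ {j : ℕ | j ≠ i}, MeasurableSpace.comap (Z j) inferInstance) ⊔ G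

/-- An i.i.d. sample with cross-fitted, bounded nuisance estimates. -/
structure Design {Ω : Type*} (G : MeasurableSpace Ω) [mΩ : MeasurableSpace Ω] (μ : Measure Ω)
    (Λ : ℝ) (s : Side) (K : ℕ) (PX : Measure (Cov d)) (κ : Kernel (Cov d) (Bool × ℝ))
    (Z : ℕ → Ω → Obs d) (ηhat : ℕ → ℕ → Ω → Nuisances d) (f : Cov d → Bool → ℝ → ℝ)
    (ε B : ℝ) : Prop where
  one_le : 1 ≤ Λ
  eps_pos : 0 < ε
  folds_pos : 0 < K
  measurable : ∀ i, Measurable (Z i)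
  indep : iIndepFun Z μ
  law : ∀ i, μ.map (Z i) = PX.compProd κ
  le : G ≤ mΩ
  indepG : Indep G (⨆ i, MeasurableSpace.comap (Z i) inferInstance) μ
  fitted : ∀ n, ∀ k < K, NuisancesFittedOn (trainSigma K Z n k ⊔ G) (ηhat n k)
  regular : ∀ᵐ x ∂PX, RegularAt κ B x
  bounded : ∀ n, ∀ k < K, ∀ᵐ ω ∂μ, ∀ᵐ x ∂PX, BoundedAt Λ κ s f ε B (ηhat n k ω) x

theorem NuisancesFittedOn.measurable_residual {Ω : Type*} {m : MeasurableSpace Ω} {Λ : ℝ} {s : Side}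
    {κ : Kernel (Cov d) (Bool × ℝ)} [IsMarkovKernel κ] {η : Ω → Nuisances d}
    (h : NuisancesFittedOn m η) :
    Measurable fun p : Ω × Obs d => residual Λ κ s (η p.1) p.2 :=
  h.measurable_phiTau.sub ((h.measurable_condMean (Λ := Λ) (s := s) (κ := κ)).comp
    (by fun_prop : Measurable fun p : Ω × Obs d => (p.1, p.2.1)))

theorem measurable_comp_prodMk {Ω α β : Type*} {m mΩ : MeasurableSpace Ω} [MeasurableSpace α]
    [MeasurableSpace β] (hm : m ≤ mΩ) {g : Ω × α → β} (hg : Measurable[m.prod inferInstance] g)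
    {Y : Ω → α} (hY : Measurable[mΩ] Y) : Measurable[mΩ] fun ω => g (ω, Y ω) :=
  hg.comp (Measurable.prodMk (measurable_id'' hm) hY)

theorem measurable_of_le_left {Ω α β : Type*} {m m' : MeasurableSpace Ω} [mα : MeasurableSpace α]
    [MeasurableSpace β] (hm : m ≤ m') {g : Ω × α → β} (hg : Measurable[m.prod mα] g) :
    Measurable[m'.prod mα] g :=
  hg.mono (sup_le_sup (MeasurableSpace.comap_mono hm) le_rfl) le_rfl

/-- A function of `(m, Y)` is a jointly measurable function of `ω` (through `m`) and `Y`. -/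
theorem exists_eq_of_measurable_sup {Ω α : Type*} {m : MeasurableSpace Ω} [mα : MeasurableSpace α]
    {Y : Ω → α} {b : Ω → ℝ} (hb : Measurable[m ⊔ MeasurableSpace.comap Y mα] b) :
    ∃ g : Ω × α → ℝ, Measurable[m.prod mα] g ∧ ∀ ω, b ω = g (ω, Y ω) := by
  have h : m ⊔ MeasurableSpace.comap Y mα =
      MeasurableSpace.comap (fun ω => (ω, Y ω)) (m.prod mα) := by
    rw [MeasurableSpace.prod, MeasurableSpace.comap_sup, MeasurableSpace.comap_comp,
      MeasurableSpace.comap_comp]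
    congr 1
    exact MeasurableSpace.comap_id.symm
  rw [h] at hb
  obtain ⟨g, hg, hbg⟩ := Measurable.exists_eq_measurable_comp hb
  exact ⟨g, hg, fun ω => congrFun hbg ω⟩

namespace Design

variable {Ω : Type*} {G : MeasurableSpace Ω} [mΩ : MeasurableSpace Ω] {μ : Measure Ω}
  [IsProbabilityMeasure μ] {Λ : ℝ} {s : Side} {K : ℕ} {PX : Measure (Cov d)}
  [IsProbabilityMeasure PX] {κ : Kernel (Cov d) (Bool × ℝ)} [IsMarkovKernel κ]
  {Z : ℕ → Ω → Obs d} {ηhat : ℕ → ℕ → Ω → Nuisances d} {f : Cov d → Bool → ℝ → ℝ} {ε B : ℝ}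

theorem othersSigma_le (h : Design G μ Λ s K PX κ Z ηhat f ε B) (i : ℕ) :
    othersSigma G Z i ≤ mΩ :=
  sup_le (iSup₂_le fun j _ => (h.measurable j).comap_le) h.le

/-- The remaining randomness is represented by the identity map into `Ω` with the smaller σ-algebra,
so that functions fitted on it are literally functions of that variable. -/
theorem indepFun_others (h : Design G μ Λ s K PX κ Z ηhat f ε B) (i : ℕ) :
    @IndepFun Ω Ω (Obs d) mΩ (othersSigma G Z i) inferInstance id (Z i) μ := by
  have hle : ∀ j, MeasurableSpace.comap (Z j) inferInstance ≤ mΩ := fun j => (h.measurable j).comap_le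
  have hT : (⨆ j ∈ {j : ℕ | j ≠ i}, MeasurableSpace.comap (Z j) inferInstance) ≤ mΩ :=
    iSup₂_le fun j _ => hle j
  have h1 : Indep (⨆ j ∈ {j : ℕ | j ≠ i}, MeasurableSpace.comap (Z j) inferInstance)
      (⨆ j ∈ ({i} : Set ℕ), MeasurableSpace.comap (Z j) inferInstance) μ :=
    indep_iSup_of_disjoint hle h.indep (by simp)
  have h2 : (⨆ j ∈ ({i} : Set ℕ), MeasurableSpace.comap (Z j) inferInstance) =
      MeasurableSpace.comap (Z i) inferInstance := by simp
  rw [h2] at h1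
  have h3 := indep_sup_left h.le hT (hle i) (indep_of_indep_of_le_right h.indepG
    (sup_le (iSup₂_le fun j _ => le_iSup (fun i => MeasurableSpace.comap (Z i) inferInstance) j)
      (le_iSup (fun i => MeasurableSpace.comap (Z i) inferInstance) i))) h1
  change Indep (MeasurableSpace.comap id _) _ μ
  rw [MeasurableSpace.comap_id]
  exact h3


/-- The point of cross-fitting: the training set of a fold omits every index of that fold, in
particular `i`. -/
theorem trainSigma_le_others {n k i : ℕ} (hik : i % K = k) :
    trainSigma K Z n k ⊔ G ≤ othersSigma G Z i := by
  refine sup_le_sup (iSup_le fun j => ?_) le_rfl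
  refine le_iSup₂_of_le j.1 ?_ le_rfl
  rintro rfl
  exact j.2.2 hik

theorem covariateSigma_le {n i : ℕ} :
    covariateSigma Z n ⊔ G ≤
      othersSigma G Z i ⊔ MeasurableSpace.comap (fun ω => (Z i ω).1) inferInstance := by
  refine sup_le (iSup_le fun j => ?_) (le_sup_right.trans le_sup_left)
  have hcomp : MeasurableSpace.comap (fun ω => (Z j.1 ω).1) inferInstance ≤
      MeasurableSpace.comap (Z j.1) inferInstance := by
    rw [show (fun ω => (Z j.1 ω).1) = Prod.fst ∘ Z j.1 from rfl, ← MeasurableSpace.comap_comp]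
    exact MeasurableSpace.comap_mono measurable_fst.comap_le
  by_cases hj : j.1 = i
  · rw [← hj]; exact le_sup_right
  · refine le_trans (hcomp.trans ?_) (le_sup_left.trans le_sup_left)
    exact le_iSup₂_of_le j.1 hj le_rfl

theorem covariateSigma_le' (h : Design G μ Λ s K PX κ Z ηhat f ε B) (n : ℕ) :
    covariateSigma Z n ⊔ G ≤ mΩ :=
  sup_le (iSup_le fun j => (measurable_fst.comp (h.measurable j)).comap_le) h.le

/-- Almost sure statements about one observation, given a fit on the others. -/
theorem ae_mem (h : Design G μ Λ s K PX κ Z ηhat f ε B) (i : ℕ) {S : Set (Ω × Obs d)}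
    (hS : MeasurableSet[(othersSigma G Z i).prod inferInstance] S)
    (hae : ∀ᵐ ω ∂μ, ∀ᵐ z ∂(PX.compProd κ), (ω, z) ∈ S) : ∀ᵐ ω ∂μ, (ω, Z i ω) ∈ S :=
  ae_mem_of_ae_ae (mT := othersSigma G Z i) (ι := id) (measurable_id'' (h.othersSigma_le i))
    (h.measurable i) (h.indepFun_others i) (h.law i) hS hae

theorem measurable_residual (h : Design G μ Λ s K PX κ Z ηhat f ε B) (n i : ℕ) :
    Measurable fun ω => residual Λ κ s (ηhat n (i % K) ω) (Z i ω) :=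
  measurable_comp_prodMk ((trainSigma_le_others rfl).trans (h.othersSigma_le i))
    (h.fitted n (i % K) (Nat.mod_lt i h.folds_pos)).measurable_residual (h.measurable i)

theorem ae_abs_residual_le (h : Design G μ Λ s K PX κ Z ηhat f ε B) (n i : ℕ) :
    ∀ᵐ ω ∂μ, |residual Λ κ s (ηhat n (i % K) ω) (Z i ω)| ≤ 2 * phiBound Λ ε B := by
  have hk := Nat.mod_lt i h.folds_pos
  have hm : Measurable[(othersSigma G Z i).prod inferInstance]
      fun p : Ω × Obs d => residual Λ κ s (ηhat n (i % K) p.1) p.2 :=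
    measurable_of_le_left (trainSigma_le_others rfl) (h.fitted n _ hk).measurable_residual
  refine h.ae_mem i (S := {p | |residual Λ κ s (ηhat n (i % K) p.1) p.2| ≤ 2 * phiBound Λ ε B})
    ((continuous_abs.measurable.comp hm) measurableSet_Iic) ?_
  filter_upwards [h.bounded n _ hk] with ω hω
  have hb : ∀ᵐ x ∂PX, BoundedAt Λ κ s f ε B (ηhat n (i % K) ω) x ∧ RegularAt κ B x :=
    hω.and h.regular
  have hy : ∀ᵐ z ∂(PX.compProd κ), |z.2.2| ≤ B := by
    rw [Measure.ae_compProd_iff (measurableSet_le (by fun_prop) (by fun_prop))]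
    exact h.regular.mono fun x hx => hx.bounded
  filter_upwards [ae_compProd_of_ae_left (κ := κ) hb, hy] with z ⟨h1, h2⟩ h3
  have b1 := h1.abs_phiTau_le h.one_le h.eps_pos h3
  have b2 := h1.abs_condMean_le h.one_le h.eps_pos h2
  exact (abs_sub _ _).trans (by rw [Prod.mk.eta] at b1; linarith)

/-- Freeze the other observations, the external randomness and the covariate of observation `i`.
Then `b` is fixed, and so is the residual of `j`, because `i` and `j` share a fit that does not use
observation `i`; the residual of `i` has conditional mean zero. -/
theorem integral_residual_mul_residual (h : Design G μ Λ s K PX κ Z ηhat f ε B) {n i j : ℕ}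
    (hij : i ≠ j) (hmod : i % K = j % K) {b : Ω → ℝ}
    (hb : Measurable[covariateSigma Z n ⊔ G] b) {c : ℝ} (hc : ∀ ω, |b ω| ≤ c) :
    ∫ ω, b ω * residual Λ κ s (ηhat n (j % K) ω) (Z j ω) *
      residual Λ κ s (ηhat n (i % K) ω) (Z i ω) ∂μ = 0 := by
  have hk := Nat.mod_lt i h.folds_pos
  obtain ⟨g, hg, hbg⟩ := exists_eq_of_measurable_sup (hb.mono (covariateSigma_le (i := i)) le_rfl)
  have hle : trainSigma K Z n (i % K) ⊔ G ≤ othersSigma G Z i := trainSigma_le_others rfl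
  have hres := (h.fitted n _ hk).measurable_residual (Λ := Λ) (s := s) (κ := κ)
  have hZj : Measurable[othersSigma G Z i] (Z j) := by
    refine Measurable.mono (comap_measurable (Z j)) ?_ le_rfl
    exact le_sup_of_le_left (le_iSup₂_of_le j hij.symm le_rfl)
  have hDj : Measurable[othersSigma G Z i]
      fun ω => residual Λ κ s (ηhat n (i % K) ω) (Z j ω) := measurable_comp_prodMk hle hres hZj
  set F : Ω × Obs d → ℝ := fun p => g (p.1, p.2.1) *
    residual Λ κ s (ηhat n (i % K) p.1) (Z j p.1) * residual Λ κ s (ηhat n (i % K) p.1) p.2 with hF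
  have hFm : Measurable[(othersSigma G Z i).prod inferInstance] F := by
    let := othersSigma G Z i
    refine Measurable.mul (Measurable.mul ?_ ?_) (measurable_of_le_left hle hres)
    · exact hg.comp (by fun_prop : Measurable fun p : Ω × Obs d => (p.1, p.2.1))
    · exact hDj.comp measurable_fst
  have hbm : Measurable b := hb.mono (h.covariateSigma_le' n) le_rfl
  have hFeq : ∀ ω, b ω * residual Λ κ s (ηhat n (j % K) ω) (Z j ω) *
      residual Λ κ s (ηhat n (i % K) ω) (Z i ω) = F (ω, Z i ω) := fun ω => by
    simp only [hF, ← hmod, hbg]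
  simp_rw [hFeq]
  refine integral_eq_zero_of_conditional_mean (mT := othersSigma G Z i) (ι := id)
    (measurable_id'' (h.othersSigma_le i)) (h.measurable i) (h.indepFun_others i) (h.law i) hFm ?_ ?_
  · simp only [id, ← hFeq]
    refine Integrable.of_bound ((hbm.mul (h.measurable_residual n j)).mul
      (h.measurable_residual n i)).aestronglyMeasurable
      (c * (2 * phiBound Λ ε B) * (2 * phiBound Λ ε B)) ?_
    filter_upwards [h.ae_abs_residual_le n i, h.ae_abs_residual_le n j] with ω h1 h2
    rw [norm_mul, norm_mul]
    have hc0 : 0 ≤ c := (abs_nonneg _).trans (hc ω)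
    have hp0 := (abs_nonneg _).trans h1
    exact mul_le_mul (mul_le_mul (hc ω) h2 (norm_nonneg _) hc0) h1 (norm_nonneg _) (by positivity)
  · filter_upwards [h.bounded n _ hk] with ω hω
    filter_upwards [hω, h.regular] with x hx hr
    simp only [id, hF]
    rw [integral_const_mul]
    have : ∫ p, residual Λ κ s (ηhat n (i % K) ω) (x, p) ∂(κ x) = 0 := by
      simp only [residual]
      rw [integral_sub (hx.integrable_phiTau h.one_le h.eps_pos hr) (integrable_const _)]
      simp [condMean]
    rw [this, mul_zero]

end Design

end BLearner

/-! ### Concentration of the residuals and uniform control of the bias -/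

namespace BLearner

variable {d : ℕ}

namespace Design

variable {Ω : Type*} {G : MeasurableSpace Ω} [mΩ : MeasurableSpace Ω] {μ : Measure Ω}
  [IsProbabilityMeasure μ] {Λ : ℝ} {s : Side} {K : ℕ} {PX : Measure (Cov d)}
  [IsProbabilityMeasure PX] {κ : Kernel (Cov d) (Bool × ℝ)} [IsMarkovKernel κ]
  {Z : ℕ → Ω → Obs d} {ηhat : ℕ → ℕ → Ω → Nuisances d} {f : Cov d → Bool → ℝ → ℝ} {ε B : ℝ}

theorem bound_nonneg (h : Design G μ Λ s K PX κ Z ηhat f ε B) : 0 ≤ B := by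
  obtain ⟨ω, hω⟩ := (h.bounded 0 0 h.folds_pos).exists
  obtain ⟨x, hx⟩ := hω.exists
  exact (abs_nonneg _).trans hx.q1

theorem phiBound_nonneg (h : Design G μ Λ s K PX κ Z ηhat f ε B) : 0 ≤ phiBound Λ ε B := by
  have := h.bound_nonneg
  have := h.eps_pos
  have := h.one_le
  unfold phiBound
  positivity

theorem measure_residual_fold_ge_le (h : Design G μ Λ s K PX κ Z ηhat f ε B) (n k : ℕ)
    {a : ℕ → Ω → ℝ} (ha : ∀ i < n, Measurable[covariateSigma Z n ⊔ G] (a i)) {c δ : ℝ}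
    (hc : 0 ≤ c) (hδ : 0 < δ) :
    μ {ω | δ ≤ |∑ i ∈ (Finset.range n).filter (fun i => i % K = k),
        a i ω * residual Λ κ s (ηhat n (i % K) ω) (Z i ω)|} ≤
      μ {ω | c < ∑ i ∈ Finset.range n, a i ω ^ 2} +
        ENNReal.ofReal ((2 * phiBound Λ ε B) ^ 2 * c / δ ^ 2) := by
  have hle := h.covariateSigma_le' n
  have ham : ∀ i ∈ Finset.range n, Measurable[covariateSigma Z n ⊔ G] (a i) := fun i hi =>
    ha i (Finset.mem_range.1 hi)
  refine measure_abs_weighted_sum_ge_le (Finset.filter_subset _ _)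
    (fun i hi => (ham i hi).mono hle le_rfl) (fun i _ => h.measurable_residual n i) hδ
    (fun i _ => h.ae_abs_residual_le n i) (by linarith [h.phiBound_nonneg]) hc ?_
  intro i hi j hj hij
  have hi' := Finset.mem_filter.1 hi
  have hj' := Finset.mem_filter.1 hj
  have hE : MeasurableSet[covariateSigma Z n ⊔ G] {ω | ∑ l ∈ Finset.range n, a l ω ^ 2 ≤ c} := by
    refine @measurableSet_le _ _ _ _ _ (covariateSigma Z n ⊔ G) _ _ _ _ _ ?_ measurable_const
    exact Finset.measurable_fun_sum _ fun l hl => (ham l hl).pow_const 2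
  -- The truncation event involves only the weights, so the truncated product `a i * a j` is still a
  -- function of covariates and external randomness, now bounded by `c`.
  refine h.integral_residual_mul_residual hij (hi'.2.trans hj'.2.symm)
    (((ham i hi'.1).mul (ham j hj'.1)).indicator hE) (c := c) fun ω => ?_
  by_cases hω : ω ∈ {ω | ∑ l ∈ Finset.range n, a l ω ^ 2 ≤ c}
  · rw [indicator_of_mem hω, abs_mul]
    have hsum : ∀ l ∈ Finset.range n, a l ω ^ 2 ≤ c := fun l hl =>
      (Finset.single_le_sum (f := fun l => a l ω ^ 2) (fun _ _ => sq_nonneg _) hl).trans hω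
    have h1 := hsum i hi'.1
    have h2 := hsum j hj'.1
    rw [← sq_abs] at h1 h2
    nlinarith [sq_nonneg (|a i ω| - |a j ω|)]
  · rw [indicator_of_notMem hω, abs_zero]; exact hc

/-- Residuals of different folds need not be orthogonal, since the fit for one fold uses the data of
the other. A union bound over the folds, each allotted `δ / K`, avoids these cross terms. -/
theorem measure_residual_sum_ge_le (h : Design G μ Λ s K PX κ Z ηhat f ε B) (n : ℕ)
    {a : ℕ → Ω → ℝ} (ha : ∀ i < n, Measurable[covariateSigma Z n ⊔ G] (a i)) {c δ : ℝ}
    (hc : 0 ≤ c) (hδ : 0 < δ) :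
    μ {ω | δ ≤ |∑ i ∈ Finset.range n, a i ω * residual Λ κ s (ηhat n (i % K) ω) (Z i ω)|} ≤
      K * (μ {ω | c < ∑ i ∈ Finset.range n, a i ω ^ 2} +
        ENNReal.ofReal ((2 * phiBound Λ ε B) ^ 2 * c / (δ / K) ^ 2)) := by
  have hK : (0 : ℝ) < K := Nat.cast_pos.2 h.folds_pos
  have hsub : {ω | δ ≤ |∑ i ∈ Finset.range n, a i ω * residual Λ κ s (ηhat n (i % K) ω) (Z i ω)|} ⊆
      ⋃ k ∈ Finset.range K, {ω | δ / K ≤ |∑ i ∈ (Finset.range n).filter (fun i => i % K = k),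
        a i ω * residual Λ κ s (ηhat n (i % K) ω) (Z i ω)|} := fun ω hω => by
    by_contra hcon
    simp only [mem_iUnion, mem_ofPred_eq, not_exists, not_le] at hcon
    have hfib := Finset.sum_fiberwise_of_maps_to (s := Finset.range n) (t := Finset.range K)
      (g := fun i => i % K) (fun i _ => Finset.mem_range.2 (Nat.mod_lt i h.folds_pos))
      (fun i => a i ω * residual Λ κ s (ηhat n (i % K) ω) (Z i ω))
    have h1 : |∑ i ∈ Finset.range n, a i ω * residual Λ κ s (ηhat n (i % K) ω) (Z i ω)| <
        ∑ _k ∈ Finset.range K, δ / K := by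
      rw [← hfib]
      exact (Finset.abs_sum_le_sum_abs _ _).trans_lt (Finset.sum_lt_sum_of_nonempty
        (Finset.nonempty_range_iff.2 h.folds_pos.ne') fun k hk => hcon k hk)
    rw [Finset.sum_const, Finset.card_range, nsmul_eq_mul, mul_div_cancel₀ _ hK.ne'] at h1
    exact absurd hω (not_le.2 h1)
  refine (measure_mono hsub).trans ((measure_biUnion_finset_le _ _).trans ?_)
  refine (Finset.sum_le_sum fun k _ =>
    h.measure_residual_fold_ge_le n k ha hc (div_pos hδ hK)).trans ?_
  rw [Finset.sum_const, Finset.card_range, nsmul_eq_mul]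

/-- Off an event of small probability, the conditional means of the pseudo-outcomes are uniformly
close to the sharp bounds. -/
theorem ae_abs_condMean_sub_le (h : Design G μ Λ s K PX κ Z ηhat f ε B) (n i : ℕ) (δ : ℝ) :
    ∀ᵐ ω ∂μ, (∀ᵐ x ∂PX, |condMean Λ κ s (ηhat n (i % K) ω) x - tauStar Λ κ s x| ≤ δ) →
      |condMean Λ κ s (ηhat n (i % K) ω) (Z i ω).1 - tauStar Λ κ s (Z i ω).1| ≤ δ := by
  have hk := Nat.mod_lt i h.folds_pos
  set A := {p : Ω × Cov d | |condMean Λ κ s (ηhat n (i % K) p.1) p.2 - tauStar Λ κ s p.2| ≤ δ} with hA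
  have hAm : MeasurableSet[(othersSigma G Z i).prod inferInstance] A := by
    have h1 := measurable_of_le_left (trainSigma_le_others (G := G) (Z := Z) (n := n) (K := K) rfl)
      ((h.fitted n _ hk).measurable_condMean (Λ := Λ) (s := s) (κ := κ))
    have h2 : Measurable[(othersSigma G Z i).prod inferInstance]
        fun p : Ω × Cov d => tauStar Λ κ s p.2 := by
      exact @Measurable.comp _ _ _ ((othersSigma G Z i).prod inferInstance) _ _ _ _
        (measurable_tauStar κ h.one_le s) (@measurable_snd _ _ (othersSigma G Z i) _)
    have h3 : Measurable[(othersSigma G Z i).prod inferInstance]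
        fun p : Ω × Cov d => condMean Λ κ s (ηhat n (i % K) p.1) p.2 - tauStar Λ κ s p.2 :=
      Measurable.sub h1 h2
    exact (continuous_abs.measurable.comp h3) measurableSet_Iic
  have hFm : MeasurableSet[othersSigma G Z i] {ω | PX (Prod.mk ω ⁻¹' Aᶜ) = 0} := by
    let := othersSigma G Z i
    exact measurable_measure_prodMk_left (MeasurableSet.compl hAm) (measurableSet_singleton 0)
  -- The implication is written as one jointly measurable set, bad fit or good point, which holds
  -- for almost every independent point whatever the fit; so `ae_mem` applies.
  set S : Set (Ω × Obs d) := {p | p.1 ∈ {ω | PX (Prod.mk ω ⁻¹' Aᶜ) = 0}ᶜ ∨ (p.1, p.2.1) ∈ A} with hS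
  have hSm : MeasurableSet[(othersSigma G Z i).prod inferInstance] S := by
    let := othersSigma G Z i
    refine MeasurableSet.union (measurable_fst hFm.compl) ?_
    exact (by fun_prop : Measurable fun p : Ω × Obs d => (p.1, p.2.1)) hAm
  have hmem := h.ae_mem i hSm (Eventually.of_forall fun ω => by
    by_cases hω : PX (Prod.mk ω ⁻¹' Aᶜ) = 0
    · have : ∀ᵐ x ∂PX, (ω, x) ∈ A := by
        rw [ae_iff]; exact hω
      filter_upwards [ae_compProd_of_ae_left (κ := κ) this] with z hz
      exact Or.inr hz
    · exact Eventually.of_forall fun z => Or.inl hω)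
  filter_upwards [hmem] with ω hω hae
  rcases hω with h1 | h1
  · exact absurd (show PX (Prod.mk ω ⁻¹' Aᶜ) = 0 from ae_iff.1 hae) h1
  · exact h1

end Design

/-- The consistency assumptions on the nuisance estimates. -/
structure ConsistentNuisances {Ω : Type*} [MeasurableSpace Ω] (μ : Measure Ω)
    (Λ : ℝ) (s : Side) (K : ℕ) (PX : Measure (Cov d)) (κ : Kernel (Cov d) (Bool × ℝ))
    (ηhat : ℕ → ℕ → Ω → Nuisances d) : Prop where
  quantiles : ∀ k < K,
    UniformlyConsistent μ PX (fun n ω => (ηhat n k ω).q1) (fun x => qStar Λ κ s x true) ∧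
    UniformlyConsistent μ PX (fun n ω => (ηhat n k ω).q0) (fun x => qStar Λ κ s.flip x false)
  robust : (∀ k < K, UniformlyConsistent μ PX (fun n ω => (ηhat n k ω).e) (propensity κ)) ∨
    (∀ k < K,
      UniformlyConsistent μ PX (fun n ω => (ηhat n k ω).rho1) (fun x => rhoStar Λ κ s x true) ∧
      UniformlyConsistent μ PX (fun n ω => (ηhat n k ω).rho0) (fun x => rhoStar Λ κ s.flip x false))

namespace Design

variable {Ω : Type*} {G : MeasurableSpace Ω} [mΩ : MeasurableSpace Ω] {μ : Measure Ω}
  [IsProbabilityMeasure μ] {Λ : ℝ} {s : Side} {K : ℕ} {PX : Measure (Cov d)}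
  [IsProbabilityMeasure PX] {κ : Kernel (Cov d) (Bool × ℝ)} [IsMarkovKernel κ]
  {Z : ℕ → Ω → Obs d} {ηhat : ℕ → ℕ → Ω → Nuisances d} {f : Cov d → Bool → ℝ → ℝ} {ε B : ℝ}

/-- In each product of errors one factor is small by assumption and the other is merely bounded;
which is which depends on the case of `robust`. -/
theorem uniformlyConsistent_condMean (h : Design G μ Λ s K PX κ Z ηhat f ε B)
    (hc : ConsistentNuisances μ Λ s K PX κ ηhat) {k : ℕ} (hk : k < K) :
    UniformlyConsistent μ PX (fun n ω => condMean Λ κ s (ηhat n k ω)) (tauStar Λ κ s) := by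
  intro δ hδ
  have hΛ := h.one_le
  have hB := h.bound_nonneg
  have hε := h.eps_pos
  -- One budget for both cases: two quantile errors with factor `1 + Λ`, two `rho` errors bounded by
  -- `(2 + 2 * Λ) * B`, and two propensity errors bounded by `1`.
  set L := 2 * (1 + Λ) + 2 * ((2 + 2 * Λ) * B) + 2 with hL
  have hL0 : 0 < L := by positivity
  set γ := ε * δ / L with hγ
  have hγ0 : 0 < γ := by positivity
  have hγL : ε⁻¹ * (L * γ) = δ := by rw [hγ]; field_simp
  have hprodB : 0 ≤ (2 + 2 * Λ) * B * γ := by positivity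
  obtain ⟨hq1, hq0⟩ := hc.quantiles k hk
  have hsum := (hq1 γ hγ0).add (hq0 γ hγ0)
  rcases hc.robust with he | hρ
  · have hsum := hsum.add (he k hk γ hγ0)
    rw [add_zero, add_zero] at hsum
    refine tendsto_of_tendsto_of_tendsto_of_le_of_le tendsto_const_nhds hsum (fun _ => bot_le)
      fun n => ?_
    refine (measure_mono_ae ?_).trans ((measure_union_le _ _).trans
      (add_le_add (measure_union_le _ _) le_rfl))
    filter_upwards [h.bounded n k hk] with ω hω hbad
    by_contra hcon
    obtain ⟨h10, h2⟩ := not_or.1 hcon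
    obtain ⟨h1, h0⟩ := not_or.1 h10
    refine hbad ?_
    filter_upwards [hω, h.regular, not_not.1 h1, not_not.1 h0, not_not.1 h2] with x hx hr b1 b0 b2
    refine (hx.abs_condMean_sub_le hΛ hε hr).trans ?_
    rw [← hγL]
    refine mul_le_mul_of_nonneg_left ?_ (by positivity)
    have r1 : |(ηhat n k ω).rho1 x - rhoStar Λ κ s x true| ≤ (2 + 2 * Λ) * B :=
      (abs_sub _ _).trans (by linarith [hx.rho1, hr.abs_rhoStar_le hΛ s true])
    have r0 : |(ηhat n k ω).rho0 x - rhoStar Λ κ s.flip x false| ≤ (2 + 2 * Λ) * B :=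
      (abs_sub _ _).trans (by linarith [hx.rho0, hr.abs_rhoStar_le hΛ s.flip false])
    have p1 := mul_le_mul r1 b2 (abs_nonneg _) (by positivity)
    have p0 := mul_le_mul r0 b2 (abs_nonneg _) (by positivity)
    have u1 := mul_le_mul_of_nonneg_left b1 (by positivity : 0 ≤ 1 + Λ)
    have u0 := mul_le_mul_of_nonneg_left b0 (by positivity : 0 ≤ 1 + Λ)
    rw [hL]
    linarith
  · have hsum := hsum.add (((hρ k hk).1 γ hγ0).add ((hρ k hk).2 γ hγ0))
    rw [add_zero, add_zero] at hsum
    refine tendsto_of_tendsto_of_tendsto_of_le_of_le tendsto_const_nhds hsum (fun _ => bot_le)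
      fun n => ?_
    refine (measure_mono_ae ?_).trans ((measure_union_le _ _).trans
      (add_le_add (measure_union_le _ _) (measure_union_le _ _)))
    filter_upwards [h.bounded n k hk] with ω hω hbad
    by_contra hcon
    obtain ⟨h10, h23⟩ := not_or.1 hcon
    obtain ⟨h1, h0⟩ := not_or.1 h10
    obtain ⟨h2, h3⟩ := not_or.1 h23
    refine hbad ?_
    filter_upwards [hω, h.regular, not_not.1 h1, not_not.1 h0, not_not.1 h2, not_not.1 h3]
      with x hx hr b1 b0 b2 b3
    refine (hx.abs_condMean_sub_le hΛ hε hr).trans ?_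
    rw [← hγL]
    refine mul_le_mul_of_nonneg_left ?_ (by positivity)
    have he : |(ηhat n k ω).e x - propensity κ x| ≤ 1 := by
      have := hr.overlap
      rw [abs_le]
      constructor <;> linarith [hx.e.1, hx.e.2, this.1, this.2]
    have p1 := mul_le_mul b2 he (abs_nonneg _) hγ0.le
    have p0 := mul_le_mul b3 he (abs_nonneg _) hγ0.le
    have u1 := mul_le_mul_of_nonneg_left b1 (by positivity : 0 ≤ 1 + Λ)
    have u0 := mul_le_mul_of_nonneg_left b0 (by positivity : 0 ≤ 1 + Λ)
    rw [hL]
    linarith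

/-- The conditional means at all sample points are uniformly close to the sharp bounds. -/
theorem tendsto_measure_condMean_sub (h : Design G μ Λ s K PX κ Z ηhat f ε B)
    (hc : ConsistentNuisances μ Λ s K PX κ ηhat) {δ : ℝ} (hδ : 0 < δ) :
    Tendsto (fun n => μ {ω | ¬ ∀ i,
      |condMean Λ κ s (ηhat n (i % K) ω) (Z i ω).1 - tauStar Λ κ s (Z i ω).1| ≤ δ}) atTop (𝓝 0) := by
  have hsum : Tendsto (fun n => ∑ k ∈ Finset.range K,
      μ {ω | ¬ ∀ᵐ x ∂PX, |condMean Λ κ s (ηhat n k ω) x - tauStar Λ κ s x| ≤ δ}) atTop (𝓝 0) := by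
    have := tendsto_finsetSum (Finset.range K) fun k hk =>
      h.uniformlyConsistent_condMean hc (Finset.mem_range.1 hk) δ hδ
    simpa using this
  refine tendsto_of_tendsto_of_tendsto_of_le_of_le tendsto_const_nhds hsum (fun _ => bot_le)
    fun n => ?_
  refine (measure_mono_ae ?_).trans (measure_biUnion_finset_le (Finset.range K) _)
  filter_upwards [ae_all_iff.2 fun i => h.ae_abs_condMean_sub_le n i δ] with ω hω hbad
  by_contra hcon
  refine hbad fun i => hω i ?_
  by_contra hi
  exact hcon (mem_iUnion₂.2 ⟨i % K, Finset.mem_range.2 (Nat.mod_lt i h.folds_pos), hi⟩)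

end Design

end BLearner

namespace BLearner

/-! ### Convergence to zero in probability -/

/-- `S_n → 0` in probability. -/
def Vanishes {T : Type*} [MeasurableSpace T] (ν : Measure T) (S : ℕ → T → ℝ) : Prop :=
  ∀ δ : ℝ, 0 < δ → Tendsto (fun n => ν {t | δ ≤ |S n t|}) atTop (𝓝 0)

section Vanishes

variable {T : Type*} [MeasurableSpace T] {ν : Measure T} {S S' : ℕ → T → ℝ}

theorem tendstoInMeasure_iff_vanishes {g : T → ℝ} :
    TendstoInMeasure ν S atTop g ↔ Vanishes ν (fun n t => S n t - g t) := by
  rw [tendstoInMeasure_iff_norm]; rfl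

theorem vanishes_of_forall_ofReal
    (h : ∀ δ : ℝ, 0 < δ → ∀ r : ℝ, 0 < r → ∀ᶠ n in atTop, ν {t | δ ≤ |S n t|} ≤ ENNReal.ofReal r) :
    Vanishes ν S := fun δ hδ => by
  rw [ENNReal.tendsto_nhds_zero]
  intro r hr
  rcases eq_or_ne r ⊤ with rfl | hr'
  · exact Eventually.of_forall fun n => le_top
  · have := h δ hδ r.toReal (ENNReal.toReal_pos hr.ne' hr')
    rwa [ENNReal.ofReal_toReal hr'] at this

theorem Vanishes.eventually_le (h : Vanishes ν S) {δ r : ℝ} (hδ : 0 < δ) (hr : 0 < r) :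
    ∀ᶠ n in atTop, ν {t | δ ≤ |S n t|} ≤ ENNReal.ofReal r :=
  ENNReal.tendsto_nhds_zero.1 (h δ hδ) _ (ENNReal.ofReal_pos.2 hr)

theorem Vanishes.mono_ae (h : Vanishes ν S') (hle : ∀ n, ∀ᵐ t ∂ν, |S n t| ≤ |S' n t|) :
    Vanishes ν S := fun δ hδ => by
  refine tendsto_of_tendsto_of_tendsto_of_le_of_le tendsto_const_nhds (h δ hδ) (fun _ => bot_le)
    fun n => measure_mono_ae ?_
  filter_upwards [hle n] with t ht hδt
  exact le_trans (show δ ≤ |S n t| from hδt) ht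

theorem Vanishes.add (h : Vanishes ν S) (h' : Vanishes ν S') :
    Vanishes ν (fun n t => S n t + S' n t) := fun δ hδ => by
  have hsum := (h (δ / 2) (half_pos hδ)).add (h' (δ / 2) (half_pos hδ))
  rw [add_zero] at hsum
  refine tendsto_of_tendsto_of_tendsto_of_le_of_le tendsto_const_nhds hsum (fun _ => bot_le)
    fun n => (measure_mono fun t ht => ?_).trans (measure_union_le _ _)
  by_contra hcon
  obtain ⟨h1, h2⟩ := not_or.1 hcon
  have h1 : |S n t| < δ / 2 := not_le.1 h1
  have h2 : |S' n t| < δ / 2 := not_le.1 h2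
  have ht : δ ≤ |S n t + S' n t| := ht
  linarith [abs_add_le (S n t) (S' n t)]

theorem Vanishes.mul_isBigOpOne (h : Vanishes ν S) (h' : IsBigOpOne ν S') :
    Vanishes ν (fun n t => S n t * S' n t) := by
  refine vanishes_of_forall_ofReal fun δ hδ r hr => ?_
  obtain ⟨M, hM⟩ := h' (r / 2) (half_pos hr)
  have hM0 : 0 < |M| + 1 := by positivity
  filter_upwards [hM, h.eventually_le (div_pos hδ hM0) (half_pos hr)] with n h1 h2
  rw [← add_halves r, ENNReal.ofReal_add (half_pos hr).le (half_pos hr).le]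
  refine (measure_mono fun t ht => ?_).trans ((measure_union_le _ _).trans (add_le_add h2 h1))
  by_contra hcon
  obtain ⟨c1, c2⟩ := not_or.1 hcon
  have c1 : |S n t| < δ / (|M| + 1) := not_le.1 c1
  have c2 : |S' n t| ≤ M := not_lt.1 c2
  have ht : δ ≤ |S n t * S' n t| := ht
  rw [abs_mul] at ht
  rw [lt_div_iff₀ hM0] at c1
  have : |S n t| * |S' n t| ≤ |S n t| * (|M| + 1) :=
    mul_le_mul_of_nonneg_left (by linarith [le_abs_self M]) (abs_nonneg _)
  linarith

theorem Vanishes.const_mul (h : Vanishes ν S) (c : ℝ) : Vanishes ν (fun n t => c * S n t) := by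
  have h' : IsBigOpOne ν (fun _ _ => c : ℕ → T → ℝ) := fun δ _ => ⟨|c|, by simp⟩
  simpa [mul_comm] using h.mul_isBigOpOne h'

end Vanishes

/-! ### Weighted averages under Stone's limit conditions -/

section Weights

variable {d : ℕ} {T : Type*} [MeasurableSpace T] {ν : Measure T} {X : ℕ → T → Cov d}
  {x : T → Cov d} {W : ℕ → ℕ → T → ℝ}

/-- Weights that are uniformly negligible have a vanishing sum of squares. -/
theorem StoneLimits.sum_sq_vanishes (h : StoneLimits ν X x W)
    (hO : IsBigOpOne ν fun n t => ∑ i ∈ Finset.range n, |W n i t|) :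
    Vanishes ν fun n t => ∑ i ∈ Finset.range n, W n i t ^ 2 := by
  have hmax := tendstoInMeasure_iff_vanishes.1 h.max_zero
  -- The sum of squares is at most the largest weight times the total absolute weight.
  refine (hmax.mul_isBigOpOne hO).mono_ae fun n => Eventually.of_forall fun t => ?_
  rw [abs_of_nonneg (Finset.sum_nonneg fun _ _ => sq_nonneg _)]
  refine le_trans ?_ (le_abs_self _)
  rw [sub_zero, Finset.mul_sum]
  refine Finset.sum_le_sum fun i hi => ?_
  rw [← sq_abs, sq]
  refine mul_le_mul_of_nonneg_right ?_ (abs_nonneg _)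
  exact le_ciSup (f := fun j : Fin n => |W n j t|) (Set.finite_range _).bddAbove
    ⟨i, Finset.mem_range.1 hi⟩

/-- Averages with weights of bounded total mass, of values that are uniformly small off an event
of small probability. -/
theorem vanishes_sum_of_uniformly_small
    (hO : IsBigOpOne ν fun n t => ∑ i ∈ Finset.range n, |W n i t|) {b : ℕ → ℕ → T → ℝ}
    (hb : ∀ δ : ℝ, 0 < δ → Tendsto (fun n => ν {t | ¬ ∀ i, |b n i t| ≤ δ}) atTop (𝓝 0)) :
    Vanishes ν fun n t => ∑ i ∈ Finset.range n, W n i t * b n i t := by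
  refine vanishes_of_forall_ofReal fun δ hδ r hr => ?_
  obtain ⟨M, hM⟩ := hO (r / 2) (half_pos hr)
  have hM0 : 0 < |M| + 1 := by positivity
  have hγ : 0 < δ / (|M| + 1) / 2 := by positivity
  filter_upwards [hM, ENNReal.tendsto_nhds_zero.1 (hb _ hγ) _ (ENNReal.ofReal_pos.2 (half_pos hr))]
    with n h1 h2
  rw [← add_halves r, ENNReal.ofReal_add (half_pos hr).le (half_pos hr).le]
  refine (measure_mono fun t ht => ?_).trans ((measure_union_le _ _).trans (add_le_add h2 h1))
  by_contra hcon
  obtain ⟨c1, c2⟩ := not_or.1 hcon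
  have c1 : ∀ i, |b n i t| ≤ δ / (|M| + 1) / 2 := not_not.1 c1
  have c2 : |(∑ i ∈ Finset.range n, |W n i t|)| ≤ M := not_lt.1 c2
  have ht : δ ≤ |∑ i ∈ Finset.range n, W n i t * b n i t| := ht
  have : |∑ i ∈ Finset.range n, W n i t * b n i t| ≤
      (∑ i ∈ Finset.range n, |W n i t|) * (δ / (|M| + 1) / 2) := by
    rw [Finset.sum_mul]
    refine (Finset.abs_sum_le_sum_abs _ _).trans (Finset.sum_le_sum fun i _ => ?_)
    rw [abs_mul]
    exact mul_le_mul_of_nonneg_left (c1 i) (abs_nonneg _)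
  have h3 : ∑ i ∈ Finset.range n, |W n i t| ≤ |M| + 1 := by
    linarith [le_abs_self (∑ i ∈ Finset.range n, |W n i t|), le_abs_self M]
  have h4 := mul_le_mul_of_nonneg_right h3 hγ.le
  have h5 : (|M| + 1) * (δ / (|M| + 1) / 2) = δ / 2 := by field_simp
  linarith

/-- Localizing weights reproduce values that depend continuously on the point. -/
theorem StoneLimits.vanishes_sum_sub (h : StoneLimits ν X x W)
    (hO : IsBigOpOne ν fun n t => ∑ i ∈ Finset.range n, |W n i t|) {u : ℕ → T → ℝ} {v : T → ℝ}
    {H : ℝ} (hu : ∀ᵐ t ∂ν, ∀ i, |u i t| ≤ H) (hv : ∀ᵐ t ∂ν, |v t| ≤ H)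
    (hloc : ∀ δ : ℝ, 0 < δ → ∃ a : ℝ, 0 < a ∧
      ∀ᵐ t ∂ν, ∀ i, ‖X i t - x t‖ ≤ a → |u i t - v t| ≤ δ) :
    Vanishes ν fun n t => ∑ i ∈ Finset.range n, W n i t * u i t - v t := by
  refine vanishes_of_forall_ofReal fun δ hδ r hr => ?_
  obtain ⟨M, hM⟩ := hO (r / 2) (half_pos hr)
  have hM0 : 0 < |M| + 1 := by positivity
  have hγ : 0 < δ / (|M| + 1) / 2 := by positivity
  obtain ⟨a, ha, hclose⟩ := hloc _ hγ
  have hrest := ((tendstoInMeasure_iff_vanishes.1 (h.concentrate a ha)).const_mul (2 * H)).add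
    ((tendstoInMeasure_iff_vanishes.1 h.sum_one).const_mul H |>.mono_ae
      (S := fun n t => H * |∑ i ∈ Finset.range n, W n i t - 1|)
      fun n => Eventually.of_forall fun t => by rw [abs_mul, abs_mul, abs_abs])
  filter_upwards [hM, hrest.eventually_le (half_pos hδ) (half_pos hr)] with n h1 h2
  rw [← add_halves r, ENNReal.ofReal_add (half_pos hr).le (half_pos hr).le]
  refine (measure_mono_ae ?_).trans ((measure_union_le _ _).trans (add_le_add h2 h1))
  filter_upwards [hu, hv, hclose] with t hut hvt hct ht
  by_contra hcon
  obtain ⟨c1, c2⟩ := not_or.1 hcon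
  simp only [mem_ofPred_eq, not_le] at c1
  have c2 : |(∑ i ∈ Finset.range n, |W n i t|)| ≤ M := not_lt.1 c2
  have ht : δ ≤ |∑ i ∈ Finset.range n, W n i t * u i t - v t| := ht
  have c1 := (le_abs_self _).trans_lt c1
  simp only [sub_zero] at c1
  have hH : 0 ≤ H := (abs_nonneg _).trans hvt
  -- The error comes from near points, where `u` is close to `v`, from far points, whose total
  -- weight vanishes, and from the weights not summing exactly to one.
  have hsplit : ∑ i ∈ Finset.range n, W n i t * u i t - v t =
      ∑ i ∈ Finset.range n, W n i t * (u i t - v t) + v t * (∑ i ∈ Finset.range n, W n i t - 1) := by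
    simp_rw [mul_sub, Finset.sum_sub_distrib, ← Finset.sum_mul]; ring
  have hfirst : |∑ i ∈ Finset.range n, W n i t * (u i t - v t)| ≤
      (∑ i ∈ Finset.range n, |W n i t|) * (δ / (|M| + 1) / 2) + 2 * H *
        ∑ i ∈ Finset.range n, {t | a < ‖X i t - x t‖}.indicator (fun t => |W n i t|) t := by
    rw [Finset.sum_mul, Finset.mul_sum, ← Finset.sum_add_distrib]
    refine (Finset.abs_sum_le_sum_abs _ _).trans (Finset.sum_le_sum fun i _ => ?_)
    rw [abs_mul]
    by_cases hi : t ∈ {t | a < ‖X i t - x t‖}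
    · rw [indicator_of_mem hi]
      have : |u i t - v t| ≤ 2 * H := (abs_sub _ _).trans (by linarith [hut i])
      have h3 := mul_le_mul_of_nonneg_left this (abs_nonneg (W n i t))
      have h4 := mul_nonneg (abs_nonneg (W n i t)) hγ.le
      linarith
    · rw [indicator_of_notMem hi, mul_zero, add_zero]
      exact mul_le_mul_of_nonneg_left (hct i (not_lt.1 hi)) (abs_nonneg _)
  have hsecond : |v t * (∑ i ∈ Finset.range n, W n i t - 1)| ≤
      H * |∑ i ∈ Finset.range n, W n i t - 1| := by
    rw [abs_mul]
    exact mul_le_mul_of_nonneg_right hvt (abs_nonneg _)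
  have h3 : ∑ i ∈ Finset.range n, |W n i t| ≤ |M| := by
    linarith [le_abs_self (∑ i ∈ Finset.range n, |W n i t|), le_abs_self M]
  have h4 := mul_le_mul_of_nonneg_right h3 hγ.le
  have h5 : (|M| + 1) * (δ / (|M| + 1) / 2) = δ / 2 := by field_simp
  rw [hsplit] at ht
  have h6 := abs_add_le (∑ i ∈ Finset.range n, W n i t * (u i t - v t))
    (v t * (∑ i ∈ Finset.range n, W n i t - 1))
  nlinarith

end Weights

end BLearner

/-! ### Stone's theorem and assembly of the three error terms -/

namespace BLearner

variable {d : ℕ}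

/-- **Stone's theorem** for an integrable regression function observed without noise. -/
theorem StoneConditions.vanishes_sum_sub {Ω : Type*} [MeasurableSpace Ω] {μ : Measure Ω}
    [IsProbabilityMeasure μ] {PX : Measure (Cov d)} [IsProbabilityMeasure PX] {X : ℕ → Ω → Cov d}
    {W : ℕ → ℕ → Ω → Cov d → ℝ} (hS : StoneConditions μ PX X W) (hX : ∀ i, Measurable (X i))
    (hW : ∀ n, ∀ i < n, Measurable fun p : Ω × Cov d => W n i p.1 p.2)
    (hO : IsBigOpOne (μ.prod PX) fun n p => ∑ i ∈ Finset.range n, |W n i p.1 p.2|)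
    {τ : Cov d → ℝ} (hτ : Measurable τ) (hi : Integrable τ PX) :
    Vanishes (μ.prod PX) fun n p => ∑ i ∈ Finset.range n, W n i p.1 p.2 * τ (X i p.1) - τ p.2 := by
  obtain ⟨C, hC⟩ := hS.domination
  refine vanishes_of_forall_ofReal fun δ hδ r hr => ?_
  -- Both approximation errors go through Markov's inequality at level `δ / 3` with target `r / 3`,
  -- whence the `9`; `C + 1` serves the dominated sum and the error at the evaluation point alike.
  set γ := r * δ / (9 * (C + 1)) with hγ
  have hC0 : (0 : ℝ) ≤ C := C.2
  have hγ0 : 0 < γ := by positivity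
  obtain ⟨g, hgc, hgi, hgcont, hgint⟩ := hi.exists_hasCompactSupport_integral_sub_le hγ0
  obtain ⟨H, hH⟩ := hgcont.bounded_above_of_compact_support hgc
  have huc : UniformContinuous g := hgcont.uniformContinuous_of_tendsto_cocompact
    hgc.is_zero_at_infty
  have hsmooth : Vanishes (μ.prod PX)
      fun n p => ∑ i ∈ Finset.range n, W n i p.1 p.2 * g (X i p.1) - g p.2 := by
    refine hS.limits.vanishes_sum_sub hO (u := fun i p => g (X i p.1)) (v := fun p => g p.2) (H := H)
      (Eventually.of_forall fun p i => hH _) (Eventually.of_forall fun p => hH _) fun δ hδ => ?_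
    obtain ⟨a, ha, hga⟩ := Metric.uniformContinuous_iff.1 huc δ hδ
    refine ⟨a / 2, half_pos ha, Eventually.of_forall fun p i hp => ?_⟩
    have := hga (a := X i p.1) (b := p.2) (by rw [dist_eq_norm]; linarith)
    rw [Real.dist_eq] at this
    exact this.le
  set F : Cov d → ℝ≥0∞ := fun x => ENNReal.ofReal |τ x - g x| with hF
  have hFm : Measurable F := (hτ.sub hgcont.measurable).abs.ennreal_ofReal
  have hFint : ∫⁻ x, F x ∂PX ≤ ENNReal.ofReal γ := by
    have := ofReal_integral_eq_lintegral_ofReal (hi.sub hgint).abs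
      (Eventually.of_forall fun _ => abs_nonneg _)
    exact this.symm.le.trans (ENNReal.ofReal_le_ofReal hgi)
  have hδ3 : 0 < δ / 3 := by positivity
  have hlast : (μ.prod PX) {p | δ / 3 ≤ |τ p.2 - g p.2|} ≤ ENNReal.ofReal (r / 3) := by
    have hset : {p : Ω × Cov d | δ / 3 ≤ |τ p.2 - g p.2|} =
        univ ×ˢ {x | ENNReal.ofReal (δ / 3) ≤ F x} := by
      ext p
      simp [hF, ENNReal.ofReal_le_ofReal_iff (abs_nonneg _)]
    rw [hset, Measure.prod_prod, measure_univ, one_mul]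
    refine (meas_ge_le_lintegral_div hFm.aemeasurable (ENNReal.ofReal_pos.2 hδ3).ne'
      ENNReal.ofReal_ne_top).trans ?_
    refine (ENNReal.div_le_div_right hFint _).trans ?_
    rw [← ENNReal.ofReal_div_of_pos hδ3]
    refine ENNReal.ofReal_le_ofReal ?_
    rw [div_le_iff₀ hδ3, hγ, div_le_iff₀ (by positivity)]
    nlinarith [mul_pos hr hδ]
  -- Stone's domination condition bounds the smoothed approximation error by `C` times its integral
  -- under `PX`, uniformly in `n`.
  have hfirst : ∀ n, 1 ≤ n → (μ.prod PX)
      {p | δ / 3 ≤ |∑ i ∈ Finset.range n, W n i p.1 p.2 * (τ (X i p.1) - g (X i p.1))|} ≤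
      ENNReal.ofReal (r / 3) := fun n hn => by
    set S : Ω × Cov d → ℝ≥0∞ :=
      fun p => ∑ i ∈ Finset.range n, ENNReal.ofReal |W n i p.1 p.2| * F (X i p.1) with hSdef
    have hSm : Measurable S := Finset.measurable_fun_sum _ fun i hi =>
      (hW n i (Finset.mem_range.1 hi)).abs.ennreal_ofReal.mul
        (hFm.comp ((hX i).comp measurable_fst))
    have hsub : {p | δ / 3 ≤ |∑ i ∈ Finset.range n, W n i p.1 p.2 * (τ (X i p.1) - g (X i p.1))|} ⊆
        {p | ENNReal.ofReal (δ / 3) ≤ S p} := fun p hp => by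
      have hp : δ / 3 ≤ |∑ i ∈ Finset.range n, W n i p.1 p.2 * (τ (X i p.1) - g (X i p.1))| := hp
      have h2 : S p = ENNReal.ofReal
          (∑ i ∈ Finset.range n, |W n i p.1 p.2| * |τ (X i p.1) - g (X i p.1)|) := by
        rw [ENNReal.ofReal_sum_of_nonneg fun i _ => by positivity]
        exact Finset.sum_congr rfl fun i _ => (ENNReal.ofReal_mul (abs_nonneg _)).symm
      change ENNReal.ofReal (δ / 3) ≤ S p
      rw [h2]
      refine ENNReal.ofReal_le_ofReal (hp.trans ((Finset.abs_sum_le_sum_abs _ _).trans ?_))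
      exact Finset.sum_le_sum fun i _ => (abs_mul _ _).le
    refine (measure_mono hsub).trans ((meas_ge_le_lintegral_div hSm.aemeasurable
      (ENNReal.ofReal_pos.2 hδ3).ne' ENNReal.ofReal_ne_top).trans ?_)
    refine (ENNReal.div_le_div_right ((hC n hn F hFm).trans
      (mul_le_mul_right hFint (C : ℝ≥0∞))) _).trans ?_
    rw [← ENNReal.ofReal_coe_nnreal, ← ENNReal.ofReal_mul hC0, ← ENNReal.ofReal_div_of_pos hδ3]
    refine ENNReal.ofReal_le_ofReal ?_
    rw [div_le_iff₀ hδ3, hγ, mul_div_assoc', div_le_iff₀ (by positivity)]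
    nlinarith [mul_pos hr hδ]
  filter_upwards [eventually_ge_atTop 1, hsmooth.eventually_le hδ3 (by positivity : 0 < r / 3)]
    with n hn h2
  have hr3 : r = r / 3 + r / 3 + r / 3 := by ring
  rw [hr3, ENNReal.ofReal_add (by positivity) (by positivity),
    ENNReal.ofReal_add (by positivity) (by positivity)]
  refine (measure_mono fun p hp => ?_).trans ((measure_union_le _ _).trans
    (add_le_add ((measure_union_le _ _).trans (add_le_add (hfirst n hn) h2)) hlast))
  by_contra hcon
  obtain ⟨c12, c3⟩ := not_or.1 hcon
  obtain ⟨c1, c2⟩ := not_or.1 c12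
  simp only [mem_ofPred_eq, not_le] at c1 c2 c3
  have hp : δ ≤ |∑ i ∈ Finset.range n, W n i p.1 p.2 * τ (X i p.1) - τ p.2| := hp
  have hsplit : ∑ i ∈ Finset.range n, W n i p.1 p.2 * τ (X i p.1) - τ p.2 =
      ∑ i ∈ Finset.range n, W n i p.1 p.2 * (τ (X i p.1) - g (X i p.1)) +
      (∑ i ∈ Finset.range n, W n i p.1 p.2 * g (X i p.1) - g p.2) - (τ p.2 - g p.2) := by
    simp_rw [mul_sub, Finset.sum_sub_distrib]; ring
  rw [hsplit] at hp
  have h4 := abs_sub (∑ i ∈ Finset.range n, W n i p.1 p.2 * (τ (X i p.1) - g (X i p.1)) +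
      (∑ i ∈ Finset.range n, W n i p.1 p.2 * g (X i p.1) - g p.2)) (τ p.2 - g p.2)
  have h5 := abs_add_le (∑ i ∈ Finset.range n, W n i p.1 p.2 * (τ (X i p.1) - g (X i p.1)))
      (∑ i ∈ Finset.range n, W n i p.1 p.2 * g (X i p.1) - g p.2)
  linarith

/-- A Chebyshev bound in terms of a vanishing variance proxy gives convergence to zero. -/
theorem Vanishes.of_chebyshev {T : Type*} [MeasurableSpace T] {ν : Measure T} {S V : ℕ → T → ℝ}
    {K : ℕ} {A : ℝ} (hA : 0 ≤ A) (hK : 0 < K) (hV : Vanishes ν V)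
    (hS : ∀ n, ∀ c δ : ℝ, 0 < c → 0 < δ → ν {t | δ ≤ |S n t|} ≤
      K * (ν {t | c < V n t} + ENNReal.ofReal (A * c / (δ / K) ^ 2))) : Vanishes ν S := by
  refine vanishes_of_forall_ofReal fun δ hδ r hr => ?_
  have hK' : (0 : ℝ) < K := Nat.cast_pos.2 hK
  -- The factor `K` multiplies two terms of size at most `ρ`, giving `r` in total; `c` below makes
  -- the variance term at most `ρ`.
  set ρ := r / K / 2 with hρ
  have hρ0 : 0 < ρ := by positivity
  have hq : 0 < (δ / K) ^ 2 := by positivity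
  set c := ρ * (δ / K) ^ 2 / (A + 1) with hc
  have hc0 : 0 < c := by positivity
  filter_upwards [hV.eventually_le hc0 hρ0] with n hn
  have h1 : ν {t | c < V n t} ≤ ENNReal.ofReal ρ :=
    (measure_mono fun t (ht : c < V n t) => show c ≤ |V n t| from ht.le.trans (le_abs_self _)).trans hn
  have h2 : ENNReal.ofReal (A * c / (δ / K) ^ 2) ≤ ENNReal.ofReal ρ := by
    refine ENNReal.ofReal_le_ofReal ?_
    rw [div_le_iff₀ hq, hc, mul_div_assoc', div_le_iff₀ (by positivity)]
    nlinarith [mul_pos hρ0 hq]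
  refine (hS n c δ hc0 hδ).trans ?_
  refine (mul_le_mul_right (add_le_add h1 h2) (K : ℝ≥0∞)).trans ?_
  rw [← ENNReal.ofReal_add hρ0.le hρ0.le, ← ENNReal.ofReal_natCast, ← ENNReal.ofReal_mul hK'.le]
  refine ENNReal.ofReal_le_ofReal (le_of_eq ?_)
  rw [hρ]; field_simp; norm_num

/-- The three parts of the estimation error. -/
theorem tauHat_eq {Ω : Type*} (Λ : ℝ) (κ : Kernel (Cov d) (Bool × ℝ)) (s : Side) (K : ℕ)
    (Z : ℕ → Ω → Obs d) (ηhat : ℕ → ℕ → Ω → Nuisances d) (w : ℕ → ℕ → Ω → Cov d → ℝ)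
    (n : ℕ) (ω : Ω) (x : Cov d) :
    tauHat Λ s K Z ηhat w n ω x =
      ∑ i ∈ Finset.range n, w n i ω x / n * residual Λ κ s (ηhat n (i % K) ω) (Z i ω) +
      ∑ i ∈ Finset.range n, w n i ω x / n *
        (condMean Λ κ s (ηhat n (i % K) ω) (Z i ω).1 - tauStar Λ κ s (Z i ω).1) +
      ∑ i ∈ Finset.range n, w n i ω x / n * tauStar Λ κ s (Z i ω).1 := by
  rw [tauHat, Finset.mul_sum, ← Finset.sum_add_distrib, ← Finset.sum_add_distrib]
  refine Finset.sum_congr rfl fun i _ => ?_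
  rw [residual]; ring

theorem isBigOpOne_weights {T : Type*} [MeasurableSpace T] {ν : Measure T} {w : ℕ → ℕ → T → ℝ}
    (h : IsBigOpOne ν fun n t => (1 / (n : ℝ)) * ∑ i ∈ Finset.range n, |w n i t|) :
    IsBigOpOne ν fun n t => ∑ i ∈ Finset.range n, |w n i t / n| := by
  convert h using 3 with n t
  rw [Finset.mul_sum]
  refine Finset.sum_congr rfl fun i _ => ?_
  rw [abs_div, Nat.abs_cast]; ring

theorem FittedOn.measurable_section {Ω : Type*} {m : MeasurableSpace Ω} {g : Ω → Cov d → ℝ}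
    (h : FittedOn m g) (x : Cov d) : Measurable[m] fun ω => g ω x :=
  Measurable.comp h (measurable_id.prodMk measurable_const)

theorem FittedOn.measurable_of_le {Ω : Type*} {m mΩ : MeasurableSpace Ω} {g : Ω → Cov d → ℝ}
    (h : FittedOn m g) (hm : m ≤ mΩ) : Measurable fun p : Ω × Cov d => g p.1 p.2 :=
  measurable_of_le_left hm h

namespace Design

variable {Ω : Type*} {G : MeasurableSpace Ω} [mΩ : MeasurableSpace Ω] {μ : Measure Ω}
  [IsProbabilityMeasure μ] {Λ : ℝ} {s : Side} {K : ℕ} {PX : Measure (Cov d)}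
  [IsProbabilityMeasure PX] {κ : Kernel (Cov d) (Bool × ℝ)} [IsMarkovKernel κ]
  {Z : ℕ → Ω → Obs d} {ηhat : ℕ → ℕ → Ω → Nuisances d} {f : Cov d → Bool → ℝ → ℝ} {ε B : ℝ}
  {w : ℕ → ℕ → Ω → Cov d → ℝ}

/-- For each fixed evaluation point the weights depend only on covariates and external randomness,
so the Chebyshev bound holds pointwise in `x` and is integrated against `PX` by Tonelli. -/
theorem vanishes_residual_sum (h : Design G μ Λ s K PX κ Z ηhat f ε B)
    (hw : ∀ n, ∀ i < n, FittedOn (covariateSigma Z n ⊔ G) (w n i))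
    (hV : Vanishes (μ.prod PX) fun n p => ∑ i ∈ Finset.range n, (w n i p.1 p.2 / n) ^ 2) :
    Vanishes (μ.prod PX) fun n p => ∑ i ∈ Finset.range n,
      w n i p.1 p.2 / n * residual Λ κ s (ηhat n (i % K) p.1) (Z i p.1) := by
  refine Vanishes.of_chebyshev (sq_nonneg (2 * phiBound Λ ε B)) h.folds_pos hV
    fun n c δ hc hδ => ?_
  have hwm : ∀ i ∈ Finset.range n, Measurable fun p : Ω × Cov d => w n i p.1 p.2 / n := fun i hi =>
    ((hw n i (Finset.mem_range.1 hi)).measurable_of_le (h.covariateSigma_le' n)).div_const _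
  have hSm : Measurable fun p : Ω × Cov d => ∑ i ∈ Finset.range n,
      w n i p.1 p.2 / n * residual Λ κ s (ηhat n (i % K) p.1) (Z i p.1) :=
    Finset.measurable_fun_sum _ fun i hi =>
      (hwm i hi).mul ((h.measurable_residual n i).comp measurable_fst)
  have hVm : Measurable fun p : Ω × Cov d => ∑ i ∈ Finset.range n, (w n i p.1 p.2 / n) ^ 2 :=
    Finset.measurable_fun_sum _ fun i hi => (hwm i hi).pow_const 2
  rw [Measure.prod_apply_symm (measurableSet_le measurable_const hSm.abs),
    Measure.prod_apply_symm (measurableSet_lt measurable_const hVm)]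
  calc _ ≤ ∫⁻ x, K * (μ {ω | c < ∑ i ∈ Finset.range n, (w n i ω x / n) ^ 2} +
          ENNReal.ofReal ((2 * phiBound Λ ε B) ^ 2 * c / (δ / K) ^ 2)) ∂PX :=
        lintegral_mono fun x => h.measure_residual_sum_ge_le n
          (fun i hi => ((hw n i hi).measurable_section x).div_const _) hc.le hδ
    _ = _ := by
        rw [lintegral_const_mul' _ _ (ENNReal.natCast_ne_top K),
          lintegral_add_right _ measurable_const, lintegral_const, measure_univ, mul_one]
        rfl

theorem vanishes_residual_sum_at (h : Design G μ Λ s K PX κ Z ηhat f ε B)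
    (hw : ∀ n, ∀ i < n, FittedOn (covariateSigma Z n ⊔ G) (w n i)) (x : Cov d)
    (hV : Vanishes μ fun n ω => ∑ i ∈ Finset.range n, (w n i ω x / n) ^ 2) :
    Vanishes μ fun n ω => ∑ i ∈ Finset.range n,
      w n i ω x / n * residual Λ κ s (ηhat n (i % K) ω) (Z i ω) :=
  Vanishes.of_chebyshev (sq_nonneg (2 * phiBound Λ ε B)) h.folds_pos hV fun n _ _ hc hδ =>
    h.measure_residual_sum_ge_le n
      (fun i hi => ((hw n i hi).measurable_section x).div_const _) hc.le hδ

theorem integrable_tauStar (h : Design G μ Λ s K PX κ Z ηhat f ε B) :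
    Integrable (tauStar Λ κ s) PX :=
  Integrable.of_bound (measurable_tauStar κ h.one_le s).aestronglyMeasurable _
    (h.regular.mono fun _ hx => hx.abs_tauStar_le h.one_le s)

/-- Almost sure statements about the covariates of the sample. -/
theorem ae_covariates (h : Design G μ Λ s K PX κ Z ηhat f ε B) {P : Cov d → Prop}
    (hP : ∀ᵐ x ∂PX, P x) : ∀ᵐ ω ∂μ, ∀ i, P (Z i ω).1 := by
  refine ae_all_iff.2 fun i => ?_
  rw [← map_fst_eq (h.measurable i) (h.law i)] at hP
  exact ae_of_ae_map (measurable_fst.comp (h.measurable i)).aemeasurable hP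

/-- Consistency at a random evaluation point. -/
theorem tendstoInMeasure_tauHat (h : Design G μ Λ s K PX κ Z ηhat f ε B)
    (hc : ConsistentNuisances μ Λ s K PX κ ηhat)
    (hw : ∀ n, ∀ i < n, FittedOn (covariateSigma Z n ⊔ G) (w n i))
    (hS : StoneConditions μ PX (fun i ω => (Z i ω).1) (fun n i ω x => w n i ω x / n))
    (hO : IsBigOpOne (μ.prod PX)
      (fun n p => (1 / (n : ℝ)) * ∑ i ∈ Finset.range n, |w n i p.1 p.2|)) :
    TendstoInMeasure (μ.prod PX) (fun n p => tauHat Λ s K Z ηhat w n p.1 p.2) atTop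
      (fun p => sharpCATE Λ κ s p.2) := by
  have hO' := isBigOpOne_weights (w := fun n i (p : Ω × Cov d) => w n i p.1 p.2) hO
  have h1 := h.vanishes_residual_sum hw (hS.limits.sum_sq_vanishes hO')
  have h2 := vanishes_sum_of_uniformly_small hO' (b := fun n i p =>
    condMean Λ κ s (ηhat n (i % K) p.1) (Z i p.1).1 - tauStar Λ κ s (Z i p.1).1) fun δ hδ => by
      refine (h.tendsto_measure_condMean_sub hc hδ).congr fun n => ?_
      have := Measure.prod_prod (μ := μ) (ν := PX) {ω | ¬ ∀ i,
        |condMean Λ κ s (ηhat n (i % K) ω) (Z i ω).1 - tauStar Λ κ s (Z i ω).1| ≤ δ} univ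
      rw [measure_univ, mul_one] at this
      rw [← this]
      congr 1
      ext p; simp
  have h3 := hS.vanishes_sum_sub (fun i => measurable_fst.comp (h.measurable i))
    (fun n i hi => ((hw n i hi).measurable_of_le (h.covariateSigma_le' n)).div_const _) hO'
    (measurable_tauStar κ h.one_le s) h.integrable_tauStar
  refine tendstoInMeasure_iff_vanishes.2 (((h1.add h2).add h3).mono_ae fun n => ?_)
  have hsharp : ∀ᵐ p ∂(μ.prod PX), sharpCATE Λ κ s p.2 = tauStar Λ κ s p.2 := by
    have : ∀ᵐ x ∂PX, sharpCATE Λ κ s x = tauStar Λ κ s x :=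
      h.regular.mono fun x hx => sharpCATE_eq_tauStar h.one_le hx s
    exact Measure.quasiMeasurePreserving_snd.ae this
  filter_upwards [hsharp] with p hp
  rw [hp, tauHat_eq Λ κ, add_sub_assoc]

/-- Consistency at a fixed continuity point of the sharp bound. -/
theorem tendstoInMeasure_tauHat_at (h : Design G μ Λ s K PX κ Z ηhat f ε B)
    (hc : ConsistentNuisances μ Λ s K PX κ ηhat)
    (hw : ∀ n, ∀ i < n, FittedOn (covariateSigma Z n ⊔ G) (w n i)) {x₀ : Cov d}
    (hcont : ContinuousWithinAt (sharpCATE Λ κ s) PX.support x₀)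
    (hO : IsBigOpOne μ (fun n ω => (1 / (n : ℝ)) * ∑ i ∈ Finset.range n, |w n i ω x₀|))
    (hS : StoneLimits μ (fun i ω => (Z i ω).1) (fun _ => x₀) (fun n i ω => w n i ω x₀ / n)) :
    TendstoInMeasure μ (fun n ω => tauHat Λ s K Z ηhat w n ω x₀) atTop
      (fun _ => sharpCATE Λ κ s x₀) := by
  have hO' := isBigOpOne_weights (w := fun n i ω => w n i ω x₀) hO
  have h1 := h.vanishes_residual_sum_at hw x₀ (hS.sum_sq_vanishes hO')
  have h2 := vanishes_sum_of_uniformly_small hO' fun δ hδ => h.tendsto_measure_condMean_sub hc hδ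
  -- The closed form is known only almost everywhere and may fail at `x₀`, so the target stays
  -- `sharpCATE` there. The two functions agree at all sample covariates almost surely.
  have h3 := hS.vanishes_sum_sub hO' (u := fun i ω => tauStar Λ κ s (Z i ω).1)
    (v := fun _ => sharpCATE Λ κ s x₀) (H := max ((2 + 2 * Λ) * B) |sharpCATE Λ κ s x₀|)
    (by
      filter_upwards [h.ae_covariates h.regular] with ω hω i
      exact ((hω i).abs_tauStar_le h.one_le s).trans (le_max_left _ _))
    (Eventually.of_forall fun _ => le_max_right _ _)
    (fun δ hδ => by
      obtain ⟨a, ha, hclose⟩ := Metric.continuousWithinAt_iff.1 hcont δ hδ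
      refine ⟨a / 2, half_pos ha, ?_⟩
      -- The sample covariates almost surely lie in the support, which is why continuity relative to
      -- the support suffices.
      have hsupp : ∀ᵐ x ∂PX, x ∈ PX.support := Measure.support_mem_ae
      filter_upwards [h.ae_covariates h.regular, h.ae_covariates hsupp] with ω hω hωs i hi
      have := hclose (hωs i) (by rw [dist_eq_norm]; linarith)
      rw [Real.dist_eq, sharpCATE_eq_tauStar h.one_le (hω i) s] at this
      exact this.le)
  refine tendstoInMeasure_iff_vanishes.2 (((h1.add h2).add h3).mono_ae fun n => ?_)
  refine Eventually.of_forall fun ω => ?_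
  rw [tauHat_eq Λ κ, add_sub_assoc]

end Design

end BLearner

theorem mainTheorem5 {d : ℕ} {Ω : Type*}
    -- a separate source of randomness, for instance another sample
    (G : MeasurableSpace Ω) [mΩ : MeasurableSpace Ω]
    (μ : Measure Ω) [IsProbabilityMeasure μ]
    -- sensitivity parameter, side of the bound, number of folds
    (Λ : ℝ) (hΛ : 1 ≤ Λ) (s : BLearner.Side) (K : ℕ) (hK : 2 ≤ K)
    -- the law of `X` and the conditional law of `(A, Y)` given `X`
    (PX : Measure (BLearner.Cov d)) [IsProbabilityMeasure PX]
    (κ : Kernel (BLearner.Cov d) (Bool × ℝ)) [IsMarkovKernel κ]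
    -- the i.i.d. sample
    (Z : ℕ → Ω → BLearner.Obs d) (hZ : ∀ i, Measurable (Z i)) (hZindep : iIndepFun Z μ)
    (hZlaw : ∀ i, μ.map (Z i) = PX.compProd κ)
    -- the separate randomness is independent of the sample
    (hG : G ≤ mΩ)
    (hGindep : Indep G (⨆ i, MeasurableSpace.comap (Z i) inferInstance) μ)
    -- cross-fitted nuisance estimates and weights
    (ηhat : ℕ → ℕ → Ω → BLearner.Nuisances d)
    (hη : ∀ n, ∀ k < K, BLearner.NuisancesFittedOn (BLearner.trainSigma K Z n k ⊔ G) (ηhat n k))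
    (w : ℕ → ℕ → Ω → BLearner.Cov d → ℝ)
    (hw : ∀ n, ∀ i < n, BLearner.FittedOn (BLearner.covariateSigma Z n ⊔ G) (w n i))
    -- boundedness
    (f : BLearner.Cov d → Bool → ℝ → ℝ) (hf : ∀ x a, Measurable (f x a))
    (hdens : ∀ᵐ x ∂PX, ∀ a,
      BLearner.outcomeLaw κ x a = volume.withDensity (fun y => ENNReal.ofReal (f x a y)))
    (ε B : ℝ) (hε : 0 < ε)
    (hY : ∀ᵐ z ∂(PX.compProd κ), |z.2.2| ≤ B)
    (hbdd : ∀ n, ∀ k < K, ∀ᵐ ω ∂μ, ∀ᵐ x ∂PX, BLearner.BoundedAt Λ κ s f ε B (ηhat n k ω) x)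
    -- conditions on the weights
    (hStone : BLearner.StoneConditions μ PX (fun i ω => (Z i ω).1) (fun n i ω x => w n i ω x / n))
    (hOp : BLearner.IsBigOpOne (μ.prod PX)
      (fun n p => (1 / (n : ℝ)) * ∑ i ∈ Finset.range n, |w n i p.1 p.2|))
    -- uniform consistency of the quantiles, and of the propensity score or the `ρ` estimates
    (hq : ∀ k < K,
      BLearner.UniformlyConsistent μ PX (fun n ω => (ηhat n k ω).q1)
        (fun x => BLearner.qStar Λ κ s x true) ∧
      BLearner.UniformlyConsistent μ PX (fun n ω => (ηhat n k ω).q0)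
        (fun x => BLearner.qStar Λ κ s.flip x false))
    (heρ : (∀ k < K, BLearner.UniformlyConsistent μ PX (fun n ω => (ηhat n k ω).e)
        (BLearner.propensity κ)) ∨
      (∀ k < K,
        BLearner.UniformlyConsistent μ PX (fun n ω => (ηhat n k ω).rho1)
          (fun x => BLearner.rhoStar Λ κ s x true) ∧
        BLearner.UniformlyConsistent μ PX (fun n ω => (ηhat n k ω).rho0)
          (fun x => BLearner.rhoStar Λ κ s.flip x false))) :
    -- consistency at a random evaluation point, the mode of convergence of Stone's theorem
    TendstoInMeasure (μ.prod PX)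
      (fun n p => BLearner.tauHat Λ s K Z ηhat w n p.1 p.2) atTop
      (fun p => BLearner.sharpCATE Λ κ s p.2) ∧
    -- consistency at every fixed continuity point (on the support of `PX`) at which the weights localize
    ∀ x₀ : BLearner.Cov d, ContinuousWithinAt (BLearner.sharpCATE Λ κ s) PX.support x₀ →
      BLearner.IsBigOpOne μ (fun n ω => (1 / (n : ℝ)) * ∑ i ∈ Finset.range n, |w n i ω x₀|) →
      BLearner.StoneLimits μ (fun i ω => (Z i ω).1) (fun _ => x₀) (fun n i ω => w n i ω x₀ / n) →
      TendstoInMeasure μ (fun n ω => BLearner.tauHat Λ s K Z ηhat w n ω x₀) atTop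
        (fun _ => BLearner.sharpCATE Λ κ s x₀) := by
  have hregular : ∀ᵐ x ∂PX, BLearner.RegularAt κ B x := by
    -- The bounds on the true propensity score do not involve the estimates, so a single realization
    -- of a single fit provides them.
    obtain ⟨ω, hω⟩ := (hbdd 0 0 (by omega)).exists
    filter_upwards [hω, hdens, Measure.ae_ae_of_ae_compProd hY] with x h1 h2 h3
    refine ⟨⟨hε.trans_le h1.e_star.1, by linarith [h1.e_star.2]⟩, fun a => ⟨fun y => ?_⟩, h3⟩
    rw [h2 a]
    exact withDensity_absolutelyContinuous _ _ (measure_singleton y)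
  have hdesign : BLearner.Design G μ Λ s K PX κ Z ηhat f ε B :=
    ⟨hΛ, hε, by omega, hZ, hZindep, hZlaw, hG, hGindep, hη, hregular, hbdd⟩
  have hcons : BLearner.ConsistentNuisances μ Λ s K PX κ ηhat := ⟨hq, heρ⟩
  exact ⟨hdesign.tendstoInMeasure_tauHat hcons hw hStone hOp, fun x₀ hcont hO hS =>
    hdesign.tendstoInMeasure_tauHat_at hcons hw hcont hO hS⟩
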